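/- **Setting.** Let $\mathcal I$ be a finite set of vehicles containing the vehicle $1$ immediately ahead of the truck. Fix $\alpha\in\mathbb R$, a powertrain delay $\sigma>0$, times $t_0<t_{\rm f}$, and range policy data $h_{\rm st}<h^*<h_{\rm go}$, $v_{\max}>0$; put $\kappa=v_{\max}/(h_{\rm go}-h_{\rm st})$ and $v^*=V(h^*)$, where $V(h)=\max\{0,\min\{\kappa(h-h_{\rm st}),v_{\max}\}\}$. The inputs $(\tilde v_i)_{i\in\mathcal I}$ are real processes on $\mathbb R$ that are jointly Gaussian, of zero mean, jointly wide-sense stationary (WSS) and mean-square differentiable, and their cross-correlations $R_{ij}(\tau)=\mathbb E[\tilde v_i(t+\tau)\tilde v_j(t)]$ are integrable, so that the (cross) power spectral densities $S_{\tilde v_i\tilde v_j}(\omega)=\int_{-\infty}^{\infty}R_{ij}(\tau)e^{-\mathrm j\omega\tau}\,d\tau$ exist. The control parameters are gains $\beta=(\beta_i)_{i\in\mathcal I}$, real, and additional delays $(\sigma_i)_{i\in\mathcal I}$ with $\sigma_i\ge 0$ and $\sigma_1=0$. The linearized dynamics are $$\dot{\tilde h}(t)=\tilde v_1(t)-\tilde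 v(t),\qquad \dot{\tilde v}(t)=\alpha\big(\kappa\tilde h(t-\sigma)-\tilde v(t-\sigma)\big)+\sum_{i\in\mathcal I}\beta_i\big(\tilde v_i(t-(\sigma+\sigma_i))-\tilde v(t-\sigma)\big).$$ A *steady-state response* is a solution $(\tilde h,\tilde v)$, in the mean-square sense and for all $t\in\mathbb R$, whose second moments are bounded uniformly in $t$, with $(t,\omega)\mapsto\tilde v$ and $\dot{\tilde v}$ jointly measurable. With $v=v^*+\tilde v$, the energy consumption is $\bar w=\int_{t_0}^{t_{\rm f}}v(t)\max\{\dot v(t),0\}\,dt$. Let $\mathcal D(s)=s^2e^{s\sigma}+\big(\alpha+\sum_{i}\beta_i\big)s+\alpha\kappa$, $T_1(s)=\dfrac{\beta_1s+\alpha\kappa}{\mathcal D(s)}$ and $T_i(s)=\dfrac{\beta_ise^{-s\sigma_i}}{\mathcal D(s)}$ for $i\ne1$. The gains are *plant stable* if every root of $\mathcal D$ has negative real part. Let $\Omega$ be the set of gains for which $\alpha>0$ and $$\underline\omega\sin(\underline\omega\sigma)-\alpha<\sum_{i\in\mathcal I}\beta_i<\overline\omega\sin(\overline\omega\sigma)-\alpha,$$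 where $\underline\omega<\overline\omega$ are two solutions of $\alpha\kappa=\omega^2\cos(\omega\sigma)$ with $0<\omega\sigma<\pi/2$ (so $\Omega=\emptyset$ if there are no two such solutions). Put $$J=\sum_{i,j\in\mathcal I}\int_0^\infty\omega^2\,T_i(\mathrm j\omega)\,T_j^*(\mathrm j\omega)\,S_{\tilde v_i\tilde v_j}(\omega)\,d\omega .$$ **Corollary.** For plant-stable parameters a steady-state response with WSS speed perturbation $\tilde v$ exists, all integrals in $J$ converge absolutely, $J$ is real and nonnegative, and every steady-state response has almost surely a well-defined and integrable energy consumption $\bar w$ with $$\mathbb E[\bar w]=(t_{\rm f}-t_0)\,\frac{v^*}{\sqrt{2\pi}}\,\sqrt{J/\pi},$$ an increasing function of $J$. Consequently the parameters $(\beta_i,\sigma_i)_{i\in\mathcal I}$ that minimize $\mathbb E[\bar w]$ (evaluated on steady-state responses) among the plant-stable parameters are exactly the solutions of $$\min_{(\beta_i,\sigma_i)}J\quad\text{subject to}\quad(\beta_i)\in\Omega .$$ -/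

import Mathlib

open MeasureTheory ProbabilityTheory Filter Topology

noncomputable section

namespace CCC

/-! ### Range policy and equilibrium -/

/-- Gradient `κ = v_max / (h_go - h_st)` of the range policy. -/
def rangeGradient (hst hgo vmax : ℝ) : ℝ := vmax / (hgo - hst)

/-- Range policy `V(h) = max {0, min {κ (h - h_st), v_max}}`. -/
def rangePolicy (hst hgo vmax h : ℝ) : ℝ :=
  max 0 (min (rangeGradient hst hgo vmax * (h - hst)) vmax)

/-! ### Second order stochastic processes -/

section Processes

variable {Ω : Type*} [MeasurableSpace Ω]

/-- `Y` is the mean-square derivative of the process `X` at time `t`. -/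
def HasMSDerivAt (P : Measure Ω) (X : ℝ → Ω → ℝ) (Y : Ω → ℝ) (t : ℝ) : Prop :=
  Tendsto (fun δ : ℝ => eLpNorm (fun ω => (X (t + δ) ω - X t ω) / δ - Y ω) 2 P)
    (𝓝[≠] 0) (𝓝 0)

/-- Mean-square differentiability on the whole time axis. -/
def MSDifferentiable (P : Measure Ω) (X : ℝ → Ω → ℝ) : Prop :=
  ∃ Y : ℝ → Ω → ℝ, ∀ t, MemLp (Y t) 2 P ∧ HasMSDerivAt P X (Y t) t

/-- Wide-sense stationarity: finite second moments, constant mean, and an autocorrelation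
`E[X_s X_t]` that depends on `t - s` only. -/
def IsWSS (P : Measure Ω) (X : ℝ → Ω → ℝ) : Prop :=
  (∀ t, MemLp (X t) 2 P) ∧
  (∃ m : ℝ, ∀ t, ∫ ω, X t ω ∂P = m) ∧
  (∃ r : ℝ → ℝ, ∀ s t, ∫ ω, X s ω * X t ω ∂P = r (t - s))

/-- Cross-correlation function `R_{XY}(τ) = E[X_{t+τ} Y_t]` of jointly wide-sense stationary
processes, evaluated at `t = 0`. -/
def crossCorr (P : Measure Ω) (X Y : ℝ → Ω → ℝ) (τ : ℝ) : ℝ :=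
  ∫ ω, X τ ω * Y 0 ω ∂P

/-- Cross power spectral density, the Fourier transform of the cross-correlation in the
angular frequency `w`. -/
def crossPSD (P : Measure Ω) (X Y : ℝ → Ω → ℝ) (w : ℝ) : ℂ :=
  ∫ τ : ℝ, (crossCorr P X Y τ : ℂ) * Complex.exp (-(Complex.I * w * τ))

/-- The inputs: a family of zero-mean, jointly Gaussian, jointly wide-sense stationary,
mean-square differentiable processes. -/
structure IsGaussianInput {ι : Type*} (P : Measure Ω) (X : ι → ℝ → Ω → ℝ) : Prop where
  gaussian : IsGaussianProcess (fun p : ι × ℝ => X p.1 p.2) P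
  zero_mean : ∀ i t, ∫ ω, X i t ω ∂P = 0
  wss : ∀ i, IsWSS P (X i)
  jointly_wss : ∀ i j s t, ∫ ω, X i s ω * X j t ω ∂P = crossCorr P (X i) (X j) (s - t)
  ms_differentiable : ∀ i, MSDifferentiable P (X i)

/-- Surrogate energy consumption `∫_{t₀}^{t_f} v g(v̇) dt` with `g(x) = max {x, 0}`, for the
speed `v = v* + ṽ`; here `v` is the speed perturbation and `a` its derivative. -/
def energy (vStar t₀ tf : ℝ) (v a : ℝ → Ω → ℝ) (ω : Ω) : ℝ :=
  ∫ t in t₀..tf, (vStar + v t ω) * max (a t ω) 0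

/-- `(h, v)` is a steady-state response of the linearized closed loop to the inputs `X`, with
acceleration `a`: the delay differential equations hold in mean square at all times of the real
line, and the second moments stay bounded. `κ` is the gradient of the range policy, `σ` the
powertrain delay, `lead` the vehicle immediately ahead, `β` the gains and `d` the additional
delays. -/
structure IsSteadyState {ι : Type*} [Fintype ι] (P : Measure Ω) (α κ σ : ℝ) (lead : ι)
    (β d : ι → ℝ) (X : ι → ℝ → Ω → ℝ) (h v a : ℝ → Ω → ℝ) : Prop where
  measurable_v : Measurable (Function.uncurry v)
  measurable_a : Measurable (Function.uncurry a)
  memLp_h : ∀ t, MemLp (h t) 2 P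
  memLp_v : ∀ t, MemLp (v t) 2 P
  memLp_a : ∀ t, MemLp (a t) 2 P
  headway : ∀ t, HasMSDerivAt P h (fun ω => X lead t ω - v t ω) t
  speed : ∀ t, HasMSDerivAt P v (a t) t
  accel : ∀ t, a t =ᵐ[P] fun ω =>
    α * (κ * h (t - σ) ω - v (t - σ) ω)
      + ∑ i, β i * (X i (t - (σ + d i)) ω - v (t - σ) ω)
  bounded : ∃ C : ℝ, ∀ t, ∫ ω, h t ω ^ 2 ∂P ≤ C ∧ ∫ ω, v t ω ^ 2 ∂P ≤ C

end Processes

/-! ### Transfer functions, plant stability, objective -/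

section Frequency

variable {ι : Type*} [Fintype ι]

/-- Characteristic function `D(s) = s² e^{sσ} + (α + ∑ β_i) s + α κ`. -/
def charD (α κ σ : ℝ) (β : ι → ℝ) (s : ℂ) : ℂ :=
  s ^ 2 * Complex.exp (s * σ) + ((α : ℂ) + ∑ i, (β i : ℂ)) * s + (α : ℂ) * κ

/-- Plant stability: all roots of the characteristic equation have negative real parts. -/
def PlantStable (α κ σ : ℝ) (β : ι → ℝ) : Prop :=
  ∀ s : ℂ, charD α κ σ β s = 0 → s.re < 0

/-- The plant stable region `Ω`, in terms of the two solutions `ω₁ < ω₂` of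
`α κ = ω² cos (ω σ)` with `0 < ω σ < π / 2`. -/
def plantStableRegion (α κ σ : ℝ) : Set (ι → ℝ) :=
  {β | 0 < α ∧ ∃ ω₁ ω₂ : ℝ, 0 < ω₁ ∧ ω₁ < ω₂ ∧ ω₂ * σ < Real.pi / 2 ∧
    α * κ = ω₁ ^ 2 * Real.cos (ω₁ * σ) ∧ α * κ = ω₂ ^ 2 * Real.cos (ω₂ * σ) ∧
    ω₁ * Real.sin (ω₁ * σ) - α < ∑ i, β i ∧ ∑ i, β i < ω₂ * Real.sin (ω₂ * σ) - α}

/-- Delays are nonnegative, and the response to the vehicle immediately ahead carries no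
additional delay. -/
def AdmissibleDelays (lead : ι) (d : ι → ℝ) : Prop :=
  d lead = 0 ∧ ∀ i, 0 ≤ d i

open Classical in
/-- Link transfer functions `T_i(s)`. -/
def linkTransfer (α κ σ : ℝ) (lead : ι) (β d : ι → ℝ) (i : ι) (s : ℂ) : ℂ :=
  if i = lead then ((β lead : ℂ) * s + (α : ℂ) * κ) / charD α κ σ β s
  else (β i : ℂ) * s * Complex.exp (-(s * d i)) / charD α κ σ β s

/-- The summand `ω² T_i(jω) T_j*(jω) S_ij(ω)` of the objective. -/
def costIntegrand (α κ σ : ℝ) (lead : ι) (S : ι → ι → ℝ → ℂ) (β d : ι → ℝ) (i j : ι)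
    (w : ℝ) : ℂ :=
  (w : ℂ) ^ 2 * linkTransfer α κ σ lead β d i (Complex.I * w)
    * (starRingEnd ℂ) (linkTransfer α κ σ lead β d j (Complex.I * w)) * S i j w

/-- The objective `J = ∑_{i,j} ∫_0^∞ ω² T_i(jω) T_j*(jω) S_ij(ω) dω`. -/
def cost (α κ σ : ℝ) (lead : ι) (S : ι → ι → ℝ → ℂ) (β d : ι → ℝ) : ℂ :=
  ∑ i, ∑ j, ∫ w in Set.Ioi (0 : ℝ), costIntegrand α κ σ lead S β d i j w

end Frequency

end CCC

end

open scoped FourierTransform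

/-! ### Plant stability, sufficiency: the region excludes roots with nonnegative real part. -/

noncomputable section

namespace CCC

/-! The theorem has two independent halves: a root-location statement for a quasi-polynomial, and a
formula for the expected energy of a stationary Gaussian response.

Root location (`plantStable_iff_mem_plantStableRegion`). Rescaling time by `σ` turns the
characteristic function into z² e^z + p z + q. In the region one can write p = w sin w with q < w²
cos w; comparing moduli and then arguments rules out roots with Re z ≥ 0 (`quasiPoly_no_root`).
Conversely, the two real equations for a root x + iy are linear in (p, q). For fixed q > 0,
following the curve of points x ≥ 0, 0 ≤ y < π whose second coefficient is q, and applying the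
intermediate value theorem to p along it, produces an unstable root for every (p, q) outside the
region (`region_of_no_root`).

Energy. The processes are regarded as curves in the Hilbert space L²(P), so mean-square calculus
becomes ordinary calculus. Stability makes D zero-free on the imaginary axis, hence 1/D and s/D are
Fourier transforms of integrable kernels (`exists_kernels`). Convolution with them gives a bounded
solution, and the same kernels show that it is the only bounded one (`eq_response`). Its speed and
acceleration are linear filters of the inputs. Fubini's theorem expresses their correlations through
the spectral densities (`IsStationaryFamily.inner_filter`); these are positive semidefinite as
matrices and integrable by a Bochner-type argument (`spectral_nonneg`, `integrable_spectrum`). In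
particular E[a²] = J/π (`norm_sq_accel`).

Filter outputs lie in the closed span of the inputs, so they are centered and jointly Gaussian.
Since E[v²] is constant in time, v and a are uncorrelated, therefore independent, and E[(v* + v)
max(a, 0)] = v* √(E[a²]) / √(2π). Fubini over time gives the energy formula. It is a positive
multiple of √J, and the two feasible sets coincide, so the two minimization problems have the same
solutions. -/

lemma mul_cos_mul_sin_le {y w : ℝ} (hy : 0 < y) (hyw : y ≤ w) (hw : w < Real.pi / 2) :
    w * Real.cos w * Real.sin y ≤ y * Real.cos y * Real.sin w := by
  rcases hyw.eq_or_lt with rfl | hlt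
  · exact le_of_eq (by ring)
  -- Concavity of sin with sin 0 = 0 makes sin t / t decreasing on (0, π). Compared at w - y and w +
  -- y and expanded, this says exactly that t cot t decreases.
  have h1 : (w - y) * Real.sin (w + y) ≤ (w + y) * Real.sin (w - y) := by
    have hv : 0 < w + y := by linarith
    have := strictConcaveOn_sin_Icc.concaveOn.2 (x := w + y) (y := 0)
      ⟨by linarith, by linarith⟩ ⟨le_rfl, Real.pi_pos.le⟩
      (div_nonneg (by linarith : 0 ≤ w - y) hv.le) (div_nonneg (by linarith : 0 ≤ 2 * y) hv.le)
      (by field_simp; ring)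
    simp only [smul_eq_mul, Real.sin_zero, mul_zero, add_zero] at this
    rw [div_mul_cancel₀ _ hv.ne', div_mul_eq_mul_div, div_le_iff₀ hv] at this
    linarith
  rw [Real.sin_add, Real.sin_sub] at h1
  nlinarith

/-- The function 2 log t + log (cos t) is strictly concave on (0, π/2), so between two points where
it takes the same value it is strictly larger. -/
lemma lt_sq_mul_cos {y₁ y y₂ q : ℝ} (h0 : 0 < y₁) (h1 : y₁ < y) (h2 : y < y₂)
    (h3 : y₂ < Real.pi / 2) (hq1 : q = y₁ ^ 2 * Real.cos y₁) (hq2 : q = y₂ ^ 2 * Real.cos y₂) :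
    q < y ^ 2 * Real.cos y := by
  have hc : ∀ t, 0 < t → t < Real.pi / 2 → 0 < Real.cos t := fun t h h' =>
    Real.cos_pos_of_mem_Ioo ⟨by linarith, h'⟩
  have hc1 := hc y₁ h0 (by linarith)
  have hc2 := hc y₂ (by linarith) h3
  have hc0 := hc y (by linarith) (by linarith)
  have hqpos : 0 < q := by rw [hq1]; positivity
  obtain ⟨a, b, ha, hb, hab, hy⟩ : ∃ a b : ℝ, 0 < a ∧ 0 < b ∧ a + b = 1 ∧ a * y₁ + b * y₂ = y := by
    refine ⟨(y₂ - y) / (y₂ - y₁), (y - y₁) / (y₂ - y₁), div_pos (by linarith) (by linarith),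
      div_pos (by linarith) (by linarith), ?_, ?_⟩ <;>
    · have : y₂ - y₁ ≠ 0 := by linarith
      field_simp
      ring
  have hlog : a * Real.log y₁ + b * Real.log y₂ < Real.log y := by
    have := strictConcaveOn_log_Ioi.2 (Set.mem_Ioi.2 h0) (Set.mem_Ioi.2 (by linarith : 0 < y₂))
      (by linarith) ha hb hab
    simpa [hy] using this
  have hcos : a * Real.cos y₁ + b * Real.cos y₂ ≤ Real.cos y := by
    have := strictConcaveOn_cos_Icc.concaveOn.2 (x := y₁) (y := y₂)
      ⟨by linarith, by linarith⟩ ⟨by linarith, by linarith⟩ ha.le hb.le hab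
    simpa [hy] using this
  have hlogc : a * Real.log (Real.cos y₁) + b * Real.log (Real.cos y₂) ≤ Real.log (Real.cos y) := by
    have h := strictConcaveOn_log_Ioi.concaveOn.2 (Set.mem_Ioi.2 hc1) (Set.mem_Ioi.2 hc2)
      ha.le hb.le hab
    simp only [smul_eq_mul] at h
    exact h.trans (Real.log_le_log (by positivity) hcos)
  have e : ∀ t, 0 < t → 0 < Real.cos t →
      Real.log (t ^ 2 * Real.cos t) = 2 * Real.log t + Real.log (Real.cos t) := fun t h h' => by
    rw [Real.log_mul (by positivity) h'.ne', Real.log_pow]; norm_num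
  have l1 := e y₁ h0 hc1
  have l2 := e y₂ (by linarith) hc2
  rw [← hq1] at l1
  rw [← hq2] at l2
  have hy0 : 0 < y := by linarith
  rw [← Real.log_lt_log_iff hqpos (by positivity), e y hy0 hc0]
  have hb' : b = 1 - a := by linarith
  calc Real.log q = a * Real.log q + b * Real.log q := by rw [← add_mul, hab, one_mul]
    _ = a * (2 * Real.log y₁ + Real.log (Real.cos y₁))
        + b * (2 * Real.log y₂ + Real.log (Real.cos y₂)) := by rw [← l1, ← l2]
    _ < _ := by linarith

/-- The characteristic quasi-polynomial with unit delay. -/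
def quasiPoly (p q : ℝ) (z : ℂ) : ℂ := z ^ 2 * Complex.exp z + p * z + q

lemma quasiPoly_eq (p q x y : ℝ) : quasiPoly p q (x + y * Complex.I) =
    ((Real.exp x * ((x ^ 2 - y ^ 2) * Real.cos y - 2 * x * y * Real.sin y) + p * x + q : ℝ) : ℂ)
    + ((Real.exp x * ((x ^ 2 - y ^ 2) * Real.sin y + 2 * x * y * Real.cos y) + p * y : ℝ) : ℂ)
      * Complex.I := by
  have h2 : Complex.I ^ 2 = -1 := Complex.I_sq
  rw [quasiPoly, Complex.exp_add, Complex.exp_mul_I]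
  push_cast
  linear_combination (Complex.exp x * (Complex.cos y * y ^ 2 + 2 * x * y * Complex.sin y
    + y ^ 2 * Complex.sin y * Complex.I)) * h2

lemma quasiPoly_eq_zero_iff (p q x y : ℝ) : quasiPoly p q (x + y * Complex.I) = 0 ↔
    Real.exp x * ((x ^ 2 - y ^ 2) * Real.cos y - 2 * x * y * Real.sin y) + p * x + q = 0 ∧
    Real.exp x * ((x ^ 2 - y ^ 2) * Real.sin y + 2 * x * y * Real.cos y) + p * y = 0 := by
  rw [quasiPoly_eq, Complex.ext_iff]
  simp [-Complex.ofReal_mul, -Complex.ofReal_add, -Complex.ofReal_exp]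

/-- At z = iw the imaginary part vanishes, because p = w sin w, and the real part q - w² cos w is
negative. A root with x, y ≥ 0 is first confined to |z| < w by comparing moduli; then p and q are
compared with the values forced by the root, through the monotonicity of t cot t. -/
lemma quasiPoly_no_root {w p q x y : ℝ} (hw0 : 0 < w) (hw : w < Real.pi / 2)
    (hp : p = w * Real.sin w) (hq0 : 0 < q) (hq : q < w ^ 2 * Real.cos w)
    (hx : 0 ≤ x) (hy : 0 ≤ y)
    (h1 : Real.exp x * ((x ^ 2 - y ^ 2) * Real.cos y - 2 * x * y * Real.sin y) + p * x + q = 0)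
    (h2 : Real.exp x * ((x ^ 2 - y ^ 2) * Real.sin y + 2 * x * y * Real.cos y) + p * y = 0) :
    False := by
  have hsw : 0 < Real.sin w := Real.sin_pos_of_pos_of_lt_pi hw0 (by linarith)
  have hcw : 0 < Real.cos w := Real.cos_pos_of_mem_Ioo ⟨by linarith, hw⟩
  have hp0 : 0 < p := by rw [hp]; positivity
  have hE : 1 + x ≤ Real.exp x := by linarith [Real.add_one_le_exp x]
  have hE2 : 1 + 2 * x ≤ Real.exp x ^ 2 := by nlinarith
  set E := Real.exp x
  -- Squared moduli of the two sides of z² e^z = -(p z + q).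
  have hmod : E ^ 2 * (x ^ 2 + y ^ 2) ^ 2 = (p * x + q) ^ 2 + p ^ 2 * y ^ 2 := by
    have e1 : p * x + q = -(E * ((x ^ 2 - y ^ 2) * Real.cos y - 2 * x * y * Real.sin y)) := by
      linarith
    have e2 : p * y = -(E * ((x ^ 2 - y ^ 2) * Real.sin y + 2 * x * y * Real.cos y)) := by
      linarith
    have := Real.sin_sq_add_cos_sq y
    rw [show p ^ 2 * y ^ 2 = (p * y) ^ 2 by ring, e1, e2]
    linear_combination (-(E ^ 2 * (x ^ 2 + y ^ 2) ^ 2)) * this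
  set R := x ^ 2 + y ^ 2 with hR
  have hR0 : 0 ≤ R := by positivity
  -- If R ≥ w², the left side of `hmod` is at least (1 + 2x) R². The right side p² R + 2pqx + q² is
  -- smaller than R² sin² w + 2 R² x + R² cos² w, which is the same quantity.
  have hRw : R < w ^ 2 := by
    by_contra! hcon
    have hq2 : q ^ 2 < (w ^ 2 * Real.cos w) ^ 2 := by gcongr
    have hsc := Real.sin_sq_add_cos_sq w
    have a1 : E ^ 2 * R ^ 2 = p ^ 2 * R + 2 * p * q * x + q ^ 2 := by rw [hmod, hR]; ring
    have a2 : (1 + 2 * x) * R ^ 2 ≤ E ^ 2 * R ^ 2 := by gcongr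
    have a3 : p ^ 2 * R ≤ R ^ 2 * Real.sin w ^ 2 := by
      have : w ^ 2 * R ≤ R * R := by gcongr
      calc p ^ 2 * R = (w ^ 2 * R) * Real.sin w ^ 2 := by rw [hp]; ring
        _ ≤ R * R * Real.sin w ^ 2 := by gcongr
        _ = _ := by ring
    have hw4 : w ^ 2 * w ^ 2 ≤ R ^ 2 := by rw [pow_two R]; gcongr
    have a4 : p * q ≤ R ^ 2 := by
      calc p * q ≤ (w * w) * (w ^ 2 * 1) := by
            rw [hp]
            gcongr
            · exact Real.sin_le hw0.le
            · exact hq.le.trans (by gcongr; exact Real.cos_le_one w)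
        _ = w ^ 2 * w ^ 2 := by ring
        _ ≤ R ^ 2 := hw4
    have a5 : q ^ 2 < R ^ 2 * Real.cos w ^ 2 := by
      calc q ^ 2 < (w ^ 2 * Real.cos w) ^ 2 := hq2
        _ = w ^ 2 * w ^ 2 * Real.cos w ^ 2 := by ring
        _ ≤ _ := by gcongr
    have a6 : p * q * x ≤ R ^ 2 * x := by gcongr
    have a7 : R ^ 2 * Real.sin w ^ 2 + R ^ 2 * Real.cos w ^ 2 = R ^ 2 := by
      rw [← mul_add, hsc, mul_one]
    linarith
  have hyw : y < w := by
    have : y ^ 2 < w ^ 2 := by linarith [sq_nonneg x]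
    exact lt_of_pow_lt_pow_left₀ 2 hw0.le this
  rcases hy.eq_or_lt with rfl | hy
  · simp at h1
    have h3 : 0 ≤ E * x ^ 2 := by positivity
    have h4 : 0 ≤ p * x := by positivity
    linarith
  have hs : 0 < Real.sin y := Real.sin_pos_of_pos_of_lt_pi hy (by linarith)
  have hc : 0 < Real.cos y := Real.cos_pos_of_mem_Ioo ⟨by linarith, by linarith⟩
  have hkey := mul_cos_mul_sin_le hy hyw.le hw
  have hE0 : 0 < E := Real.exp_pos x
  -- The root equations solved for q and p; the combination y · (real part) - x · (imaginary part)
  -- eliminates p.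
  have b1 : q * y = E * (x ^ 2 + y ^ 2) * (x * Real.sin y + y * Real.cos y) := by
    linear_combination y * h1 - x * h2
  have b2 : p * y = E * ((y ^ 2 - x ^ 2) * Real.sin y - 2 * x * y * Real.cos y) := by
    linear_combination h2
  have b3 : p * (y * Real.cos y) ≤ q * Real.sin y := by
    have c1 : p * y ≤ E * (y ^ 2 * Real.sin y) := by
      rw [b2]
      gcongr
      have h3 : 0 ≤ x * y * Real.cos y := by positivity
      have h4 : 0 ≤ x ^ 2 * Real.sin y := by positivity
      linarith
    have c2 : E * y ^ 2 * (y * Real.cos y) ≤ q * y := by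
      rw [b1]
      gcongr
      · exact le_add_of_nonneg_left (sq_nonneg x)
      · exact le_add_of_nonneg_left (mul_nonneg hx hs.le)
    have : y * (p * (y * Real.cos y)) ≤ y * (q * Real.sin y) := by
      calc y * (p * (y * Real.cos y)) = (p * y) * (y * Real.cos y) := by ring
        _ ≤ E * (y ^ 2 * Real.sin y) * (y * Real.cos y) := by gcongr
        _ = E * y ^ 2 * (y * Real.cos y) * Real.sin y := by ring
        _ ≤ q * y * Real.sin y := by gcongr
        _ = _ := by ring
    exact le_of_mul_le_mul_left this hy
  -- The ratio p / q is at most tan y / y by `b3`, while p = w sin w and q < w² cos w force it above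
  -- tan w / w. In product form the two contradict the monotonicity of t cot t.
  have d1 : p * (w * Real.cos w * Real.sin y) ≤ q * Real.sin y * Real.sin w := by
    calc p * (w * Real.cos w * Real.sin y) ≤ p * (y * Real.cos y * Real.sin w) := by gcongr
      _ = p * (y * Real.cos y) * Real.sin w := by ring
      _ ≤ _ := by gcongr
  have d2 : q * Real.sin y * Real.sin w < p * (w * Real.cos w * Real.sin y) := by
    calc q * Real.sin y * Real.sin w < w ^ 2 * Real.cos w * Real.sin y * Real.sin w := by gcongr
      _ = _ := by rw [hp]; ring
  linarith

end CCC

/-! ### Plant stability, necessity: unstable roots outside the region. -/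

noncomputable section

namespace CCC

/-- The value of `q` for which `x + iy` is a root of `quasiPoly p q`, for a suitable `p`. -/
def rootQ (x y : ℝ) : ℝ := Real.exp x * (x ^ 2 + y ^ 2) * (x * Real.sinc y + Real.cos y)

/-- The value of `p` for which `x + iy` is a root of `quasiPoly p q`, for a suitable `q`. -/
def rootP (x y : ℝ) : ℝ :=
  Real.exp x * ((y ^ 2 - x ^ 2) * Real.sinc y - 2 * x * Real.cos y)

lemma mul_sinc_eq_sin (y : ℝ) : y * Real.sinc y = Real.sin y := by
  rcases eq_or_ne y 0 with rfl | h
  · simp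
  · rw [Real.sinc_of_ne_zero h]; field_simp

/-- The root equations are linear in (p, q). Writing their solution with `sinc` keeps it meaningful
at y = 0, where it describes a double real root. -/
lemma quasiPoly_rootP_rootQ (x y : ℝ) :
    quasiPoly (rootP x y) (rootQ x y) (x + y * Complex.I) = 0 := by
  rw [quasiPoly_eq_zero_iff, ← mul_sinc_eq_sin, rootP, rootQ]
  constructor <;> ring

lemma continuous_rootQ : Continuous fun p : ℝ × ℝ => rootQ p.1 p.2 := by
  have := Real.continuous_sinc
  unfold rootQ; fun_prop

lemma continuous_rootP : Continuous fun p : ℝ × ℝ => rootP p.1 p.2 := by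
  have := Real.continuous_sinc
  unfold rootP; fun_prop

lemma sinc_pos {y : ℝ} (h0 : 0 ≤ y) (h : y < Real.pi) : 0 < Real.sinc y := by
  rcases h0.eq_or_lt with rfl | h0
  · simp
  · rw [Real.sinc_of_ne_zero h0.ne']
    exact div_pos (Real.sin_pos_of_pos_of_lt_pi h0 h) h0

/-- Positivity of the value forces the factor x sinc y + cos y to be positive; after that every
factor grows with x. -/
lemma rootQ_lt_rootQ {x x' y : ℝ} (hy0 : 0 ≤ y) (hy : y < Real.pi) (hx : 0 ≤ x) (hxx : x < x')
    (h : 0 < rootQ x y) : rootQ x y < rootQ x' y := by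
  have hk := sinc_pos hy0 hy
  unfold rootQ at *
  have hu : 0 < x * Real.sinc y + Real.cos y := by
    by_contra! hcon
    have : 0 ≤ Real.exp x * (x ^ 2 + y ^ 2) := by positivity
    nlinarith
  have hr : 0 < x' ^ 2 + y ^ 2 := by
    have : 0 < x' := by linarith
    positivity
  calc Real.exp x * (x ^ 2 + y ^ 2) * (x * Real.sinc y + Real.cos y)
      ≤ Real.exp x * (x' ^ 2 + y ^ 2) * (x' * Real.sinc y + Real.cos y) := by gcongr
    _ < _ := by
      have : 0 < x' * Real.sinc y + Real.cos y := hu.trans (by gcongr)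
      gcongr

lemma rootQ_inj {x x' y : ℝ} (hy0 : 0 ≤ y) (hy : y < Real.pi) (hx : 0 ≤ x) (hx' : 0 ≤ x')
    (h : 0 < rootQ x y) (heq : rootQ x y = rootQ x' y) : x = x' := by
  rcases lt_trichotomy x x' with h1 | h1 | h1
  · exact absurd heq (rootQ_lt_rootQ hy0 hy hx h1 h).ne
  · exact h1
  · exact absurd heq (rootQ_lt_rootQ hy0 hy hx' h1 (heq ▸ h)).ne'

lemma exists_rootQ_eq {q y : ℝ} (hy0 : 0 ≤ y) (hy : y < Real.pi) (hq : 0 < q)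
    (hle : y ^ 2 * Real.cos y ≤ q) : ∃ x, 0 ≤ x ∧ rootQ x y = q := by
  have hk := sinc_pos hy0 hy
  -- The first summand gives N sinc y ≥ 2, so the last factor of `rootQ` is at least 1 even if cos y
  -- = -1; the rest gives N² ≥ q.
  set N := 2 / Real.sinc y + q + 1 with hN
  have hN1 : q + 1 ≤ N := by have : 0 < 2 / Real.sinc y := by positivity
                             linarith
  have hNk : 2 ≤ N * Real.sinc y := by
    have : 2 / Real.sinc y * Real.sinc y = 2 := by field_simp
    nlinarith
  have hbig : q ≤ rootQ N y := by
    have h1 : 1 ≤ N * Real.sinc y + Real.cos y := by linarith [Real.neg_one_le_cos y]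
    have h2 : 1 ≤ Real.exp N := Real.one_le_exp (by linarith)
    have h3 : q ≤ N ^ 2 + y ^ 2 := by nlinarith [sq_nonneg y]
    calc q = 1 * q * 1 := by ring
      _ ≤ _ := by unfold rootQ; gcongr
  have hsmall : rootQ 0 y ≤ q := by simpa [rootQ] using hle
  have hcont : ContinuousOn (fun x => rootQ x y) (Set.Icc 0 N) :=
    (continuous_rootQ.comp (by fun_prop : Continuous fun x : ℝ => (x, y))).continuousOn
  obtain ⟨x, hx, hxq⟩ := intermediate_value_Icc (by linarith) hcont ⟨hsmall, hbig⟩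
  exact ⟨x, hx.1, hxq⟩

/-- The level set of `rootQ` at height q is a graph over y. Continuity needs no implicit function
theorem: strict monotonicity in x lets the values at fixed abscissae l < X y₀ < u, which are
continuous in y, trap X y. -/
lemma exists_continuousOn_rootQ_eq {a b q : ℝ} (ha : 0 ≤ a) (hb : b < Real.pi) (hq : 0 < q)
    (hle : ∀ y ∈ Set.Icc a b, y ^ 2 * Real.cos y ≤ q) :
    ∃ X : ℝ → ℝ, ContinuousOn X (Set.Icc a b) ∧
      ∀ y ∈ Set.Icc a b, 0 ≤ X y ∧ rootQ (X y) y = q := by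
  have hex : ∀ y, ∃ x, y ∈ Set.Icc a b → 0 ≤ x ∧ rootQ x y = q := fun y => by
    by_cases hy : y ∈ Set.Icc a b
    · obtain ⟨x, hx⟩ := exists_rootQ_eq (ha.trans hy.1) (hy.2.trans_lt hb) hq (hle y hy)
      exact ⟨x, fun _ => hx⟩
    · exact ⟨0, fun h => absurd h hy⟩
  choose X hX using hex
  refine ⟨X, fun y₀ hy₀ => ?_, hX⟩
  have hmono : ∀ y ∈ Set.Icc a b, ∀ x x', 0 ≤ x → x < x' → 0 < rootQ x y →
      rootQ x y < rootQ x' y := fun y hy x x' h1 h2 h3 =>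
    rootQ_lt_rootQ (ha.trans hy.1) (hy.2.trans_lt hb) h1 h2 h3
  have hcont : ∀ x, ContinuousWithinAt (fun y => rootQ x y) (Set.Icc a b) y₀ := fun x =>
    (continuous_rootQ.comp (by fun_prop : Continuous fun y : ℝ => (x, y))).continuousWithinAt
  refine tendsto_order.2 ⟨fun l hl => ?_, fun u hu => ?_⟩
  · rcases lt_or_ge l 0 with hl0 | hl0
    · filter_upwards [self_mem_nhdsWithin] with y hy
      exact hl0.trans_le (hX y hy).1
    · have h1 : rootQ l y₀ < q := by
        by_contra! hcon
        have := hmono y₀ hy₀ l _ hl0 hl (hq.trans_le hcon)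
        linarith [(hX y₀ hy₀).2]
      filter_upwards [self_mem_nhdsWithin, (hcont l).eventually_lt_const h1] with y hy hy2
      by_contra! hcon
      rcases hcon.eq_or_lt with he | he
      · rw [← he, (hX y hy).2] at hy2
        exact lt_irrefl _ hy2
      · have := hmono y hy _ _ (hX y hy).1 he ((hX y hy).2 ▸ hq)
        linarith [(hX y hy).2]
  · have hu0 : 0 ≤ u := (hX y₀ hy₀).1.trans hu.le
    have h1 : q < rootQ u y₀ := by
      have := hmono y₀ hy₀ _ _ (hX y₀ hy₀).1 hu ((hX y₀ hy₀).2 ▸ hq)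
      linarith [(hX y₀ hy₀).2]
    filter_upwards [self_mem_nhdsWithin, (hcont u).eventually_const_lt h1] with y hy hy2
    by_contra! hcon
    rcases hcon.eq_or_lt with he | he
    · rw [he, (hX y hy).2] at hy2
      exact lt_irrefl _ hy2
    · have := hmono y hy _ _ hu0 he (hq.trans hy2)
      linarith [(hX y hy).2]

/-- Along the level curve of `rootQ`, the coefficient `rootP` varies continuously, so every value
between those at the endpoints is attained at a point with x ≥ 0. -/
lemma exists_root_of_between {a b p q xa xb : ℝ} (ha : 0 ≤ a) (hab : a ≤ b) (hb : b < Real.pi)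
    (hq : 0 < q) (hle : ∀ y ∈ Set.Icc a b, y ^ 2 * Real.cos y ≤ q)
    (hxa : 0 ≤ xa) (hxaq : rootQ xa a = q) (hxb : 0 ≤ xb) (hxbq : rootQ xb b = q)
    (hpa : rootP xa a ≤ p) (hpb : p ≤ rootP xb b) :
    ∃ x y : ℝ, 0 ≤ x ∧ quasiPoly p q (x + y * Complex.I) = 0 := by
  obtain ⟨X, hXc, hX⟩ := exists_continuousOn_rootQ_eq ha hb hq hle
  have hA : a ∈ Set.Icc a b := ⟨le_rfl, hab⟩
  have hB : b ∈ Set.Icc a b := ⟨hab, le_rfl⟩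
  have hXa : X a = xa := rootQ_inj ha (hab.trans_lt hb) (hX a hA).1 hxa
    ((hX a hA).2 ▸ hq) ((hX a hA).2.trans hxaq.symm)
  have hXb : X b = xb := rootQ_inj (ha.trans hab) hb (hX b hB).1 hxb
    ((hX b hB).2 ▸ hq) ((hX b hB).2.trans hxbq.symm)
  have hcont : ContinuousOn (fun y => rootP (X y) y) (Set.Icc a b) :=
    continuous_rootP.comp_continuousOn (hXc.prodMk continuousOn_id)
  obtain ⟨y, hy, hyp⟩ := intermediate_value_Icc hab hcont
    (show p ∈ Set.Icc (rootP (X a) a) (rootP (X b) b) by rw [hXa, hXb]; exact ⟨hpa, hpb⟩)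
  refine ⟨X y, y, (hX y hy).1, ?_⟩
  have := quasiPoly_rootP_rootQ (X y) y
  rwa [(hX y hy).2, show rootP (X y) y = p from hyp] at this

/-- As y approaches π, the factor x sinc y + cos y can stay positive only if x tends to infinity,
and then `rootP` is unbounded above along the level curve. -/
lemma exists_large_rootP {p q b₀ : ℝ} (hq : 0 < q) (hb₀ : b₀ < Real.pi) :
    ∃ b x, b₀ < b ∧ 0 < b ∧ b < Real.pi ∧ 0 ≤ x ∧ rootQ x b = q ∧ p ≤ rootP x b := by
  -- The final bound is `rootP` ≥ x/2 - q, so x ≥ M suffices; the condition δ · 2M ≤ 1 is what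
  -- forces x ≥ M.
  set M := 2 * (|p| + q) + 1 with hM
  have hM1 : 1 ≤ M := by linarith [abs_nonneg p]
  obtain ⟨δ, hδ0, hδ1, hδ2, hδ3⟩ : ∃ δ : ℝ, 0 < δ ∧ δ ≤ 1 ∧ δ < Real.pi - b₀ ∧ δ * (2 * M) ≤ 1 := by
    refine ⟨min (min 1 ((Real.pi - b₀) / 2)) (1 / (2 * M)), ?_, ?_, ?_, ?_⟩
    · refine lt_min (lt_min one_pos (by linarith)) (by positivity)
    · exact (min_le_left _ _).trans (min_le_left _ _)
    · exact ((min_le_left _ _).trans (min_le_right _ _)).trans_lt (by linarith)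
    · rw [← le_div_iff₀ (by positivity)]
      exact min_le_right _ _
  have hpi := Real.pi_gt_three
  have hb0 : 0 < Real.pi - δ := by linarith
  have hcos : 1 / 2 ≤ Real.cos δ := by
    have := Real.one_sub_sq_div_two_le_cos (x := δ)
    nlinarith
  have hle : (Real.pi - δ) ^ 2 * Real.cos (Real.pi - δ) ≤ q := by
    rw [Real.cos_pi_sub]
    have : 0 ≤ (Real.pi - δ) ^ 2 * Real.cos δ := by positivity
    linarith
  obtain ⟨x, hx0, hx⟩ := exists_rootQ_eq hb0.le (by linarith) hq hle
  refine ⟨Real.pi - δ, x, by linarith, hb0, by linarith, hx0, hx, ?_⟩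
  set b := Real.pi - δ with hb
  have hsin : Real.sin b = Real.sin δ := by rw [hb, Real.sin_pi_sub]
  have hcosb : Real.cos b = -Real.cos δ := by rw [hb, Real.cos_pi_sub]
  have hk := mul_sinc_eq_sin b
  have hu : 0 < x * Real.sinc b + Real.cos b := by
    by_contra! hcon
    have : 0 ≤ Real.exp x * (x ^ 2 + b ^ 2) := by positivity
    have : rootQ x b ≤ 0 := mul_nonpos_of_nonneg_of_nonpos this hcon
    linarith
  have hxM : M ≤ x := by
    have h1 : b * Real.cos δ < x * Real.sin δ := by
      rw [← hsin, ← hk]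
      have := mul_pos hb0 hu
      rw [hcosb] at this
      linarith
    have h2 : x * Real.sin δ ≤ x * δ := by gcongr; exact Real.sin_le hδ0.le
    have h3 : 1 * (1 / 2) ≤ b * Real.cos δ := by gcongr; linarith
    have h4 : δ * M ≤ δ * x := by linarith
    exact le_of_mul_le_mul_left h4 hδ0
  have hexp : 1 ≤ Real.exp x := Real.one_le_exp hx0
  have hrat : x / (x ^ 2 + b ^ 2) ≤ 1 := by
    rw [div_le_one (by positivity)]
    nlinarith [sq_nonneg b]
  -- Adding q x / (x² + b²), with q = `rootQ` x b, cancels the term -x² sinc b, which would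
  -- otherwise compete with the growth.
  have hP : rootP x b = Real.exp x * (b * Real.sin b + x * Real.cos δ)
      - q * (x / (x ^ 2 + b ^ 2)) := by
    have hne : x ^ 2 + b ^ 2 ≠ 0 := by positivity
    rw [← hx, rootP, rootQ, ← hk, ← neg_eq_iff_eq_neg.2 hcosb]
    field_simp
    ring
  rw [hP]
  have h5 : 0 ≤ b * Real.sin b := mul_nonneg hb0.le
    (Real.sin_nonneg_of_nonneg_of_le_pi hb0.le (by linarith))
  have h6 : x * (1 / 2) ≤ x * Real.cos δ := by gcongr
  have h7 : 1 * (x * (1 / 2)) ≤ Real.exp x * (b * Real.sin b + x * Real.cos δ) := by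
    gcongr; linarith
  have h8 : q * (x / (x ^ 2 + b ^ 2)) ≤ q * 1 := by gcongr
  linarith [le_abs_self p]

lemma exists_real_root {p q x₀ : ℝ} (hx₀ : 0 ≤ x₀)
    (h : 0 ∈ Set.uIcc q (x₀ ^ 2 * Real.exp x₀ + p * x₀ + q)) :
    ∃ x y : ℝ, 0 ≤ x ∧ quasiPoly p q (x + y * Complex.I) = 0 := by
  have hcont : ContinuousOn (fun x : ℝ => x ^ 2 * Real.exp x + p * x + q) (Set.uIcc 0 x₀) := by
    fun_prop
  have h' : (0 : ℝ) ∈ Set.uIcc ((fun x : ℝ => x ^ 2 * Real.exp x + p * x + q) 0)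
      ((fun x : ℝ => x ^ 2 * Real.exp x + p * x + q) x₀) := by simpa using h
  obtain ⟨x, hx, hx0⟩ := intermediate_value_uIcc hcont h'
  rw [Set.uIcc_of_le hx₀] at hx
  refine ⟨x, 0, hx.1, (quasiPoly_eq_zero_iff p q x 0).2 ⟨?_, by simp⟩⟩
  simp only [Real.cos_zero, Real.sin_zero] at *
  linarith

/-- Where y² cos y ≤ q the level curve with x ≥ 0 exists. If this held on all of (0, π/2), the curve
would run from y = 0 up to y near π and p would be attained. Otherwise the curve is interrupted
between the first and last crossings w₁, w₂; at these x = 0 and `rootP` equals y sin y, so only p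
strictly between the two values avoids the remaining arcs. -/
lemma region_of_no_root {p q : ℝ}
    (hst : ∀ x y : ℝ, 0 ≤ x → quasiPoly p q (x + y * Complex.I) ≠ 0) :
    0 < q ∧ ∃ w₁ w₂ : ℝ, 0 < w₁ ∧ w₁ < w₂ ∧ w₂ < Real.pi / 2 ∧ q = w₁ ^ 2 * Real.cos w₁ ∧
      q = w₂ ^ 2 * Real.cos w₂ ∧ w₁ * Real.sin w₁ < p ∧ p < w₂ * Real.sin w₂ := by
  have hpi := Real.pi_pos
  have hst' : ¬ ∃ x y : ℝ, 0 ≤ x ∧ quasiPoly p q (x + y * Complex.I) = 0 := by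
    rintro ⟨x, y, hx, h⟩
    exact hst x y hx h
  have hq : 0 < q := by
    by_contra! hq
    have h0 : 0 ≤ |p| + |q| + 1 := by positivity
    refine hst' (exists_real_root h0 (Set.mem_uIcc_of_le hq ?_))
    have h1 := Real.one_le_exp h0
    have h2 : (|p| + |q| + 1) ^ 2 * 1 ≤ (|p| + |q| + 1) ^ 2 * Real.exp (|p| + |q| + 1) := by
      gcongr
    have h3 : -|p| * (|p| + |q| + 1) ≤ p * (|p| + |q| + 1) := by
      gcongr; exact neg_abs_le p
    nlinarith [neg_abs_le q, abs_nonneg q, abs_nonneg p, mul_nonneg (abs_nonneg p) (abs_nonneg q)]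
  obtain ⟨x₀, hx₀, hx₀q⟩ := exists_rootQ_eq le_rfl hpi hq (by simpa using hq.le)
  -- The end y = 0 of the curve: for smaller p the real function x² e^x + p x + q is nonpositive at
  -- x₀ and positive at 0, which yields a real root.
  have hp₀ : rootP x₀ 0 ≤ p := by
    by_contra! hcon
    refine hst' (exists_real_root hx₀ (Set.mem_uIcc_of_ge ?_ hq.le))
    have h1 : p * x₀ ≤ rootP x₀ 0 * x₀ := by gcongr
    have h2 : x₀ ^ 2 * Real.exp x₀ + rootP x₀ 0 * x₀ + rootQ x₀ 0 = 0 := by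
      simp [rootP, rootQ]; ring
    linarith
  set f : ℝ → ℝ := fun y => y ^ 2 * Real.cos y with hf
  have hfc : Continuous f := by fun_prop
  obtain ⟨w₀, hw₀, hw₀q⟩ : ∃ w₀ ∈ Set.Ioo 0 (Real.pi / 2), q < f w₀ := by
    by_contra! hcon
    obtain ⟨b, x, -, hb0, hb, hx, hxq, hxp⟩ := exists_large_rootP (p := p) hq hpi
    refine hst' (exists_root_of_between le_rfl hb0.le hb hq (fun y hy => ?_) hx₀ hx₀q hx hxq hp₀ hxp)
    rcases hy.1.eq_or_lt with rfl | hy0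
    · simpa using hq.le
    rcases lt_or_ge y (Real.pi / 2) with h | h
    · exact hcon y ⟨hy0, h⟩
    · have := Real.cos_nonpos_of_pi_div_two_le_of_le h (by linarith [hy.2])
      nlinarith [mul_nonneg (sq_nonneg y) (neg_nonneg.2 this)]
  -- The extreme points of the compact sets where y² cos y ≥ q, to the left and to the right of w₀.
  -- Extremality gives both the equality with q and the inequality y² cos y ≤ q on the outer arcs.
  obtain ⟨y₁, hy₁, hmin⟩ : ∃ y₁, IsLeast (Set.Icc 0 w₀ ∩ f ⁻¹' Set.Ici q) y₁ :=
    (isCompact_Icc.inter_right (isClosed_Ici.preimage hfc)).exists_isLeast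
      ⟨w₀, ⟨hw₀.1.le, le_rfl⟩, hw₀q.le⟩
  obtain ⟨y₂, hy₂, hmax⟩ : ∃ y₂, IsGreatest (Set.Icc w₀ (Real.pi / 2) ∩ f ⁻¹' Set.Ici q) y₂ :=
    (isCompact_Icc.inter_right (isClosed_Ici.preimage hfc)).exists_isGreatest
      ⟨w₀, ⟨le_rfl, hw₀.2.le⟩, hw₀q.le⟩
  have hf0 : f 0 = 0 := by simp [hf]
  have hfpi : f (Real.pi / 2) = 0 := by simp [hf]
  have hy₁q : f y₁ = q := by
    obtain ⟨y, hy, hyq⟩ := intermediate_value_Icc hy₁.1.1 hfc.continuousOn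
      (show q ∈ Set.Icc (f 0) (f y₁) from ⟨by rw [hf0]; exact hq.le, hy₁.2⟩)
    have := hmin ⟨⟨hy.1, hy.2.trans hy₁.1.2⟩, hyq.ge⟩
    rwa [le_antisymm hy.2 this] at hyq
  have hy₂q : f y₂ = q := by
    obtain ⟨y, hy, hyq⟩ := intermediate_value_Icc' hy₂.1.2 hfc.continuousOn
      (show q ∈ Set.Icc (f (Real.pi / 2)) (f y₂) from ⟨by rw [hfpi]; exact hq.le, hy₂.2⟩)
    have := hmax ⟨⟨hy₂.1.1.trans hy.1, hy.2⟩, hyq.ge⟩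
    rwa [le_antisymm this hy.1] at hyq
  have hy₁0 : 0 < y₁ := hy₁.1.1.lt_of_ne (by rintro rfl; linarith)
  have hy₁w : y₁ < w₀ := hy₁.1.2.lt_of_ne (by rintro rfl; linarith)
  have hy₂w : w₀ < y₂ := hy₂.1.1.lt_of_ne (by rintro rfl; linarith)
  have hy₂pi : y₂ < Real.pi / 2 := hy₂.1.2.lt_of_ne (by rintro rfl; linarith)
  have hQ0 : ∀ y, rootQ 0 y = f y := fun y => by simp [rootQ, hf]
  have hP0 : ∀ y, rootP 0 y = y * Real.sin y := fun y => by
    simp [rootP, ← mul_sinc_eq_sin]; ring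
  refine ⟨hq, y₁, y₂, hy₁0, hy₁w.trans hy₂w, hy₂pi, hy₁q.symm, hy₂q.symm, ?_, ?_⟩
  · by_contra! hcon
    refine hst' (exists_root_of_between le_rfl hy₁0.le (by linarith) hq (fun y hy => ?_) hx₀ hx₀q
      le_rfl ((hQ0 y₁).trans hy₁q) hp₀ (by rwa [hP0]))
    by_contra! hlt
    have := hmin ⟨⟨hy.1, hy.2.trans hy₁.1.2⟩, hlt.le⟩
    rw [le_antisymm hy.2 this] at hlt
    exact hlt.ne' hy₁q
  · by_contra! hcon
    obtain ⟨b, x, hb', -, hb, hx, hxq, hxp⟩ :=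
      exists_large_rootP (p := p) hq (show y₂ < Real.pi by linarith)
    refine hst' (exists_root_of_between (by linarith) hb'.le hb hq (fun y hy => ?_) le_rfl
      ((hQ0 y₂).trans hy₂q) hx hxq (by rwa [hP0]) hxp)
    rcases le_or_gt y (Real.pi / 2) with h | h
    · by_contra! hlt
      have := hmax ⟨⟨hy₂.1.1.trans hy.1, h⟩, hlt.le⟩
      rw [le_antisymm this hy.1] at hlt
      exact hlt.ne' hy₂q
    · have := Real.cos_nonpos_of_pi_div_two_le_of_le h.le (by linarith [hy.2])
      nlinarith [mul_nonneg (sq_nonneg y) (neg_nonneg.2 this)]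

section

variable {ι : Type*} [Fintype ι]

/-- The substitution s = z / σ normalizes the delay to one. -/
lemma charD_scale (α κ : ℝ) {σ : ℝ} (hσ : 0 < σ) (β : ι → ℝ) (z : ℂ) :
    (σ : ℂ) ^ 2 * charD α κ σ β (z / σ)
      = quasiPoly ((α + ∑ i, β i) * σ) (α * κ * σ ^ 2) z := by
  have h : (σ : ℂ) ≠ 0 := by exact_mod_cast hσ.ne'
  rw [charD, quasiPoly]
  push_cast
  rw [div_mul_cancel₀ _ h]
  field_simp

lemma plantStable_iff_quasiPoly (α κ : ℝ) {σ : ℝ} (hσ : 0 < σ) (β : ι → ℝ) :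
    PlantStable α κ σ β ↔ ∀ x y : ℝ, 0 ≤ x →
      quasiPoly ((α + ∑ i, β i) * σ) (α * κ * σ ^ 2) (x + y * Complex.I) ≠ 0 := by
  have h : (σ : ℂ) ≠ 0 := by exact_mod_cast hσ.ne'
  constructor
  · intro hst x y hx h0
    rw [← charD_scale α κ hσ] at h0
    have := hst _ ((mul_eq_zero.1 h0).resolve_left (pow_ne_zero 2 h))
    rw [Complex.div_ofReal_re] at this
    simp at this
    exact absurd this (not_lt.2 (div_nonneg hx hσ.le))
  · intro hst s hs
    by_contra! hre
    refine hst (s.re * σ) (s.im * σ) (by positivity) ?_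
    rw [show ((s.re * σ : ℝ) : ℂ) + ((s.im * σ : ℝ) : ℂ) * Complex.I = s * σ by
      conv_rhs => rw [← Complex.re_add_im s]
      push_cast; ring, ← charD_scale α κ hσ, mul_div_cancel_right₀ _ h, hs, mul_zero]

theorem plantStable_iff_mem_plantStableRegion {α κ σ : ℝ} (hκ : 0 < κ) (hσ : 0 < σ) (β : ι → ℝ) :
    PlantStable α κ σ β ↔ β ∈ plantStableRegion (ι := ι) α κ σ := by
  rw [plantStable_iff_quasiPoly α κ hσ β]
  constructor
  · intro hst
    obtain ⟨hq, w₁, w₂, h0, h12, hpi, e1, e2, l1, l2⟩ := region_of_no_root hst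
    have c1 : w₁ / σ * σ = w₁ := div_mul_cancel₀ _ hσ.ne'
    have c2 : w₂ / σ * σ = w₂ := div_mul_cancel₀ _ hσ.ne'
    refine ⟨?_, w₁ / σ, w₂ / σ, by positivity, by gcongr, by rwa [c2], ?_, ?_, ?_, ?_⟩
    · by_contra! hcon
      have := mul_nonneg (mul_nonneg (neg_nonneg.2 hcon) hκ.le) (sq_nonneg σ)
      linarith
    · rw [c1]; field_simp; linarith
    · rw [c2]; field_simp; linarith
    · rw [c1, div_mul_eq_mul_div, sub_lt_iff_lt_add, div_lt_iff₀ hσ]; linarith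
    · rw [c2, div_mul_eq_mul_div, lt_sub_iff_add_lt, lt_div_iff₀ hσ]; linarith
  · rintro ⟨hα, w₁, w₂, h0, h12, hpi, e1, e2, l1, l2⟩
    set p := (α + ∑ i, β i) * σ with hp
    set q := α * κ * σ ^ 2 with hq
    have hq0 : 0 < q := by positivity
    have h12' : w₁ * σ ≤ w₂ * σ := by gcongr
    -- The bounds on the sum of gains place p between the endpoint values of w sin w, so p is
    -- attained at an interior point; there q < w² cos w by `lt_sq_mul_cos`.
    obtain ⟨w, hw, hwp⟩ := intermediate_value_Ioo h12'
      (by fun_prop : ContinuousOn (fun w : ℝ => w * Real.sin w) _)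
      (show p ∈ Set.Ioo _ _ from ⟨by
        have : w₁ * Real.sin (w₁ * σ) * σ < p := by rw [hp]; gcongr; linarith
        linarith, by
        have : p < w₂ * Real.sin (w₂ * σ) * σ := by rw [hp]; gcongr; linarith
        linarith⟩)
    have hw1 : 0 < w₁ * σ := by positivity
    have hqw := lt_sq_mul_cos (q := q) hw1 hw.1 hw.2 hpi
      (by rw [hq, e1]; ring) (by rw [hq, e2]; ring)
    intro x y hx hroot
    rcases le_total 0 y with hy | hy
    · obtain ⟨r1, r2⟩ := (quasiPoly_eq_zero_iff _ _ _ _).1 hroot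
      exact quasiPoly_no_root (hw1.trans hw.1) (hw.2.trans hpi) hwp.symm hq0 hqw hx hy r1 r2
    · obtain ⟨r1, r2⟩ := (quasiPoly_eq_zero_iff _ _ _ _).1 hroot
      -- The coefficients are real, so a root in the lower half-plane may be replaced by its
      -- conjugate.
      refine quasiPoly_no_root (y := -y) (hw1.trans hw.1) (hw.2.trans hpi) hwp.symm hq0 hqw hx
        (by linarith) ?_ ?_
      · rw [Real.cos_neg, Real.sin_neg, ← r1]; ring
      · rw [Real.cos_neg, Real.sin_neg]; linear_combination -r2

end

end CCC

noncomputable section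

namespace CCC

/-! ### Symbol classes -/

/-- Continuous functions of growth at most `(1 + |ξ|) ^ r`. -/
def HasGrowth (r : ℤ) (f : ℝ → ℂ) : Prop :=
  Continuous f ∧ ∃ C : ℝ, ∀ ξ, ‖f ξ‖ ≤ C * (1 + |ξ|) ^ r

/-- Functions whose derivatives up to order `n` are of growth at most `(1 + |ξ|) ^ r`. -/
def IsSymbol : ℕ → ℤ → (ℝ → ℂ) → Prop
  | 0, r, f => HasGrowth r f
  | n + 1, r, f => HasGrowth r f ∧ ∃ f' : ℝ → ℂ, (∀ ξ, HasDerivAt f (f' ξ) ξ) ∧ IsSymbol n r f'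

lemma one_add_abs_pos (ξ : ℝ) : 0 < 1 + |ξ| := by positivity

namespace HasGrowth

variable {r r' : ℤ} {f g : ℝ → ℂ}

lemma exists_nonneg (hf : HasGrowth r f) : ∃ C : ℝ, 0 ≤ C ∧ ∀ ξ, ‖f ξ‖ ≤ C * (1 + |ξ|) ^ r := by
  obtain ⟨C, hC⟩ := hf.2
  refine ⟨C, ?_, hC⟩
  simpa using (norm_nonneg _).trans (hC 0)

lemma mono (hf : HasGrowth r f) (h : r ≤ r') : HasGrowth r' f := by
  obtain ⟨C, hC0, hC⟩ := hf.exists_nonneg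
  refine ⟨hf.1, C, fun ξ => (hC ξ).trans ?_⟩
  gcongr
  linarith [abs_nonneg ξ]

lemma add (hf : HasGrowth r f) (hg : HasGrowth r g) : HasGrowth r (fun ξ => f ξ + g ξ) := by
  obtain ⟨C, hC⟩ := hf.2
  obtain ⟨C', hC'⟩ := hg.2
  refine ⟨hf.1.add hg.1, C + C', fun ξ => (norm_add_le _ _).trans ?_⟩
  rw [add_mul]
  exact add_le_add (hC ξ) (hC' ξ)

lemma mul (hf : HasGrowth r f) (hg : HasGrowth r' g) : HasGrowth (r + r') (fun ξ => f ξ * g ξ) := by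
  obtain ⟨C, hC0, hC⟩ := hf.exists_nonneg
  obtain ⟨C', hC0', hC'⟩ := hg.exists_nonneg
  refine ⟨hf.1.mul hg.1, C * C', fun ξ => ?_⟩
  rw [norm_mul, zpow_add₀ (one_add_abs_pos ξ).ne', mul_mul_mul_comm]
  exact mul_le_mul (hC ξ) (hC' ξ) (norm_nonneg _)
    (mul_nonneg hC0 (zpow_pos (one_add_abs_pos ξ) _).le)

lemma inv (hf : HasGrowth r f) {c : ℝ} (hc : 0 < c) (h : ∀ ξ, c * (1 + |ξ|) ^ r ≤ ‖f ξ‖) :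
    HasGrowth (-r) (fun ξ => (f ξ)⁻¹) := by
  have hp : ∀ ξ : ℝ, 0 < c * (1 + |ξ|) ^ r := fun ξ =>
    mul_pos hc (zpow_pos (one_add_abs_pos ξ) _)
  refine ⟨hf.1.inv₀ fun ξ h0 => ?_, c⁻¹, fun ξ => ?_⟩
  · have := (hp ξ).trans_le (h ξ)
    simp [h0] at this
  · rw [norm_inv, zpow_neg, ← mul_inv]
    exact inv_anti₀ (hp ξ) (h ξ)

end HasGrowth

namespace IsSymbol

variable {n : ℕ} {r r' : ℤ} {f g : ℝ → ℂ}

lemma hasGrowth (hf : IsSymbol n r f) : HasGrowth r f := by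
  cases n with
  | zero => exact hf
  | succ n => exact hf.1

lemma of_succ (hf : IsSymbol (n + 1) r f) : IsSymbol n r f := by
  induction n generalizing f with
  | zero => exact hf.1
  | succ n ih =>
    obtain ⟨h, f', hd, h'⟩ := hf
    exact ⟨h, f', hd, ih h'⟩

lemma mono (hf : IsSymbol n r f) (h : r ≤ r') : IsSymbol n r' f := by
  induction n generalizing f with
  | zero => exact HasGrowth.mono hf h
  | succ n ih =>
    obtain ⟨h0, f', hd, h'⟩ := hf
    exact ⟨h0.mono h, f', hd, ih h'⟩

lemma add (hf : IsSymbol n r f) (hg : IsSymbol n r g) : IsSymbol n r (fun ξ => f ξ + g ξ) := by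
  induction n generalizing f g with
  | zero => exact HasGrowth.add hf hg
  | succ n ih =>
    obtain ⟨h0, f', hd, h'⟩ := hf
    obtain ⟨k0, g', kd, k'⟩ := hg
    exact ⟨h0.add k0, _, fun ξ => (hd ξ).add (kd ξ), ih h' k'⟩

lemma mul (hf : IsSymbol n r f) (hg : IsSymbol n r' g) :
    IsSymbol n (r + r') (fun ξ => f ξ * g ξ) := by
  induction n generalizing f g with
  | zero => exact HasGrowth.mul hf hg
  | succ n ih =>
    have hf1 := hf.of_succ
    have hg1 := hg.of_succ
    obtain ⟨h0, f', hd, h'⟩ := hf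
    obtain ⟨k0, g', kd, k'⟩ := hg
    exact ⟨h0.mul k0, _, fun ξ => (hd ξ).mul (kd ξ), (ih h' hg1).add (ih hf1 k')⟩

lemma const (n : ℕ) (z : ℂ) : IsSymbol n 0 (fun _ => z) := by
  have key : ∀ z : ℂ, HasGrowth 0 (fun _ => z) := fun z =>
    ⟨continuous_const, ‖z‖, fun ξ => by simp⟩
  induction n generalizing z with
  | zero => exact key z
  | succ n ih => exact ⟨key z, _, fun ξ => hasDerivAt_const ξ z, ih 0⟩

lemma ofReal (n : ℕ) : IsSymbol n 1 (fun ξ => (ξ : ℂ)) := by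
  have key : HasGrowth 1 (fun ξ : ℝ => (ξ : ℂ)) :=
    ⟨Complex.continuous_ofReal, 1, fun ξ => by simp⟩
  cases n with
  | zero => exact key
  | succ n => exact ⟨key, fun _ => 1, fun ξ => Complex.ofRealCLM.hasDerivAt,
      (const n 1).mono zero_le_one⟩

lemma neg (hf : IsSymbol n r f) : IsSymbol n r (fun ξ => -f ξ) := by
  simpa using (const n (-1)).mul hf

/-- Differentiating an oscillating exponential gains no decay; because of the delays, `IsSymbol`
therefore asks the same growth of all derivatives. -/
lemma exp_I_mul (n : ℕ) (a : ℝ) : IsSymbol n 0 (fun ξ : ℝ => Complex.exp (a * ξ * Complex.I)) := by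
  have key : HasGrowth 0 (fun ξ : ℝ => Complex.exp (a * ξ * Complex.I)) :=
    ⟨by fun_prop, 1, fun ξ => by
      simp only [← Complex.ofReal_mul, Complex.norm_exp_ofReal_mul_I]; simp⟩
  induction n with
  | zero => exact key
  | succ n ih =>
    refine ⟨key, fun ξ => (a * Complex.I) * Complex.exp (a * ξ * Complex.I), fun ξ => ?_,
      by simpa using (const n (a * Complex.I)).mul ih⟩
    have h1 : HasDerivAt (fun ξ : ℝ => (a * ξ * Complex.I : ℂ)) (a * 1 * Complex.I) ξ :=
      ((Complex.ofRealCLM.hasDerivAt (x := ξ)).const_mul (a : ℂ)).mul_const Complex.I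
    simpa [mul_comm] using h1.cexp

/-- The derivative -f' f⁻¹ f⁻¹ has order r - r - r = -r, so the induction closes. -/
lemma inv (hf : IsSymbol n r f) {c : ℝ} (hc : 0 < c) (h : ∀ ξ, c * (1 + |ξ|) ^ r ≤ ‖f ξ‖) :
    IsSymbol n (-r) (fun ξ => (f ξ)⁻¹) := by
  induction n with
  | zero => exact HasGrowth.inv hf hc h
  | succ n ih =>
    have h2 := ih hf.of_succ
    obtain ⟨h0, f', hd, h'⟩ := hf
    have hne : ∀ ξ, f ξ ≠ 0 := fun ξ h3 => by
      have := (mul_pos hc (zpow_pos (one_add_abs_pos ξ) r)).trans_le (h ξ)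
      simp [h3] at this
    refine ⟨h0.inv hc h, _, fun ξ => (hd ξ).inv (hne ξ), ?_⟩
    have := ((h'.mul h2).mul h2).neg
    rw [show r + -r + -r = -r by ring] at this
    refine cast (congrArg _ (funext fun ξ => ?_)) this
    rw [div_eq_mul_inv, neg_mul, mul_assoc, pow_two, mul_inv]

end IsSymbol

lemma HasGrowth.integrable {f : ℝ → ℂ} (hf : HasGrowth (-2) f) : Integrable f := by
  obtain ⟨C, hC0, hC⟩ := hf.exists_nonneg
  refine (integrable_inv_one_add_sq.const_mul C).mono' hf.1.aestronglyMeasurable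
    (ae_of_all _ fun ξ => (hC ξ).trans ?_)
  rw [zpow_neg]
  gcongr
  have := abs_nonneg ξ
  have h2 := sq_abs ξ
  rw [show ((1 + |ξ|) ^ (2 : ℤ)) = (1 + |ξ|) ^ 2 from zpow_natCast _ 2]
  nlinarith

lemma norm_fourier_le (f : ℝ → ℂ) (t : ℝ) : ‖𝓕 f t‖ ≤ ∫ ξ, ‖f ξ‖ :=
  VectorFourier.norm_fourierIntegral_le_integral_norm _ _ _ _ _

lemma continuous_fourier {f : ℝ → ℂ} (hf : Integrable f) : Continuous (𝓕 f) :=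
  VectorFourier.fourierIntegral_continuous Real.continuous_fourierChar
    (by exact continuous_inner) hf

/-- Two integrations by parts bound (1 + t²) |𝓕 f (t)| by the L¹ norms of f and f''. -/
lemma IsSymbol.integrable_fourier {f : ℝ → ℂ} (hf : IsSymbol 2 (-2) f) : Integrable (𝓕 f) := by
  obtain ⟨h0, f', hd, h1, f'', hd', h2⟩ := hf
  have i0 := h0.integrable
  have i1 := h1.integrable
  have i2 := HasGrowth.integrable h2
  have e1 : deriv f = f' := funext fun ξ => (hd ξ).deriv
  have e2 : deriv f' = f'' := funext fun ξ => (hd' ξ).deriv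
  have F1 := Real.fourier_deriv i0 (fun ξ => (hd ξ).differentiableAt) (e1 ▸ i1)
  have F2 := Real.fourier_deriv i1 (fun ξ => (hd' ξ).differentiableAt) (e2 ▸ i2)
  rw [e1] at F1
  rw [e2] at F2
  set C := (∫ ξ, ‖f ξ‖) + ∫ ξ, ‖f'' ξ‖ with hC
  refine (integrable_inv_one_add_sq.const_mul C).mono'
    (continuous_fourier i0).aestronglyMeasurable (ae_of_all _ fun t => ?_)
  rw [← div_eq_mul_inv, le_div_iff₀ (by positivity)]
  have b0 := norm_fourier_le f t
  have b2 := norm_fourier_le f'' t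
  rw [F2, F1] at b2
  simp only [norm_smul, norm_mul, Complex.norm_I, Complex.norm_real, Complex.norm_ofNat,
    Real.norm_eq_abs, abs_of_pos Real.pi_pos] at b2
  have hpi := Real.pi_gt_three
  have h3 : t ^ 2 * ‖𝓕 f t‖ ≤ 2 * Real.pi * 1 * |t| * (2 * Real.pi * 1 * |t| * ‖𝓕 f t‖) := by
    rw [show 2 * Real.pi * 1 * |t| * (2 * Real.pi * 1 * |t| * ‖𝓕 f t‖)
      = (2 * Real.pi) ^ 2 * (|t| ^ 2 * ‖𝓕 f t‖) by ring, sq_abs]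
    exact le_mul_of_one_le_left (by positivity) (by nlinarith)
  linarith

/-- The kernel is the inverse Fourier transform; Hermitian symmetry of the symbol makes it real. -/
lemma exists_real_kernel {f : ℝ → ℂ} (hf : IsSymbol 2 (-2) f)
    (hherm : ∀ ξ, f (-ξ) = (starRingEnd ℂ) (f ξ)) :
    ∃ k : ℝ → ℝ, Integrable k ∧ ∀ ξ, 𝓕 (fun t => (k t : ℂ)) ξ = f ξ := by
  have hF := hf.integrable_fourier
  have hinv : 𝓕 (𝓕⁻ f) = f :=
    Continuous.fourier_fourierInv_eq hf.hasGrowth.1 hf.hasGrowth.integrable hF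
  have hFi : Integrable (𝓕⁻ f) := by
    have : 𝓕⁻ f = fun t => 𝓕 f (-t) := funext fun t => Real.fourierInv_eq_fourier_neg f t
    rw [this]
    exact hF.comp_neg
  have hreal : ∀ t, (starRingEnd ℂ) (𝓕⁻ f t) = 𝓕⁻ f t := fun t => by
    rw [Real.fourierInv_eq_fourier_neg, Real.fourier_real_eq_integral_exp_smul, ← integral_conj,
      ← integral_neg_eq_self]
    refine integral_congr_ae (ae_of_all _ fun ξ => ?_)
    simp only [smul_eq_mul, map_mul, hherm, ← Complex.exp_conj, Complex.conj_I, Complex.conj_ofReal,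
      Complex.conj_conj]
    congr 2
    push_cast; ring
  have hcoe : (fun t => ((𝓕⁻ f t).re : ℂ)) = 𝓕⁻ f :=
    funext fun t => Complex.conj_eq_iff_re.1 (hreal t)
  exact ⟨fun t => (𝓕⁻ f t).re, hFi.re, fun ξ => by rw [hcoe, hinv]⟩

/-! ### Kernels of the closed loop -/

/-- The point `2 π i ξ` of the imaginary axis. -/
def freq (ξ : ℝ) : ℂ := 2 * Real.pi * ξ * Complex.I

lemma freq_neg (ξ : ℝ) : freq (-ξ) = (starRingEnd ℂ) (freq ξ) := by
  simp [freq, Complex.conj_ofNat]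

lemma isSymbol_freq (n : ℕ) : IsSymbol n 1 freq := by
  have := (IsSymbol.const n (2 * Real.pi * Complex.I)).mul (IsSymbol.ofReal n)
  refine cast (congrArg _ (funext fun ξ => ?_)) this
  simp only [freq]; ring

lemma isSymbol_exp_freq (n : ℕ) (a : ℝ) : IsSymbol n 0 (fun ξ => Complex.exp (freq ξ * a)) := by
  refine cast (congrArg _ (funext fun ξ => ?_)) (IsSymbol.exp_I_mul n (2 * Real.pi * a))
  simp only [freq]; push_cast; ring_nf

lemma exp_freq_mul_norm_le (ξ t : ℝ) : ‖Complex.exp (-(freq ξ * t))‖ = 1 := by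
  rw [Complex.norm_exp]; simp [freq]

/-- The Fourier transform of a real kernel. -/
def kernelFT (k : ℝ → ℝ) (ξ : ℝ) : ℂ := ∫ t : ℝ, Complex.exp (-(freq ξ * t)) * k t

lemma fourier_ofReal (k : ℝ → ℝ) (ξ : ℝ) : 𝓕 (fun t => (k t : ℂ)) ξ = kernelFT k ξ := by
  rw [Real.fourier_real_eq_integral_exp_smul, kernelFT]
  refine integral_congr_ae (ae_of_all _ fun t => ?_)
  simp only [smul_eq_mul, freq]
  congr 2
  push_cast; ring

lemma integrable_exp_freq_mul {k : ℝ → ℝ} (hk : Integrable k) (ξ : ℝ) :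
    Integrable fun t : ℝ => Complex.exp (-(freq ξ * t)) * k t :=
  hk.ofReal.bdd_mul (c := 1) (by fun_prop : Continuous _).aestronglyMeasurable
    (ae_of_all _ fun t => (exp_freq_mul_norm_le ξ t).le)

lemma kernelFT_add {k l : ℝ → ℝ} (hk : Integrable k) (hl : Integrable l) (ξ : ℝ) :
    kernelFT (fun t => k t + l t) ξ = kernelFT k ξ + kernelFT l ξ := by
  rw [kernelFT, kernelFT, kernelFT,
    ← integral_add (integrable_exp_freq_mul hk ξ) (integrable_exp_freq_mul hl ξ)]
  simp only [Complex.ofReal_add, mul_add]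

lemma kernelFT_const_mul (a : ℝ) (k : ℝ → ℝ) (ξ : ℝ) :
    kernelFT (fun t => a * k t) ξ = a * kernelFT k ξ := by
  rw [kernelFT, kernelFT, ← integral_const_mul]
  congr 1; ext t; push_cast; ring

lemma kernelFT_comp_add (k : ℝ → ℝ) (a ξ : ℝ) :
    kernelFT (fun t => k (t + a)) ξ = Complex.exp (freq ξ * a) * kernelFT k ξ := by
  rw [kernelFT, kernelFT, ← integral_const_mul,
    ← integral_add_right_eq_self (fun t : ℝ => Complex.exp (freq ξ * a) * _) a]
  congr 1; ext t
  rw [← mul_assoc, ← Complex.exp_add]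
  push_cast; ring_nf

/-- The fundamental solution of the relaxation equation, delayed by `σ`. -/
def expKernel (σ : ℝ) : ℝ → ℝ := (Set.Ioi σ).indicator fun t => Real.exp (σ - t)

lemma integrable_expKernel (σ : ℝ) : Integrable (expKernel σ) := by
  rw [expKernel, integrable_indicator_iff measurableSet_Ioi]
  simp_rw [sub_eq_add_neg, Real.exp_add]
  exact (integrableOn_exp_neg_Ioi σ).const_mul _

lemma fourier_expKernel (σ ξ : ℝ) : 𝓕 (fun t => (expKernel σ t : ℂ)) ξ
    = Complex.exp (freq ξ * (-σ : ℝ)) * (1 + freq ξ)⁻¹ := by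
  have hre : (-(1 + freq ξ)).re < 0 := by simp [freq]
  have hne : 1 + freq ξ ≠ 0 := fun h => by simp [h] at hre
  have h : ∀ t, Complex.exp (((-2 * Real.pi * t * ξ : ℝ) : ℂ) * Complex.I) • (expKernel σ t : ℂ)
      = (Set.Ioi σ).indicator
        (fun t : ℝ => Complex.exp σ * Complex.exp (-(1 + freq ξ) * t)) t := fun t => by
    by_cases ht : t ∈ Set.Ioi σ
    · simp only [expKernel, Set.indicator_of_mem ht, smul_eq_mul, Complex.ofReal_exp,
        ← Complex.exp_add]
      congr 1
      simp only [freq]; push_cast; ring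
    · simp [expKernel, Set.indicator_of_notMem ht]
  rw [Real.fourier_real_eq_integral_exp_smul]
  simp_rw [h]
  rw [integral_indicator measurableSet_Ioi, integral_const_mul, integral_exp_mul_complex_Ioi hre,
    mul_div_assoc', mul_neg, neg_div_neg_eq, ← Complex.exp_add, div_eq_mul_inv]
  congr 2
  push_cast; ring

/-- The characteristic function on the imaginary axis. -/
def axisD (γ c σ ξ : ℝ) : ℂ := freq ξ ^ 2 * Complex.exp (freq ξ * σ) + γ * freq ξ + c

lemma axisD_neg (γ c σ ξ : ℝ) : axisD γ c σ (-ξ) = (starRingEnd ℂ) (axisD γ c σ ξ) := by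
  simp [axisD, freq_neg, ← Complex.exp_conj]

lemma isSymbol_axisD (n : ℕ) (γ c σ : ℝ) : IsSymbol n 2 (axisD γ c σ) := by
  have h1 := ((isSymbol_freq n).mul (isSymbol_freq n)).mul (isSymbol_exp_freq n σ)
  have h2 := ((IsSymbol.const n γ).mul (isSymbol_freq n)).mono (by norm_num : (0 + 1 : ℤ) ≤ 2)
  have h3 := (IsSymbol.const n c).mono (by norm_num : (0 : ℤ) ≤ 2)
  refine cast (congrArg _ (funext fun ξ => ?_)) ((h1.add h2).add h3)
  simp only [axisD]; ring

lemma norm_freq (ξ : ℝ) : ‖freq ξ‖ = 2 * Real.pi * |ξ| := by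
  simp [freq, abs_of_pos Real.pi_pos]

lemma norm_exp_freq_mul (ξ a : ℝ) : ‖Complex.exp (freq ξ * a)‖ = 1 := by
  rw [Complex.norm_exp]; simp [freq]

/-- The quadratic term has modulus (2πξ)² on the axis and dominates for large ξ; on the remaining
compact interval the absence of zeros gives a positive minimum. -/
lemma exists_le_norm_axisD {γ c σ : ℝ} (hD : ∀ ξ, axisD γ c σ ξ ≠ 0) :
    ∃ m : ℝ, 0 < m ∧ ∀ ξ, m * (1 + |ξ|) ^ (2 : ℤ) ≤ ‖axisD γ c σ ξ‖ := by
  set R := |γ| + |c| + 1 with hR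
  have hR1 : 1 ≤ R := by linarith [abs_nonneg γ, abs_nonneg c]
  have hlarge : ∀ ξ : ℝ, R ≤ |ξ| → 1 * (1 + |ξ|) ^ 2 ≤ ‖axisD γ c σ ξ‖ := fun ξ hξ => by
    have h1 : ‖freq ξ ^ 2 * Complex.exp (freq ξ * σ)‖
        ≤ ‖axisD γ c σ ξ‖ + ‖(γ : ℂ) * freq ξ‖ + ‖(c : ℂ)‖ := by
      calc ‖freq ξ ^ 2 * Complex.exp (freq ξ * σ)‖
          = ‖axisD γ c σ ξ - γ * freq ξ - c‖ := by rw [axisD]; congr 1; ring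
        _ ≤ _ := (norm_sub_le _ _).trans (by gcongr; exact norm_sub_le _ _)
    simp only [norm_mul, norm_pow, norm_exp_freq_mul, norm_freq, Complex.norm_real,
      Real.norm_eq_abs, mul_one] at h1
    set a := |ξ| with ha
    have ha1 : 1 ≤ a := hR1.trans hξ
    have hpi := Real.pi_gt_three
    have h2 : |γ| ≤ a := by linarith [abs_nonneg c]
    have h3 : |c| ≤ a * a := by nlinarith [abs_nonneg γ]
    have h4 : |γ| * (2 * Real.pi * a) ≤ a * (2 * Real.pi * a) := by gcongr
    have h5 : 0 ≤ (Real.pi - 3) * a ^ 2 := mul_nonneg (by linarith) (by positivity)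
    have h6 : 3 * Real.pi * a ^ 2 ≤ Real.pi * Real.pi * a ^ 2 := by gcongr
    nlinarith
  have hcont : Continuous fun ξ : ℝ => ‖axisD γ c σ ξ‖ / (1 + |ξ|) ^ 2 :=
    ((isSymbol_axisD 0 γ c σ).1.norm).div (by fun_prop) fun ξ => by positivity
  obtain ⟨ξ₀, -, hmin⟩ := (isCompact_Icc (a := -R) (b := R)).exists_isMinOn
    ⟨0, by constructor <;> linarith⟩ hcont.continuousOn
  set m := ‖axisD γ c σ ξ₀‖ / (1 + |ξ₀|) ^ 2 with hm
  have hm0 : 0 < m := div_pos (norm_pos_iff.2 (hD ξ₀)) (by positivity)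
  refine ⟨min m 1, lt_min hm0 one_pos, fun ξ => ?_⟩
  rw [show ((1 + |ξ|) ^ (2 : ℤ)) = (1 + |ξ|) ^ 2 from zpow_natCast _ 2]
  rcases le_total R |ξ| with h | h
  · exact (mul_le_mul_of_nonneg_right (min_le_right _ _) (by positivity)).trans (hlarge ξ h)
  · have := hmin (abs_le.1 h)
    rw [Set.mem_ofPred_eq, le_div_iff₀ (by positivity)] at this
    exact (mul_le_mul_of_nonneg_right (min_le_left _ _) (by positivity)).trans this

/-- The symbol 1/D has order -2, which is enough for an integrable kernel, but s/D has only order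
-1. Subtracting e^(-sσ)/(1 + s), the transform of `expKernel`, cancels the leading part: the
difference is (s - e^(-sσ)(γ s + c)) / ((1 + s) D), of order -2. -/
theorem exists_kernels {γ c σ : ℝ} (hD : ∀ ξ, axisD γ c σ ξ ≠ 0) :
    ∃ k₀ k₁ : ℝ → ℝ, Integrable k₀ ∧ Integrable k₁ ∧
      (∀ ξ, kernelFT k₀ ξ = (axisD γ c σ ξ)⁻¹) ∧
      (∀ ξ, kernelFT k₁ ξ = freq ξ * (axisD γ c σ ξ)⁻¹) := by
  obtain ⟨m, hm, hlow⟩ := exists_le_norm_axisD hD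
  have hDinv := (isSymbol_axisD 2 γ c σ).inv hm hlow
  obtain ⟨k₀, hk₀, hF₀⟩ := exists_real_kernel hDinv
    (fun ξ => by simp [axisD_neg])
  have hone : IsSymbol 2 1 (fun ξ => 1 + freq ξ) :=
    ((IsSymbol.const 2 1).mono zero_le_one).add (isSymbol_freq 2)
  have hone0 : ∀ ξ, 1 + freq ξ ≠ 0 := fun ξ h => by
    have := congrArg Complex.re h
    simp [freq] at this
  have honeinv := hone.inv (c := 1 / 2) (by norm_num) (fun ξ => by
    have h1 : 1 ≤ ‖1 + freq ξ‖ := by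
      simpa [freq] using Complex.abs_re_le_norm (1 + freq ξ)
    have h2 : 2 * Real.pi * |ξ| ≤ ‖1 + freq ξ‖ := by
      simpa [freq, abs_of_pos Real.pi_pos] using Complex.abs_im_le_norm (1 + freq ξ)
    have : 1 * |ξ| ≤ 2 * Real.pi * |ξ| := by gcongr; linarith [Real.pi_gt_three]
    rw [zpow_one]; linarith)
  have hnum : IsSymbol 2 1
      (fun ξ => freq ξ + -(Complex.exp (freq ξ * (-σ : ℝ)) * (γ * freq ξ + c))) := by
    refine (isSymbol_freq 2).add (IsSymbol.neg ?_)
    have := (isSymbol_exp_freq 2 (-σ)).mul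
      (((IsSymbol.const 2 γ).mul (isSymbol_freq 2)).add
        ((IsSymbol.const 2 c).mono (by norm_num : (0 : ℤ) ≤ 0 + 1)))
    simpa using this
  have hrho := (hnum.mul honeinv).mul hDinv
  obtain ⟨ρ, hρ, hFρ⟩ := exists_real_kernel hrho (fun ξ => by
    simp [axisD_neg, freq_neg, ← Complex.exp_conj])
  refine ⟨k₀, fun t => expKernel σ t + ρ t, hk₀, (integrable_expKernel σ).add hρ,
    fun ξ => by rw [← fourier_ofReal, hF₀], fun ξ => ?_⟩
  rw [kernelFT_add (integrable_expKernel σ) hρ, ← fourier_ofReal, ← fourier_ofReal,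
    fourier_expKernel, hFρ]
  have e : Complex.exp (freq ξ * (-σ : ℝ)) * Complex.exp (freq ξ * σ) = 1 := by
    rw [← Complex.exp_add]; simp
  have h1 := hone0 ξ
  have h2 := hD ξ
  field_simp
  rw [axisD]
  linear_combination (freq ξ ^ 2) * e

end CCC

/-! ### Uniqueness of Fourier transforms and convolution with integrable kernels. -/

noncomputable section

namespace CCC

/-- A test function is the Fourier transform of a Schwartz function, and self-adjointness of the
transform moves it onto k. -/
lemma ae_eq_zero_of_kernelFT_eq_zero {k : ℝ → ℝ} (hk : Integrable k) (h : ∀ ξ, kernelFT k ξ = 0) :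
    ∀ᵐ t, k t = 0 := by
  refine ae_eq_zero_of_integral_contDiff_smul_eq_zero hk.locallyIntegrable fun g hg hgc => ?_
  have hgc' : HasCompactSupport fun t => (g t : ℂ) :=
    hgc.comp_left (g := fun r : ℝ => (r : ℂ)) Complex.ofReal_zero
  have hg' : ContDiff ℝ (⊤ : ℕ∞) fun t => (g t : ℂ) := Complex.ofRealCLM.contDiff.comp hg
  set G : SchwartzMap ℝ ℂ := hgc'.toSchwartzMap hg' with hG
  have hGg : ∀ t, G t = g t := fun t => rfl
  have hinv : 𝓕 ((𝓕⁻ G : SchwartzMap ℝ ℂ) : ℝ → ℂ) = G := by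
    rw [← SchwartzMap.fourier_coe, FourierTransform.fourier_fourierInv_eq]
  have hk' : Integrable fun t => (k t : ℂ) := hk.ofReal
  have hflip := VectorFourier.integral_fourierIntegral_smul_eq_flip (L := innerₗ ℝ)
    (μ := volume) (ν := volume) Real.continuous_fourierChar (by exact continuous_inner)
    (𝓕⁻ G : SchwartzMap ℝ ℂ).integrable hk' (𝕜 := ℝ)
  have hz : ∀ t, 𝓕 (fun t => (k t : ℂ)) t = 0 := fun t => by rw [fourier_ofReal, h]
  have h1 : ∫ t, 𝓕 ((𝓕⁻ G : SchwartzMap ℝ ℂ) : ℝ → ℂ) t • (k t : ℂ) = 0 := by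
    refine hflip.trans ?_
    rw [flip_innerₗ]
    refine (integral_congr_ae (ae_of_all _ fun t => ?_)).trans (integral_zero ℝ ℂ)
    show _ • 𝓕 (fun t => (k t : ℂ)) t = 0
    rw [hz, smul_zero]
  rw [hinv] at h1
  have h2 : ((∫ t, g t • k t : ℝ) : ℂ) = 0 := by
    rw [← h1, ← integral_complex_ofReal]
    refine integral_congr_ae (ae_of_all _ fun t => ?_)
    simp [hGg]
  exact_mod_cast h2

section Conv

variable {E : Type*} [NormedAddCommGroup E] [NormedSpace ℝ E]

/-- Convolution of a scalar kernel with a vector-valued signal. -/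
def conv (k : ℝ → ℝ) (x : ℝ → E) (t : ℝ) : E := ∫ τ, k τ • x (t - τ)

lemma integrable_kernel_smul {k : ℝ → ℝ} (hk : Integrable k) {G : ℝ → E} (hG : Continuous G)
    {C : ℝ} (hC : ∀ t, ‖G t‖ ≤ C) : Integrable fun τ => k τ • G τ := by
  have := hk.norm.mul_const C
  refine this.mono' (hk.aestronglyMeasurable.smul hG.aestronglyMeasurable)
    (ae_of_all _ fun τ => ?_)
  rw [norm_smul]
  gcongr
  exact hC τ

lemma norm_conv_le {k : ℝ → ℝ} (hk : Integrable k) {x : ℝ → E}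
    {C : ℝ} (hC : ∀ t, ‖x t‖ ≤ C) (t : ℝ) : ‖conv k x t‖ ≤ (∫ τ, ‖k τ‖) * C := by
  rw [← integral_mul_const]
  refine norm_integral_le_of_norm_le (hk.norm.mul_const C) (ae_of_all _ fun τ => ?_)
  rw [norm_smul]
  gcongr
  exact hC _

lemma continuous_conv {k : ℝ → ℝ} (hk : Integrable k) {x : ℝ → E} (hx : Continuous x)
    {C : ℝ} (hC : ∀ t, ‖x t‖ ≤ C) : Continuous (conv k x) := by
  refine continuous_of_dominated (bound := fun τ => ‖k τ‖ * C) (fun t => ?_)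
    (fun t => ae_of_all _ fun τ => ?_) (hk.norm.mul_const C) (ae_of_all _ fun τ => by fun_prop)
  · exact hk.aestronglyMeasurable.smul (by fun_prop : Continuous fun τ => x (t - τ)).aestronglyMeasurable
  · rw [norm_smul]
    gcongr
    exact hC _

lemma hasDerivAt_conv {k : ℝ → ℝ} (hk : Integrable k) {x y : ℝ → E}
    (hxy : ∀ t, HasDerivAt x (y t) t) (hy : Continuous y) {C C' : ℝ} (hC : ∀ t, ‖x t‖ ≤ C)
    (hC' : ∀ t, ‖y t‖ ≤ C') (t : ℝ) : HasDerivAt (conv k x) (conv k y t) t := by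
  have hx : Continuous x := continuous_iff_continuousAt.2 fun t => (hxy t).continuousAt
  refine (hasDerivAt_integral_of_dominated_loc_of_deriv_le (s := Set.univ) univ_mem
    (F' := fun t τ => k τ • y (t - τ)) (bound := fun τ => ‖k τ‖ * C')
    (Eventually.of_forall fun t => ?_) ?_ ?_ (ae_of_all _ fun τ t _ => ?_)
    (hk.norm.mul_const C') (ae_of_all _ fun τ t _ => ?_)).2
  · exact hk.aestronglyMeasurable.smul (by fun_prop : Continuous fun τ => x (t - τ)).aestronglyMeasurable
  · exact integrable_kernel_smul hk (by fun_prop : Continuous fun τ => x (t - τ)) fun τ => hC _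
  · exact hk.aestronglyMeasurable.smul (by fun_prop : Continuous fun τ => y (t - τ)).aestronglyMeasurable
  · rw [norm_smul]
    gcongr
    exact hC' _
  · exact ((hxy (t - τ)).comp_sub_const t τ).const_smul (k τ)

variable [CompleteSpace E]

/-- Fubini and a translation. It serves both for exponentials, giving the product rule for
transforms, and for vector-valued signals. -/
lemma integral_convolution_smul {φ k : ℝ → ℝ} (hφ : Integrable φ) (hk : Integrable k) {G : ℝ → E}
    (hG : Continuous G) {C : ℝ} (hC : ∀ t, ‖G t‖ ≤ C) :
    ∫ τ, (∫ r, φ r * k (τ - r)) • G τ = ∫ r, φ r • ∫ τ, k τ • G (τ + r) := by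
  have hint : Integrable (fun p : ℝ × ℝ => φ p.2 * k (p.1 - p.2)) :=
    hφ.convolution_integrand (ContinuousLinearMap.mul ℝ ℝ) hk
  have hint2 : Integrable (fun p : ℝ × ℝ => (φ p.2 * k (p.1 - p.2)) • G p.1) := by
    refine (hint.norm.mul_const C).mono' (hint.aestronglyMeasurable.smul
      (by fun_prop : Continuous fun p : ℝ × ℝ => G p.1).aestronglyMeasurable)
      (ae_of_all _ fun p => ?_)
    rw [norm_smul]
    gcongr
    exact hC _
  simp_rw [← integral_smul_const]
  rw [integral_integral_swap hint2]
  refine integral_congr_ae (ae_of_all _ fun r => ?_)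
  simp only [mul_smul]
  rw [integral_smul, ← integral_add_right_eq_self _ r]
  simp

end Conv

lemma integrable_convolution {φ k : ℝ → ℝ} (hφ : Integrable φ) (hk : Integrable k) :
    Integrable fun τ => ∫ r, φ r * k (τ - r) :=
  (hφ.convolution_integrand (ContinuousLinearMap.mul ℝ ℝ) hk).integral_prod_left

lemma kernelFT_convolution {φ k : ℝ → ℝ} (hφ : Integrable φ) (hk : Integrable k) (ξ : ℝ) :
    kernelFT (fun τ => ∫ r, φ r * k (τ - r)) ξ = kernelFT φ ξ * kernelFT k ξ := by
  have h := integral_convolution_smul hφ hk (G := fun t : ℝ => Complex.exp (-(freq ξ * t)))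
    (by fun_prop) (fun t => (exp_freq_mul_norm_le ξ t).le)
  rw [kernelFT]
  refine (integral_congr_ae (ae_of_all _ fun τ => ?_)).trans (h.trans ?_)
  · simp only [Complex.real_smul]; ring
  · rw [kernelFT, ← integral_mul_const]
    refine integral_congr_ae (ae_of_all _ fun r => ?_)
    simp only [Complex.real_smul]
    have e : ∫ τ, (k τ : ℂ) * Complex.exp (-(freq ξ * ((τ + r : ℝ) : ℂ)))
        = Complex.exp (-(freq ξ * r)) * kernelFT k ξ := by
      rw [kernelFT, ← integral_const_mul]
      congr 1; ext τ
      push_cast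
      rw [mul_add, neg_add, Complex.exp_add]; ring
    rw [e]; ring

/-- The indicator of `(0, T]`. -/
def window (T : ℝ) : ℝ → ℝ := (Set.Ioc 0 T).indicator fun _ => 1

lemma integrable_window (T : ℝ) : Integrable (window T) :=
  (integrable_indicator_iff measurableSet_Ioc).2 (integrableOn_const (by simp))

lemma integral_window_smul {E : Type*} [NormedAddCommGroup E] [NormedSpace ℝ E] {T : ℝ}
    (hT : 0 ≤ T) (G : ℝ → E) : ∫ r, window T r • G r = ∫ r in (0 : ℝ)..T, G r := by
  rw [intervalIntegral.integral_of_le hT, ← integral_indicator measurableSet_Ioc]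
  congr 1; ext r
  by_cases hr : r ∈ Set.Ioc 0 T <;> simp [window, hr]

lemma freq_mul_kernelFT_window {T : ℝ} (hT : 0 ≤ T) (ξ : ℝ) :
    freq ξ * kernelFT (window T) ξ = 1 - Complex.exp (-(freq ξ * T)) := by
  have h : kernelFT (window T) ξ = ∫ r in (0 : ℝ)..T, Complex.exp (-(freq ξ * r)) := by
    rw [← integral_window_smul hT, kernelFT]
    simp only [Complex.real_smul, mul_comm]
  rw [h, ← intervalIntegral.integral_const_mul]
  have hd : ∀ r ∈ Set.uIcc 0 T, HasDerivAt (fun r : ℝ => -Complex.exp (-(freq ξ * r)))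
      (freq ξ * Complex.exp (-(freq ξ * r))) r := fun r _ => by
    have h1 : HasDerivAt (fun r : ℝ => -(freq ξ * (r : ℂ))) (-(freq ξ * 1)) r :=
      ((Complex.ofRealCLM.hasDerivAt (x := r)).const_mul (freq ξ)).neg
    exact h1.cexp.neg.congr_deriv (by ring)
  rw [intervalIntegral.integral_eq_sub_of_hasDerivAt hd
    ((by fun_prop : Continuous _).intervalIntegrable _ _)]
  simp
  ring

/-- The hypothesis cannot be read as a differential equation for p, which is merely integrable.
Multiplying it by the transform of the window, for which s ŵ = 1 - e^(-sT), leaves an identity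
between transforms of integrable functions, to which uniqueness applies. -/
lemma kernel_identity {p q : ℝ → ℝ} (hp : Integrable p) (hq : Integrable q) {c : ℝ}
    (h : ∀ ξ, freq ξ * kernelFT p ξ + kernelFT q ξ = c) {T : ℝ} (hT : 0 ≤ T) :
    ∀ᵐ τ, (p τ + -1 * p (τ + -T)) + ((∫ r, window T r * q (τ - r)) + -c * window T τ) = 0 := by
  have i1 : Integrable fun τ => -1 * p (τ + -T) := (hp.comp_add_right (-T)).const_mul (-1)
  have i2 := integrable_convolution (integrable_window T) hq
  have i3 : Integrable fun τ => -c * window T τ := (integrable_window T).const_mul (-c)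
  have i4 : Integrable fun τ => p τ + -1 * p (τ + -T) := hp.add i1
  have i5 : Integrable fun τ => (∫ r, window T r * q (τ - r)) + -c * window T τ := i2.add i3
  refine ae_eq_zero_of_kernelFT_eq_zero (i4.add i5) fun ξ => ?_
  rw [kernelFT_add i4 i5, kernelFT_add hp i1, kernelFT_add i2 i3,
    kernelFT_const_mul, kernelFT_const_mul, kernelFT_comp_add,
    kernelFT_convolution (integrable_window T) hq]
  have e := freq_mul_kernelFT_window hT ξ
  have h' := h ξ
  push_cast
  rw [mul_neg]
  linear_combination (-kernelFT p ξ) * e + kernelFT (window T) ξ * h'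

section Conv

variable {E : Type*} [NormedAddCommGroup E] [NormedSpace ℝ E] [CompleteSpace E]

lemma conv_sub_conv_add_integral {p q : ℝ → ℝ} (hp : Integrable p) (hq : Integrable q) {c : ℝ}
    (h : ∀ ξ, freq ξ * kernelFT p ξ + kernelFT q ξ = c) {x : ℝ → E} (hx : Continuous x) {C : ℝ}
    (hC : ∀ t, ‖x t‖ ≤ C) {T : ℝ} (hT : 0 ≤ T) (t : ℝ) :
    conv p x t - conv p x (t - T) + ((∫ r in (0 : ℝ)..T, conv q x (t - r))
      - c • ∫ r in (0 : ℝ)..T, x (t - r)) = 0 := by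
  have hG : Continuous fun τ => x (t - τ) := by fun_prop
  have hGC : ∀ τ, ‖x (t - τ)‖ ≤ C := fun τ => hC _
  have i0 := integrable_kernel_smul hp hG hGC
  have i1 := integrable_kernel_smul (hp.comp_add_right (-T)) hG hGC
  have i2 := integrable_kernel_smul (integrable_convolution (integrable_window T) hq) hG hGC
  have i3 := integrable_kernel_smul (integrable_window T) hG hGC
  have e1 : conv p x (t - T) = ∫ τ, p (τ + -T) • x (t - τ) := by
    rw [conv, ← integral_add_right_eq_self _ (-T)]
    congr 1; ext τ; congr 2; ring
  have e2 : ∫ r in (0 : ℝ)..T, conv q x (t - r)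
      = ∫ τ, (∫ r, window T r * q (τ - r)) • x (t - τ) := by
    rw [integral_convolution_smul (integrable_window T) hq hG hGC, integral_window_smul hT]
    refine intervalIntegral.integral_congr fun r _ => ?_
    simp only [conv]
    congr 1; ext τ; congr 2; ring
  have e3 : ∫ r in (0 : ℝ)..T, x (t - r) = ∫ τ, window T τ • x (t - τ) :=
    (integral_window_smul hT _).symm
  have i4 : Integrable fun τ => c • window T τ • x (t - τ) := i3.smul c
  have i5 : Integrable fun τ => p τ • x (t - τ) - p (τ + -T) • x (t - τ) := i0.sub i1
  have i6 : Integrable fun τ => (∫ r, window T r * q (τ - r)) • x (t - τ)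
      - c • window T τ • x (t - τ) := i2.sub i4
  rw [e1, e2, e3, conv, ← integral_smul, ← integral_sub i0 i1, ← integral_sub i2 i4,
    ← integral_add i5 i6]
  refine (integral_congr_ae ?_).trans (integral_zero ℝ E)
  filter_upwards [kernel_identity hp hq h hT] with τ hτ
  rw [← sub_smul, smul_smul, ← sub_smul, ← add_smul]
  convert zero_smul ℝ _ using 2
  linarith

/-- If `s p̂ + q̂ = c`, then `p * x' + q * x = c x` for bounded continuously differentiable `x`. -/
theorem conv_deriv_add_conv {p q : ℝ → ℝ} (hp : Integrable p) (hq : Integrable q) {c : ℝ}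
    (h : ∀ ξ, freq ξ * kernelFT p ξ + kernelFT q ξ = c) {x y : ℝ → E}
    (hxy : ∀ t, HasDerivAt x (y t) t) (hy : Continuous y) {C C' : ℝ} (hC : ∀ t, ‖x t‖ ≤ C)
    (hC' : ∀ t, ‖y t‖ ≤ C') (t : ℝ) : conv p y t + conv q x t = c • x t := by
  have hx : Continuous x := continuous_iff_continuousAt.2 fun t => (hxy t).continuousAt
  have hcq := continuous_conv hq hx hC
  have d1 : HasDerivAt (fun T => conv p x (t - T)) (-conv p y t) 0 := by
    have := HasDerivAt.comp_const_sub t 0 (by simpa using hasDerivAt_conv hp hxy hy hC hC' (t - 0))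
    simpa using this
  have d2 : HasDerivAt (fun T => ∫ r in (0 : ℝ)..T, conv q x (t - r)) (conv q x t) 0 := by
    have hc : Continuous fun r => conv q x (t - r) := by fun_prop
    simpa using hc.integral_hasStrictDerivAt 0 0 |>.hasDerivAt
  have d3 : HasDerivAt (fun T => ∫ r in (0 : ℝ)..T, x (t - r)) (x t) 0 := by
    have hc : Continuous fun r => x (t - r) := by fun_prop
    simpa using hc.integral_hasStrictDerivAt 0 0 |>.hasDerivAt
  -- The integrated identity is available only for T ≥ 0, so it is differentiated from the right at
  -- T = 0.
  have d := ((d1.const_sub (conv p x t)).add (d2.sub (d3.const_smul c))).hasDerivWithinAt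
    (s := Set.Ici 0)
  have d0 : HasDerivWithinAt (fun T => conv p x t - conv p x (t - T)
      + ((∫ r in (0 : ℝ)..T, conv q x (t - r)) - c • ∫ r in (0 : ℝ)..T, x (t - r))) 0
      (Set.Ici 0) 0 :=
    (hasDerivWithinAt_const 0 (Set.Ici (0 : ℝ)) (0 : E)).congr
      (fun T hT => conv_sub_conv_add_integral hp hq h hx hC hT t)
      (conv_sub_conv_add_integral hp hq h hx hC le_rfl t)
  have := (uniqueDiffOn_Ici (0 : ℝ) 0 Set.self_mem_Ici).eq_deriv _ d d0
  rw [neg_neg, ← add_sub_assoc] at this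
  exact sub_eq_zero.1 this

end Conv

end CCC

/-! ### The closed loop for signals in a Banach space: resolvent identities, existence and
uniqueness. -/

noncomputable section

namespace CCC

/-- The kernels with transfer functions `1 / D(s)` and `s / D(s)`. -/
structure IsKernelPair (γ c σ : ℝ) (k₀ k₁ : ℝ → ℝ) : Prop where
  ne_zero : ∀ ξ, axisD γ c σ ξ ≠ 0
  integrable₀ : Integrable k₀
  integrable₁ : Integrable k₁
  kernelFT₀ : ∀ ξ, kernelFT k₀ ξ = (axisD γ c σ ξ)⁻¹
  kernelFT₁ : ∀ ξ, kernelFT k₁ ξ = freq ξ * (axisD γ c σ ξ)⁻¹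

/-- A bounded signal with bounded continuous derivative. -/
structure IsSmoothSignal {E : Type*} [NormedAddCommGroup E] [NormedSpace ℝ E] (x y : ℝ → E) :
    Prop where
  hasDerivAt : ∀ t, HasDerivAt x (y t) t
  continuous_deriv : Continuous y
  bounded : ∃ C : ℝ, ∀ t, ‖x t‖ ≤ C
  bounded_deriv : ∃ C : ℝ, ∀ t, ‖y t‖ ≤ C

variable {E : Type*} [NormedAddCommGroup E] [NormedSpace ℝ E]

lemma IsSmoothSignal.continuous {x y : ℝ → E} (h : IsSmoothSignal x y) : Continuous x :=
  continuous_iff_continuousAt.2 fun t => (h.hasDerivAt t).continuousAt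

lemma IsSmoothSignal.hasDerivAt_conv {x y : ℝ → E} (h : IsSmoothSignal x y) {k : ℝ → ℝ}
    (hk : Integrable k) (t : ℝ) : HasDerivAt (conv k x) (conv k y t) t := by
  obtain ⟨C, hC⟩ := h.bounded
  obtain ⟨C', hC'⟩ := h.bounded_deriv
  exact CCC.hasDerivAt_conv hk h.hasDerivAt h.continuous_deriv hC hC' t

lemma IsSmoothSignal.conv_bounded {x y : ℝ → E} (h : IsSmoothSignal x y) {k : ℝ → ℝ}
    (hk : Integrable k) : ∃ C : ℝ, ∀ t, ‖conv k x t‖ ≤ C := by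
  obtain ⟨C, hC⟩ := h.bounded
  exact ⟨_, norm_conv_le hk hC⟩

lemma conv_add {k l : ℝ → ℝ} (hk : Integrable k) (hl : Integrable l) {x : ℝ → E}
    (hx : Continuous x) {C : ℝ} (hC : ∀ t, ‖x t‖ ≤ C) (t : ℝ) :
    conv (fun τ => k τ + l τ) x t = conv k x t + conv l x t := by
  have hG : Continuous fun τ => x (t - τ) := by fun_prop
  rw [conv, conv, conv, ← integral_add (integrable_kernel_smul hk hG fun τ => hC _)
    (integrable_kernel_smul hl hG fun τ => hC _)]
  simp only [add_smul]

lemma conv_const_mul (a : ℝ) (k : ℝ → ℝ) (x : ℝ → E) (t : ℝ) :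
    conv (fun τ => a * k τ) x t = a • conv k x t := by
  rw [conv, conv, ← integral_smul]
  simp only [mul_smul]

lemma conv_comp_add (k : ℝ → ℝ) (a : ℝ) (x : ℝ → E) (t : ℝ) :
    conv (fun τ => k (τ + a)) x t = conv k x (t + a) := by
  rw [conv, conv, ← integral_add_right_eq_self (fun τ => k τ • x (t + a - τ)) a]
  simp only [add_sub_add_right_eq_sub]

lemma conv_neg (k : ℝ → ℝ) (x : ℝ → E) (t : ℝ) : conv k (fun s => -x s) t = -conv k x t := by
  simp only [conv, smul_neg, integral_neg]

namespace IsKernelPair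

variable [CompleteSpace E] {γ c σ : ℝ} {k₀ k₁ : ℝ → ℝ} (hK : IsKernelPair γ c σ k₀ k₁)
include hK

/-- Time-domain form of s · (1/D) = s/D. -/
lemma conv_deriv {x y : ℝ → E} (h : IsSmoothSignal x y) (t : ℝ) :
    conv k₀ y t = conv k₁ x t := by
  obtain ⟨C, hC⟩ := h.bounded
  obtain ⟨C', hC'⟩ := h.bounded_deriv
  have := conv_deriv_add_conv (c := 0) hK.integrable₀ (hK.integrable₁.const_mul (-1)) (fun ξ => by
    rw [kernelFT_const_mul, hK.kernelFT₀, hK.kernelFT₁]; push_cast; ring) h.hasDerivAt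
    h.continuous_deriv hC hC' t
  rw [conv_const_mul, zero_smul, neg_one_smul] at this
  exact add_neg_eq_zero.1 this

/-- Time-domain form of D · (1/D) = 1; the factor e^(sσ) in D is the advance by `σ`. -/
lemma conv_resolvent {x y : ℝ → E} (h : IsSmoothSignal x y) (t : ℝ) :
    conv k₁ y (t + σ) + (γ • conv k₁ x t + c • conv k₀ x t) = x t := by
  obtain ⟨C, hC⟩ := h.bounded
  obtain ⟨C', hC'⟩ := h.bounded_deriv
  have i0 := hK.integrable₀.const_mul c
  have i1 := hK.integrable₁.const_mul γ
  have := conv_deriv_add_conv (c := 1) (hK.integrable₁.comp_add_right σ) (i1.add i0) (fun ξ => by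
    rw [show (fun τ => γ * k₁ τ) + (fun τ => c * k₀ τ) = fun τ => γ * k₁ τ + c * k₀ τ from rfl,
      kernelFT_add i1 i0, kernelFT_const_mul, kernelFT_const_mul, kernelFT_comp_add,
      hK.kernelFT₀, hK.kernelFT₁]
    have hne := hK.ne_zero ξ
    rw [Complex.ofReal_one, ← mul_inv_cancel₀ hne]
    nth_rw 4 [axisD]
    ring) h.hasDerivAt h.continuous_deriv hC hC' t
  rw [show (fun τ => γ * k₁ τ) + (fun τ => c * k₀ τ) = fun τ => γ * k₁ τ + c * k₀ τ from rfl,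
    conv_add i1 i0 h.continuous hC, conv_const_mul, conv_const_mul, conv_comp_add, one_smul] at this
  exact this

/-- A bounded solution of the homogeneous equation on the whole time axis vanishes. -/
theorem eq_zero_of_homogeneous {h v w : ℝ → E} (hh : ∀ t, HasDerivAt h (-v t) t)
    (hv : ∀ t, HasDerivAt v (w t) t) (hw : ∀ t, w t = c • h (t - σ) - γ • v (t - σ))
    (hhb : ∃ C : ℝ, ∀ t, ‖h t‖ ≤ C) (hvb : ∃ C : ℝ, ∀ t, ‖v t‖ ≤ C) (t : ℝ) :
    h t = 0 ∧ v t = 0 := by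
  obtain ⟨C, hC⟩ := hhb
  obtain ⟨C', hC'⟩ := hvb
  have hvc : Continuous v := continuous_iff_continuousAt.2 fun t => (hv t).continuousAt
  have hhc : Continuous h := continuous_iff_continuousAt.2 fun t => (hh t).continuousAt
  have hwc : Continuous w := by rw [funext hw]; fun_prop
  have sh : IsSmoothSignal h fun t => -v t :=
    ⟨hh, hvc.neg, ⟨C, hC⟩, ⟨C', fun t => by rw [norm_neg]; exact hC' t⟩⟩
  have sv : IsSmoothSignal v w := by
    refine ⟨hv, hwc, ⟨C', hC'⟩, ‖c‖ * C + ‖γ‖ * C', fun t => ?_⟩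
    rw [hw]
    refine (norm_sub_le _ _).trans ?_
    rw [norm_smul, norm_smul]
    gcongr
    · exact hC _
    · exact hC' _
  -- In the resolvent identity for h, the derivatives are moved off k₁ and w is replaced by the
  -- feedback law; all terms cancel. The vanishing of v then follows from h' = -v.
  have key : ∀ t, h t = 0 := fun t => by
    have e1 : conv k₁ (fun t => -v t) (t + σ) = -conv k₀ w (t + σ) := by
      rw [conv_neg, hK.conv_deriv sv]
    have e2 : conv k₁ h t = -conv k₀ v t := by rw [← hK.conv_deriv sh, conv_neg]
    have e3 : conv k₀ w (t + σ) = c • conv k₀ h t - γ • conv k₀ v t := by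
      have i1 := integrable_kernel_smul hK.integrable₀
        (by fun_prop : Continuous fun τ => h (t - τ)) fun τ => hC _
      have i2 := integrable_kernel_smul hK.integrable₀
        (by fun_prop : Continuous fun τ => v (t - τ)) fun τ => hC' _
      have i3 : Integrable fun τ => c • k₀ τ • h (t - τ) := i1.smul c
      have i4 : Integrable fun τ => γ • k₀ τ • v (t - τ) := i2.smul γ
      simp only [conv]
      rw [← integral_smul, ← integral_smul, ← integral_sub i3 i4]
      congr 1; ext τ
      rw [hw, smul_sub, smul_comm, smul_comm (k₀ τ) γ, show t + σ - τ - σ = t - τ by ring]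
    rw [← hK.conv_resolvent sh t, e1, e2, e3]
    simp only [smul_neg]
    abel
  refine ⟨key t, ?_⟩
  have h0 : HasDerivAt h 0 t := by
    rw [funext key]; exact hasDerivAt_const t 0
  exact neg_eq_zero.1 ((hh t).unique h0)

end IsKernelPair

section Response

variable {ι : Type*} [Fintype ι]

/-- Speed component of the bounded response to the inputs `x`. -/
def responseV (c : ℝ) (lead : ι) (β d : ι → ℝ) (k₀ k₁ : ℝ → ℝ) (x : ι → ℝ → E) (t : ℝ) : E :=
  ∑ i, β i • conv k₁ (x i) (t + -d i) + c • conv k₀ (x lead) t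

/-- Headway component of the bounded response to the inputs `x`. -/
def responseH (γ σ : ℝ) (lead : ι) (β d : ι → ℝ) (k₀ k₁ : ℝ → ℝ) (x : ι → ℝ → E) (t : ℝ) : E :=
  conv k₁ (x lead) (t + σ) + γ • conv k₀ (x lead) t + -∑ i, β i • conv k₀ (x i) (t + -d i)

/-- Acceleration component of the bounded response to the inputs `x`. -/
def responseA (γ c σ : ℝ) (lead : ι) (β d : ι → ℝ) (k₀ k₁ : ℝ → ℝ) (x : ι → ℝ → E) (t : ℝ) : E :=
  c • responseH γ σ lead β d k₀ k₁ x (t + -σ) + -(γ • responseV c lead β d k₀ k₁ x (t + -σ))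
    + ∑ i, β i • x i (t + -(σ + d i))

variable {γ c σ : ℝ} {k₀ k₁ : ℝ → ℝ} (hK : IsKernelPair γ c σ k₀ k₁)
  (lead : ι) (β d : ι → ℝ) {x y : ι → ℝ → E} (hx : ∀ i, IsSmoothSignal (x i) (y i))
include hK hx

lemma hasDerivAt_responseV' (t : ℝ) :
    HasDerivAt (responseV c lead β d k₀ k₁ x) (responseV c lead β d k₀ k₁ y t) t := by
  refine HasDerivAt.add (HasDerivAt.fun_sum fun i _ => HasDerivAt.const_smul (β i) ?_)
    (((hx lead).hasDerivAt_conv hK.integrable₀ t).const_smul c)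
  exact ((hx i).hasDerivAt_conv hK.integrable₁ _).comp_add_const t (-d i)

lemma hasDerivAt_responseH' (t : ℝ) :
    HasDerivAt (responseH γ σ lead β d k₀ k₁ x) (responseH γ σ lead β d k₀ k₁ y t) t := by
  refine HasDerivAt.add (HasDerivAt.add ?_
    (((hx lead).hasDerivAt_conv hK.integrable₀ t).const_smul γ))
    (HasDerivAt.neg (HasDerivAt.fun_sum fun i _ => HasDerivAt.const_smul (β i) ?_))
  · exact ((hx lead).hasDerivAt_conv hK.integrable₁ _).comp_add_const t σ
  · exact ((hx i).hasDerivAt_conv hK.integrable₀ _).comp_add_const t (-d i)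

/-- In transforms this is s (s e^(sσ) + γ)/D = 1 - c/D for the leading input, the other terms giving
the remaining part of -v. -/
lemma hasDerivAt_responseH [CompleteSpace E] (t : ℝ) : HasDerivAt (responseH γ σ lead β d k₀ k₁ x)
    (x lead t - responseV c lead β d k₀ k₁ x t) t := by
  refine (hasDerivAt_responseH' hK lead β d hx t).congr_deriv ?_
  have h1 := hK.conv_resolvent (hx lead) t
  rw [responseH, responseV, ← h1]
  simp only [hK.conv_deriv (hx _)]
  abel

/-- The resolvent identity at the delayed time t - σ - d i rewrites each k₁ * y i as the input minus
feedback terms, which regroup into the delayed headway and speed. -/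
lemma hasDerivAt_responseV [CompleteSpace E] (t : ℝ) : HasDerivAt (responseV c lead β d k₀ k₁ x)
    (responseA γ c σ lead β d k₀ k₁ x t) t := by
  refine (hasDerivAt_responseV' hK lead β d hx t).congr_deriv ?_
  have h1 : ∀ i, conv k₁ (y i) (t + -d i) = x i (t + -(σ + d i))
      - (γ • conv k₁ (x i) (t + -σ + -d i) + c • conv k₀ (x i) (t + -σ + -d i)) := fun i => by
    have := hK.conv_resolvent (hx i) (t + -(σ + d i))
    rw [show t + -(σ + d i) + σ = t + -d i by ring] at this
    rw [show t + -σ + -d i = t + -(σ + d i) by ring, ← this]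
    abel
  rw [responseV, responseA, responseH, responseV]
  simp only [h1, hK.conv_deriv (hx lead), neg_add_cancel_right]
  simp only [smul_add, smul_sub, smul_neg, Finset.smul_sum, Finset.sum_sub_distrib,
    Finset.sum_add_distrib]
  simp only [smul_comm c γ, smul_comm γ (β _), smul_comm c (β _)]
  abel

lemma responseV_bounded : ∃ C : ℝ, ∀ t, ‖responseV c lead β d k₀ k₁ x t‖ ≤ C := by
  choose C hC using fun i => (hx i).conv_bounded hK.integrable₁
  obtain ⟨C', hC'⟩ := (hx lead).conv_bounded hK.integrable₀
  refine ⟨∑ i, ‖β i‖ * C i + ‖c‖ * C', fun t => (norm_add_le _ _).trans ?_⟩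
  rw [norm_smul]
  gcongr
  · refine (norm_sum_le _ _).trans (Finset.sum_le_sum fun i _ => ?_)
    rw [norm_smul]
    gcongr
    exact hC i _
  · exact hC' t

lemma responseH_bounded : ∃ C : ℝ, ∀ t, ‖responseH γ σ lead β d k₀ k₁ x t‖ ≤ C := by
  choose C hC using fun i => (hx i).conv_bounded hK.integrable₀
  obtain ⟨C', hC'⟩ := (hx lead).conv_bounded hK.integrable₁
  refine ⟨C' + ‖γ‖ * C lead + ∑ i, ‖β i‖ * C i, fun t => (norm_add_le _ _).trans ?_⟩
  rw [norm_neg]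
  gcongr
  · refine (norm_add_le _ _).trans ?_
    rw [norm_smul]
    gcongr
    · exact hC' _
    · exact hC lead t
  · refine (norm_sum_le _ _).trans (Finset.sum_le_sum fun i _ => ?_)
    rw [norm_smul]
    gcongr
    exact hC i _

/-- Bounded solutions of the closed loop are unique. -/
theorem eq_response [CompleteSpace E] {h v a : ℝ → E} (hh : ∀ t, HasDerivAt h (x lead t - v t) t)
    (hv : ∀ t, HasDerivAt v (a t) t)
    (ha : ∀ t, a t = c • h (t + -σ) + -(γ • v (t + -σ)) + ∑ i, β i • x i (t + -(σ + d i)))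
    (hhb : ∃ C : ℝ, ∀ t, ‖h t‖ ≤ C) (hvb : ∃ C : ℝ, ∀ t, ‖v t‖ ≤ C) (t : ℝ) :
    v t = responseV c lead β d k₀ k₁ x t ∧ a t = responseA γ c σ lead β d k₀ k₁ x t := by
  obtain ⟨C₁, h₁⟩ := hhb
  obtain ⟨C₂, h₂⟩ := hvb
  obtain ⟨C₃, h₃⟩ := responseH_bounded hK lead β d hx
  obtain ⟨C₄, h₄⟩ := responseV_bounded hK lead β d hx
  have key : ∀ t, v t = responseV c lead β d k₀ k₁ x t := fun t => by
    refine sub_eq_zero.1 (hK.eq_zero_of_homogeneous (h := fun t => h t - responseH γ σ lead β d k₀ k₁ x t)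
      (v := fun t => v t - responseV c lead β d k₀ k₁ x t)
      (w := fun t => a t - responseA γ c σ lead β d k₀ k₁ x t) (fun t => ?_)
      (fun t => (hv t).sub (hasDerivAt_responseV hK lead β d hx t)) (fun t => ?_)
      ⟨C₁ + C₃, fun t => (norm_sub_le _ _).trans (add_le_add (h₁ t) (h₃ t))⟩
      ⟨C₂ + C₄, fun t => (norm_sub_le _ _).trans (add_le_add (h₂ t) (h₄ t))⟩ t).2
    · refine ((hh t).sub (hasDerivAt_responseH hK lead β d hx t)).congr_deriv ?_
      abel
    · simp only [ha, responseA, ← sub_eq_add_neg t σ, smul_sub]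
      abel
  exact ⟨key t, (hv t).unique (by rw [funext key]; exact hasDerivAt_responseV hK lead β d hx t)⟩

end Response

end CCC

/-! ### Stationary curves in Hilbert space and positivity of the spectral matrix. -/

noncomputable section

namespace CCC

variable {H : Type*} [NormedAddCommGroup H] [InnerProductSpace ℝ H]

/-- A differentiable curve with stationary correlation has a bounded, continuous derivative. -/
lemma isSmoothSignal_of_stationary {x y : ℝ → H} {r : ℝ → ℝ}
    (hr : ∀ s t, inner ℝ (x s) (x t) = r (s - t)) (hxy : ∀ t, HasDerivAt x (y t) t) :
    IsSmoothSignal x y := by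
  have hx : Continuous x := continuous_iff_continuousAt.2 fun t => (hxy t).continuousAt
  set F : ℝ → ℝ → H := fun δ t => δ⁻¹ • (x (t + δ) - x t) with hF
  have hlim : ∀ t, Tendsto (fun δ => F δ t) (𝓝[≠] 0) (𝓝 (y t)) := fun t =>
    hasDerivAt_iff_tendsto_slope_zero.1 (hxy t)
  -- By stationarity, distances between difference quotients do not depend on t; hence their
  -- convergence at 0 is uniform in t, and the derivative is continuous.
  have hFF : ∀ δ ε t, ‖F ε t - F δ t‖ = ‖F ε 0 - F δ 0‖ := fun δ ε t => by
    rw [← sq_eq_sq₀ (norm_nonneg _) (norm_nonneg _), ← real_inner_self_eq_norm_sq,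
      ← real_inner_self_eq_norm_sq]
    simp only [hF, inner_sub_left, inner_sub_right, inner_smul_left, inner_smul_right, hr]
    simp
  have hF1 : ∀ ε t, ‖F ε t‖ = ‖F ε 0‖ := fun ε t => by
    -- With the convention 0⁻¹ = 0 the quotient F 0 vanishes, so this is the statement about norms.
    have := hFF 0 ε t
    simpa [hF] using this
  have hyF : ∀ δ t, ‖y t - F δ t‖ = ‖y 0 - F δ 0‖ := fun δ t =>
    tendsto_nhds_unique (((hlim t).sub_const _).norm.congr fun ε => hFF δ ε t)
      ((hlim 0).sub_const _).norm
  have hy1 : ∀ t, ‖y t‖ = ‖y 0‖ := fun t =>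
    tendsto_nhds_unique ((hlim t).norm.congr fun ε => hF1 ε t) (hlim 0).norm
  refine ⟨hxy, ?_, ⟨‖x 0‖, fun t => le_of_eq ?_⟩, ⟨‖y 0‖, fun t => (hy1 t).le⟩⟩
  · have hu : TendstoUniformly F y (𝓝[≠] 0) := by
      rw [Metric.tendstoUniformly_iff]
      intro ε hε
      have := (Metric.tendsto_nhds.1 (hlim 0)) ε hε
      filter_upwards [this] with δ hδ t
      rwa [dist_eq_norm, hyF, ← dist_eq_norm, dist_comm]
    exact hu.continuous (Frequently.of_forall fun δ => by simp only [hF]; fun_prop)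
  · rw [← sq_eq_sq₀ (norm_nonneg _) (norm_nonneg _), ← real_inner_self_eq_norm_sq,
      ← real_inner_self_eq_norm_sq, hr, hr, sub_self, sub_self]

/-- A family of continuous curves with stationary, integrable cross-correlations. -/
structure IsStationaryFamily {ι : Type*} (x : ι → ℝ → H) (R : ι → ι → ℝ → ℝ) : Prop where
  inner_eq : ∀ i j s t, inner ℝ (x i s) (x j t) = R i j (s - t)
  continuous : ∀ i, Continuous (x i)
  integrable : ∀ i j, Integrable (R i j)

/-- Completing the square at -r/2: the autocorrelation of a Gaussian window is again Gaussian, of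
half the exponent. -/
lemma integral_gaussian_mul_shift (ε r : ℝ) :
    ∫ τ : ℝ, Real.exp (-ε * τ ^ 2) * Real.exp (-ε * (τ + r) ^ 2)
      = √(Real.pi / (2 * ε)) * Real.exp (-(ε / 2) * r ^ 2) := by
  rw [← integral_gaussian, ← integral_mul_const,
    ← integral_add_right_eq_self (fun τ : ℝ => Real.exp (-(2 * ε) * τ ^ 2) * _) (r / 2)]
  congr 1; ext τ
  rw [← Real.exp_add, ← Real.exp_add]
  ring_nf

namespace IsStationaryFamily

variable {ι : Type*} {x : ι → ℝ → H} {R : ι → ι → ℝ → ℝ} (hx : IsStationaryFamily x R)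
include hx

lemma continuous_corr (i j : ι) : Continuous (R i j) := by
  have : R i j = fun τ => inner ℝ (x i τ) (x j 0) := by
    ext τ; rw [hx.inner_eq, sub_zero]
  rw [this]
  exact (hx.continuous i).inner continuous_const

lemma corr_neg (i j : ι) (τ : ℝ) : R i j (-τ) = R j i τ := by
  have h1 := hx.inner_eq i j 0 τ
  have h2 := hx.inner_eq j i τ 0
  rw [zero_sub] at h1
  rw [sub_zero] at h2
  rw [← h1, ← h2, real_inner_comm]

lemma norm_eq (i : ι) (t : ℝ) : ‖x i t‖ = ‖x i 0‖ := by
  rw [← sq_eq_sq₀ (norm_nonneg _) (norm_nonneg _), ← real_inner_self_eq_norm_sq,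
    ← real_inner_self_eq_norm_sq, hx.inner_eq, hx.inner_eq, sub_self, sub_self]

lemma kernelFT_corr_conj (i j : ι) (ξ : ℝ) :
    (starRingEnd ℂ) (kernelFT (R i j) ξ) = kernelFT (R j i) ξ := by
  rw [kernelFT, ← integral_conj, kernelFT, ← integral_neg_eq_self]
  congr 1; ext τ
  simp only [hx.corr_neg, map_mul, Complex.conj_ofReal, ← Complex.exp_conj, map_neg, ← freq_neg]
  congr 2
  simp only [freq]; push_cast; ring

variable [Fintype ι] [CompleteSpace H]

/-- The spectral density matrix is positive semidefinite at every frequency. -/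
theorem spectral_nonneg (c : ι → ℂ) (ξ : ℝ) :
    0 ≤ (∑ i, ∑ j, c i * (starRingEnd ℂ) (c j) * kernelFT (R i j) ξ).re := by
  set u : ι → ℝ → ℂ := fun i s => c i * Complex.exp (-(freq ξ * s)) with hu
  have huc : ∀ i, Continuous (u i) := fun i => by simp only [hu]; fun_prop
  have hun : ∀ i s, ‖u i s‖ = ‖c i‖ := fun i s => by
    simp only [hu, norm_mul, exp_freq_mul_norm_le, mul_one]
  set f : ℝ → ℝ := fun τ => (∑ i, ∑ j, c i * (starRingEnd ℂ) (c j)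
    * (Complex.exp (-(freq ξ * τ)) * R i j τ)).re with hf
  have hterm : ∀ i j, Integrable fun τ : ℝ => c i * (starRingEnd ℂ) (c j)
      * (Complex.exp (-(freq ξ * τ)) * R i j τ) := fun i j =>
    (integrable_exp_freq_mul (hx.integrable i j) ξ).const_mul _
  have hFint : Integrable fun τ : ℝ => ∑ i, ∑ j, c i * (starRingEnd ℂ) (c j)
      * (Complex.exp (-(freq ξ * τ)) * R i j τ) :=
    integrable_finsetSum _ fun i _ => integrable_finsetSum _ fun j _ => hterm i j
  have hfint : Integrable f := hFint.re
  have hfI : ∫ τ, f τ = (∑ i, ∑ j, c i * (starRingEnd ℂ) (c j) * kernelFT (R i j) ξ).re := by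
    have h1 := integral_re hFint
    simp only [RCLike.re_to_complex] at h1
    rw [h1, integral_finsetSum _ fun i _ => integrable_finsetSum _ fun j _ => hterm i j]
    congr 1
    refine Finset.sum_congr rfl fun i _ => ?_
    rw [integral_finsetSum _ fun j _ => hterm i j]
    refine Finset.sum_congr rfl fun j _ => ?_
    rw [integral_const_mul, kernelFT]
  -- Real and imaginary parts of the modulated combination ∑ u i • x i, kept apart because H is a
  -- real space.
  set w₁ : ℝ → H := fun s => ∑ i, (u i s).re • x i s with hw₁
  set w₂ : ℝ → H := fun s => ∑ i, (u i s).im • x i s with hw₂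
  have hxc := hx.continuous
  have hw₁c : Continuous w₁ := by
    refine continuous_finsetSum _ fun i _ => ?_
    have := huc i
    have := hxc i
    exact (Complex.continuous_re.comp (huc i)).smul this
  have hw₂c : Continuous w₂ := by
    refine continuous_finsetSum _ fun i _ => ?_
    have := hxc i
    exact (Complex.continuous_im.comp (huc i)).smul this
  set C := ∑ i, ‖c i‖ * ‖x i 0‖ with hC
  have hw₁b : ∀ s, ‖w₁ s‖ ≤ C := fun s => (norm_sum_le _ _).trans
    (Finset.sum_le_sum fun i _ => by
      rw [norm_smul, hx.norm_eq, ← hun i s]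
      gcongr
      exact Complex.abs_re_le_norm _)
  have hw₂b : ∀ s, ‖w₂ s‖ ≤ C := fun s => (norm_sum_le _ _).trans
    (Finset.sum_le_sum fun i _ => by
      rw [norm_smul, hx.norm_eq, ← hun i s]
      gcongr
      exact Complex.abs_im_le_norm _)
  have hinner : ∀ s t, inner ℝ (w₁ s) (w₁ t) + inner ℝ (w₂ s) (w₂ t) = f (s - t) := fun s t => by
    have hexp : ∀ a b : ι → ℝ, inner ℝ (∑ i, a i • x i s) (∑ i, b i • x i t)
        = ∑ i, ∑ j, a i * b j * R i j (s - t) := fun a b => by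
      rw [sum_inner]
      refine Finset.sum_congr rfl fun i _ => ?_
      rw [inner_sum]
      refine Finset.sum_congr rfl fun j _ => ?_
      rw [real_inner_smul_left, real_inner_smul_right, hx.inner_eq, mul_assoc]
    simp only [hw₁, hw₂, hf, hexp, Complex.re_sum, ← Finset.sum_add_distrib]
    refine Finset.sum_congr rfl fun i _ => Finset.sum_congr rfl fun j _ => ?_
    have e : c i * (starRingEnd ℂ) (c j) * (Complex.exp (-(freq ξ * ((s - t : ℝ) : ℂ)))
        * (R i j (s - t) : ℂ)) = u i s * (starRingEnd ℂ) (u j t) * (R i j (s - t) : ℂ) := by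
      have h2 : (starRingEnd ℂ) (Complex.exp (-(freq ξ * t))) = Complex.exp (freq ξ * t) := by
        rw [← Complex.exp_conj]
        simp [freq, Complex.conj_ofNat]
      simp only [hu, map_mul, h2]
      rw [show -(freq ξ * ((s - t : ℝ) : ℂ)) = -(freq ξ * s) + freq ξ * t by push_cast; ring,
        Complex.exp_add]
      ring
    rw [e]
    simp [Complex.mul_re, Complex.mul_im]
    ring
  -- The squared norms of ∫ g w₁ and ∫ g w₂, for a Gaussian window g, sum to a nonnegative number.
  -- By stationarity this sum is f integrated against the autocorrelation of g, a positive multiple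
  -- of the Gaussian in the claim.
  have hgauss : ∀ ε : ℝ, 0 < ε → 0 ≤ ∫ τ, Real.exp (-(ε / 2) * τ ^ 2) * f τ := fun ε hε => by
    set g : ℝ → ℝ := fun t => Real.exp (-ε * t ^ 2) with hg
    have hgi : Integrable g := integrable_exp_neg_mul_sq hε
    have key : ∀ w : ℝ → H, Continuous w → (∀ s, ‖w s‖ ≤ C) →
        Integrable (fun τ => g τ * ∫ s, g s * inner ℝ (w τ) (w s)) ∧
        0 ≤ ∫ τ, g τ * ∫ s, g s * inner ℝ (w τ) (w s) := fun w hw hwC => by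
      have i1 := integrable_kernel_smul hgi hw hwC
      have e1 : ∀ τ, g τ * ∫ s, g s * inner ℝ (w τ) (w s)
          = inner ℝ (∫ s, g s • w s) (g τ • w τ) := fun τ => by
        have h1 := integral_inner (𝕜 := ℝ) i1 (w τ)
        simp only [real_inner_smul_right] at h1 ⊢
        rw [h1, real_inner_comm]
      simp_rw [e1]
      refine ⟨i1.const_inner _, ?_⟩
      rw [integral_inner i1]
      exact real_inner_self_nonneg
    obtain ⟨j1, p1⟩ := key w₁ hw₁c hw₁b
    obtain ⟨j2, p2⟩ := key w₂ hw₂c hw₂b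
    have hsum := add_nonneg p1 p2
    rw [← integral_add j1 j2] at hsum
    have e2 : ∀ τ, (g τ * ∫ s, g s * inner ℝ (w₁ τ) (w₁ s))
        + (g τ * ∫ s, g s * inner ℝ (w₂ τ) (w₂ s)) = (∫ r, f r * g (τ - r)) * g τ := fun τ => by
      have i1 : Integrable fun s => g s * inner ℝ (w₁ τ) (w₁ s) := by
        have := (integrable_kernel_smul hgi hw₁c hw₁b).const_inner (𝕜 := ℝ) (w₁ τ)
        simpa only [inner_smul_right] using this
      have i2 : Integrable fun s => g s * inner ℝ (w₂ τ) (w₂ s) := by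
        have := (integrable_kernel_smul hgi hw₂c hw₂b).const_inner (𝕜 := ℝ) (w₂ τ)
        simpa only [inner_smul_right] using this
      rw [← mul_add, ← integral_add i1 i2, mul_comm]
      congr 1
      rw [← integral_sub_left_eq_self (fun r => f r * g (τ - r)) volume τ]
      congr 1; ext s
      rw [← mul_add, hinner, sub_sub_cancel, mul_comm]
    simp_rw [e2] at hsum
    have hfub := integral_convolution_smul hfint hgi (G := g) (by simp only [hg]; fun_prop)
      (C := 1) (fun t => by
        rw [Real.norm_eq_abs, abs_of_pos (Real.exp_pos _)]
        exact Real.exp_le_one_iff.2 (by nlinarith [sq_nonneg t]))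
    simp only [smul_eq_mul] at hfub
    rw [hfub] at hsum
    simp only [hg, integral_gaussian_mul_shift ε] at hsum
    have e3 : ∀ r : ℝ, f r * (√(Real.pi / (2 * ε)) * Real.exp (-(ε / 2) * r ^ 2))
        = √(Real.pi / (2 * ε)) * (Real.exp (-(ε / 2) * r ^ 2) * f r) := fun r => by ring
    simp_rw [e3] at hsum
    rw [integral_const_mul] at hsum
    exact nonneg_of_mul_nonneg_right hsum (Real.sqrt_pos.2 (by have := Real.pi_pos; positivity))
  rw [← hfI]
  -- Widening the window removes the Gaussian factor by dominated convergence.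
  have hlim : Tendsto (fun n : ℕ => ∫ τ, Real.exp (-(1 / ((n : ℝ) + 1) / 2) * τ ^ 2) * f τ) atTop
      (𝓝 (∫ τ, f τ)) := by
    refine tendsto_integral_of_dominated_convergence (fun τ => ‖f τ‖) (fun n => ?_) hfint.norm
      (fun n => ae_of_all _ fun τ => ?_) (ae_of_all _ fun τ => ?_)
    · exact (by fun_prop : Continuous fun τ : ℝ =>
        Real.exp (-(1 / ((n : ℝ) + 1) / 2) * τ ^ 2)).aestronglyMeasurable.mul
        hfint.aestronglyMeasurable
    · rw [norm_mul, Real.norm_eq_abs, abs_of_pos (Real.exp_pos _)]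
      refine mul_le_of_le_one_left (norm_nonneg _) (Real.exp_le_one_iff.2 ?_)
      have : 0 ≤ 1 / ((n : ℝ) + 1) / 2 * τ ^ 2 := by positivity
      linarith
    · have h0 : Tendsto (fun n : ℕ => 1 / ((n : ℝ) + 1)) atTop (𝓝 0) :=
        tendsto_one_div_add_atTop_nhds_zero_nat
      have h1 : Tendsto (fun n : ℕ => Real.exp (-(1 / ((n : ℝ) + 1) / 2) * τ ^ 2)) atTop
          (𝓝 (Real.exp (-(0 / 2) * τ ^ 2))) :=
        ((by fun_prop : Continuous fun z : ℝ => Real.exp (-(z / 2) * τ ^ 2)).tendsto 0).comp h0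
      simpa using h1.mul_const (f τ)
  exact ge_of_tendsto' hlim fun n => hgauss _ (by positivity)

end IsStationaryFamily

end CCC

/-! ### Integrability of the spectral densities and Fourier inversion. -/

noncomputable section

namespace CCC

/-- A continuous integrable function with nonnegative Fourier transform has an integrable Fourier
transform. -/
lemma integrable_kernelFT_of_nonneg {k : ℝ → ℝ} (hk : Integrable k) (hkc : Continuous k)
    (hre : ∀ ξ, 0 ≤ (kernelFT k ξ).re) (him : ∀ ξ, (kernelFT k ξ).im = 0) :
    Integrable (kernelFT k) := by
  have hki : Integrable fun t => (k t : ℂ) := hk.ofReal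
  have hF : 𝓕 (fun t => (k t : ℂ)) = kernelFT k := funext (fourier_ofReal k)
  have hFc : Continuous (kernelFT k) := hF ▸ continuous_fourier hki
  set g : ℝ → ℝ → ℂ := fun a ξ => Complex.exp (-(a : ℂ)⁻¹ * (‖ξ‖ : ℂ) ^ 2) with hg
  have hgi : ∀ a : ℝ, 0 < a → Integrable (g a) := fun a ha => by
    have := GaussianFourier.integrable_cexp_neg_mul_sq_norm_add (V := ℝ) (b := (a : ℂ)⁻¹)
      (by simpa using ha) 0 0
    simpa [hg] using this
  have hlim := Real.tendsto_integral_gaussian_smul' hki (v := 0)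
    (Complex.continuous_ofReal.comp hkc).continuousAt
  -- Moving the transform onto the Gaussian turns the regularized integral into an approximate
  -- identity acting on k at 0; the limit k 0 supplies a bound uniform in the regularization.
  have hlim2 : Tendsto (fun a : ℝ => ∫ ξ, g a ξ * kernelFT k ξ) atTop (𝓝 (k 0 : ℂ)) := by
    refine hlim.congr' ?_
    filter_upwards [Ioi_mem_atTop 0] with a (ha : 0 < a)
    have hflip := VectorFourier.integral_fourierIntegral_smul_eq_flip (L := innerₗ ℝ)
      (μ := volume) (ν := volume) Real.continuous_fourierChar (by exact continuous_inner)
      (hgi a ha) hki (𝕜 := ℝ)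
    rw [flip_innerₗ] at hflip
    have h2 : ∫ ξ, g a ξ * kernelFT k ξ = ∫ ξ, 𝓕 (g a) ξ • (k ξ : ℂ) := by
      refine Eq.trans ?_ hflip.symm
      rw [← hF]
      rfl
    rw [h2]
    refine integral_congr_ae (ae_of_all _ fun ξ => ?_)
    have h3 := fourier_gaussian_innerProductSpace (V := ℝ) (b := (a : ℂ)⁻¹) (by simpa using ha) ξ
    simp only [hg]
    simp only [neg_mul] at h3 ⊢
    rw [h3]
    congr 2
    · simp
    · congr 1
      simp
      ring
  obtain ⟨B, hB⟩ := hlim2.norm.isBoundedUnder_le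
  rw [eventually_map] at hB
  have hcomp : Tendsto (fun n : ℕ => ((n : ℝ) + 1) ^ 2) atTop atTop :=
    (tendsto_pow_atTop two_ne_zero).comp
      (tendsto_atTop_add_const_right _ _ tendsto_natCast_atTop_atTop)
  have hnorm : ∀ ξ, ((‖kernelFT k ξ‖ : ℝ) : ℂ) = kernelFT k ξ := fun ξ => by
    have h1 : kernelFT k ξ = ((kernelFT k ξ).re : ℂ) := Complex.ext rfl (by simp [him])
    rw [h1, Complex.norm_real, Real.norm_of_nonneg (hre ξ)]
  have hneg : Tendsto (fun n : ℕ => -((n : ℝ) + 1)) atTop atBot :=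
    tendsto_neg_atTop_atBot.comp (tendsto_atTop_add_const_right _ _ tendsto_natCast_atTop_atTop)
  refine integrable_of_intervalIntegral_norm_bounded (l := atTop) (Real.exp 1 * B)
    (fun n => hFc.integrableOn_Ioc) hneg
    (tendsto_atTop_add_const_right _ 1 tendsto_natCast_atTop_atTop) ?_
  filter_upwards [hcomp.eventually hB] with n hn
  set N : ℝ := (n : ℝ) + 1 with hN
  have hN0 : 0 < N := by positivity
  have hreal : ∀ ξ, g (N ^ 2) ξ * kernelFT k ξ
      = ((Real.exp (-(N ^ 2)⁻¹ * ξ ^ 2) * ‖kernelFT k ξ‖ : ℝ) : ℂ) := fun ξ => by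
    rw [Complex.ofReal_mul, hnorm]
    simp only [hg, Real.norm_eq_abs]
    rw [← Complex.ofReal_pow |ξ|, sq_abs]
    push_cast
    rfl
  have hint : Integrable fun ξ => Real.exp (-(N ^ 2)⁻¹ * ξ ^ 2) * ‖kernelFT k ξ‖ := by
    have hb := integrable_exp_neg_mul_sq (b := (N ^ 2)⁻¹) (by positivity)
    refine (hb.mul_const (∫ t, ‖(k t : ℂ)‖)).mono'
      ((by fun_prop : Continuous fun ξ => Real.exp (-(N ^ 2)⁻¹ * ξ ^ 2) * ‖kernelFT k ξ‖)
        ).aestronglyMeasurable (ae_of_all _ fun ξ => ?_)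
    rw [Real.norm_of_nonneg (by positivity), ← hF]
    gcongr
    exact norm_fourier_le _ _
  have hle : ∫ ξ, Real.exp (-(N ^ 2)⁻¹ * ξ ^ 2) * ‖kernelFT k ξ‖ ≤ B := by
    simp only [hreal, integral_complex_ofReal, Complex.norm_real] at hn
    exact (le_abs_self _).trans hn
  rw [intervalIntegral.integral_of_le (by linarith)]
  -- With width parameter N² the Gaussian is at least e⁻¹ on [-N, N], so the truncated integrals are
  -- at most e · B.
  calc ∫ ξ in Set.Ioc (-N) N, ‖kernelFT k ξ‖
      ≤ ∫ ξ in Set.Ioc (-N) N, Real.exp 1 * (Real.exp (-(N ^ 2)⁻¹ * ξ ^ 2) * ‖kernelFT k ξ‖) := by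
        refine setIntegral_mono_on hFc.norm.integrableOn_Ioc (hint.const_mul _).integrableOn
          measurableSet_Ioc fun ξ hξ => ?_
        rw [← mul_assoc, ← Real.exp_add]
        refine le_mul_of_one_le_left (norm_nonneg _) (Real.one_le_exp ?_)
        have h1 : ξ ^ 2 ≤ N ^ 2 := sq_le_sq' hξ.1.le hξ.2
        have h2 : (N ^ 2)⁻¹ * ξ ^ 2 ≤ (N ^ 2)⁻¹ * N ^ 2 := by gcongr
        rw [inv_mul_cancel₀ (by positivity)] at h2
        linarith
    _ ≤ ∫ ξ, Real.exp 1 * (Real.exp (-(N ^ 2)⁻¹ * ξ ^ 2) * ‖kernelFT k ξ‖) :=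
        setIntegral_le_integral (hint.const_mul _) (ae_of_all _ fun ξ => by positivity)
    _ = Real.exp 1 * ∫ ξ, Real.exp (-(N ^ 2)⁻¹ * ξ ^ 2) * ‖kernelFT k ξ‖ := integral_const_mul _ _
    _ ≤ Real.exp 1 * B := by gcongr

variable {H : Type*} [NormedAddCommGroup H] [InnerProductSpace ℝ H]

namespace IsStationaryFamily

variable {ι : Type*} {x : ι → ℝ → H} {R : ι → ι → ℝ → ℝ} (hx : IsStationaryFamily x R)
include hx

lemma comp {κ : Type*} (f : κ → ι) :
    IsStationaryFamily (fun k => x (f k)) (fun k l => R (f k) (f l)) :=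
  ⟨fun _ _ => hx.inner_eq _ _, fun _ => hx.continuous _, fun _ _ => hx.integrable _ _⟩

lemma continuous_spectrum (i j : ι) : Continuous (kernelFT (R i j)) := by
  have : 𝓕 (fun t => (R i j t : ℂ)) = kernelFT (R i j) := funext (fourier_ofReal _)
  rw [← this]
  exact continuous_fourier (hx.integrable i j).ofReal

variable [CompleteSpace H]

lemma spectrum_diag_nonneg (i : ι) (ξ : ℝ) : 0 ≤ (kernelFT (R i i) ξ).re := by
  simpa using (hx.comp fun _ : Unit => i).spectral_nonneg (fun _ => 1) ξ

/-- Positive semidefiniteness of the 2 × 2 spectral matrix, tested on (1, -z/|z|), gives 2|z| ≤ S_ii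
+ S_jj. -/
lemma norm_spectrum_le (i j : ι) (ξ : ℝ) :
    ‖kernelFT (R i j) ξ‖ ≤ (kernelFT (R i i) ξ).re + (kernelFT (R j j) ξ).re := by
  set z := kernelFT (R i j) ξ with hz
  have h0 := hx.spectrum_diag_nonneg i ξ
  have h1 := hx.spectrum_diag_nonneg j ξ
  rcases eq_or_ne z 0 with hz0 | hz0
  · rw [hz0, norm_zero]; linarith
  have hn : (‖z‖ : ℂ) ≠ 0 := by simpa using hz0
  have h := (hx.comp ![i, j]).spectral_nonneg ![1, -(z / ‖z‖)] ξ
  have hji : kernelFT (R j i) ξ = (starRingEnd ℂ) z := (hx.kernelFT_corr_conj i j ξ).symm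
  have hzz : z * (starRingEnd ℂ) z = (‖z‖ : ℂ) ^ 2 := Complex.mul_conj' z
  have e : ∑ k : Fin 2, ∑ l : Fin 2, (![1, -(z / ‖z‖)] : Fin 2 → ℂ) k
      * (starRingEnd ℂ) ((![1, -(z / ‖z‖)] : Fin 2 → ℂ) l) * kernelFT (R (![i, j] k) (![i, j] l)) ξ
      = kernelFT (R i i) ξ + kernelFT (R j j) ξ - 2 * ‖z‖ := by
    simp only [Fin.sum_univ_two, Matrix.cons_val_zero, Matrix.cons_val_one, map_one, map_neg,
      map_div₀, Complex.conj_ofReal, hji, ← hz]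
    field_simp
    linear_combination (kernelFT (R j j) ξ - 2 * ‖z‖) * hzz
  rw [e] at h
  simp at h
  nlinarith [norm_nonneg z]

/-- Diagonal densities are nonnegative transforms of continuous integrable functions, hence
integrable; they dominate the off-diagonal ones. -/
lemma integrable_spectrum (i j : ι) : Integrable (kernelFT (R i j)) := by
  have hdiag : ∀ i, Integrable (kernelFT (R i i)) := fun i =>
    integrable_kernelFT_of_nonneg (hx.integrable i i) (hx.continuous_corr i i)
      (hx.spectrum_diag_nonneg i) fun ξ => Complex.conj_eq_iff_im.1 (hx.kernelFT_corr_conj i i ξ)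
  exact ((hdiag i).re.add (hdiag j).re).mono' (hx.continuous_spectrum i j).aestronglyMeasurable
    (ae_of_all _ (hx.norm_spectrum_le i j))

lemma corr_eq_integral (i j : ι) (τ : ℝ) :
    (R i j τ : ℂ) = ∫ ξ, Complex.exp (freq ξ * τ) * kernelFT (R i j) ξ := by
  have hF : 𝓕 (fun t => (R i j t : ℂ)) = kernelFT (R i j) := funext (fourier_ofReal _)
  have hc : Continuous fun t => (R i j t : ℂ) :=
    Complex.continuous_ofReal.comp (hx.continuous_corr i j)
  have h := congrFun (hc.fourierInv_fourier_eq (hx.integrable i j).ofReal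
    (hF ▸ hx.integrable_spectrum i j)) τ
  rw [← h, hF, Real.fourierInv_eq_fourier_neg, Real.fourier_real_eq_integral_exp_smul]
  congr 1; ext ξ
  rw [smul_eq_mul, freq]
  congr 2
  push_cast; ring

end IsStationaryFamily

end CCC

/-! ### Linear time-invariant filters and their transfer functions. -/

noncomputable section

namespace CCC

variable {H : Type*} [NormedAddCommGroup H] [InnerProductSpace ℝ H] {ι : Type*}

open Classical in
/-- `IsFilter x Z M` states that `Z` arises from the signals `x` by linear time-invariant
operations with transfer functions `M i`, as functions of the frequency. -/
inductive IsFilter (x : ι → ℝ → H) : (ℝ → H) → (ι → ℝ → ℂ) → Prop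
  | base (i : ι) : IsFilter x (x i) (fun j _ => if j = i then 1 else 0)
  | zero : IsFilter x (fun _ => 0) (fun _ _ => 0)
  | add {Z Z' : ℝ → H} {M M' : ι → ℝ → ℂ} : IsFilter x Z M → IsFilter x Z' M' →
      IsFilter x (fun t => Z t + Z' t) (fun i ξ => M i ξ + M' i ξ)
  | smul (a : ℝ) {Z : ℝ → H} {M : ι → ℝ → ℂ} : IsFilter x Z M →
      IsFilter x (fun t => a • Z t) (fun i ξ => a * M i ξ)
  | shift (a : ℝ) {Z : ℝ → H} {M : ι → ℝ → ℂ} : IsFilter x Z M →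
      IsFilter x (fun t => Z (t + a)) (fun i ξ => Complex.exp (freq ξ * a) * M i ξ)
  | conv {k : ℝ → ℝ} (hk : Integrable k) {Z : ℝ → H} {M : ι → ℝ → ℂ} : IsFilter x Z M →
      IsFilter x (conv k Z) (fun i ξ => kernelFT k ξ * M i ξ)

lemma continuous_kernelFT {k : ℝ → ℝ} (hk : Integrable k) : Continuous (kernelFT k) := by
  have : FourierTransform.fourier (fun t => (k t : ℂ)) = kernelFT k := funext (fourier_ofReal _)
  rw [← this]
  exact continuous_fourier hk.ofReal

lemma norm_kernelFT_le (k : ℝ → ℝ) (ξ : ℝ) : ‖kernelFT k ξ‖ ≤ ∫ t, ‖k t‖ := by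
  refine (norm_integral_le_integral_norm _).trans (le_of_eq ?_)
  congr 1; ext t
  rw [norm_mul, exp_freq_mul_norm_le, one_mul, Complex.norm_real]

namespace IsFilter

variable {x : ι → ℝ → H} {Z Z' : ℝ → H} {M M' : ι → ℝ → ℂ}

lemma sum {κ : Type*} (s : Finset κ) {Z : κ → ℝ → H} {M : κ → ι → ℝ → ℂ}
    (h : ∀ k, IsFilter x (Z k) (M k)) :
    IsFilter x (fun t => ∑ k ∈ s, Z k t) (fun i ξ => ∑ k ∈ s, M k i ξ) := by
  classical
  induction s using Finset.induction_on with
  | empty => simpa using IsFilter.zero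
  | insert a s ha ih => simpa [Finset.sum_insert ha] using (h a).add ih

lemma neg (h : IsFilter x Z M) : IsFilter x (fun t => -Z t) (fun i ξ => -M i ξ) := by
  simpa using h.smul (-1)

lemma continuous_symbol (h : IsFilter x Z M) (i : ι) : Continuous (M i) := by
  induction h with
  | base j => by_cases hij : i = j <;> simp [hij, continuous_const]
  | zero => exact continuous_const
  | add _ _ h1 h2 => exact h1.add h2
  | smul a _ h => exact continuous_const.mul h
  | shift a _ h =>
    have : Continuous freq := (isSymbol_freq 0).1
    fun_prop
  | conv hk _ h => exact (continuous_kernelFT hk).mul h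

lemma bounded_symbol (h : IsFilter x Z M) (i : ι) : ∃ C : ℝ, ∀ ξ, ‖M i ξ‖ ≤ C := by
  induction h with
  | base j => exact ⟨1, fun ξ => by by_cases hij : i = j <;> simp [hij]⟩
  | zero => exact ⟨0, fun ξ => by simp⟩
  | add _ _ h1 h2 =>
    obtain ⟨C, hC⟩ := h1
    obtain ⟨C', hC'⟩ := h2
    exact ⟨C + C', fun ξ => (norm_add_le _ _).trans (add_le_add (hC ξ) (hC' ξ))⟩
  | smul a _ h =>
    obtain ⟨C, hC⟩ := h
    refine ⟨‖(a : ℂ)‖ * C, fun ξ => ?_⟩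
    rw [norm_mul]
    gcongr
    exact hC ξ
  | shift a _ h =>
    obtain ⟨C, hC⟩ := h
    refine ⟨C, fun ξ => ?_⟩
    rw [norm_mul, norm_exp_freq_mul, one_mul]
    exact hC ξ
  | @conv k hk _ _ _ h =>
    obtain ⟨C, hC⟩ := h
    refine ⟨(∫ t, ‖k t‖) * C, fun ξ => ?_⟩
    rw [norm_mul]
    gcongr
    · exact norm_kernelFT_le _ ξ
    · exact hC ξ

lemma continuous (hx : ∀ i, Continuous (x i)) (hb : ∀ i, ∃ C : ℝ, ∀ t, ‖x i t‖ ≤ C)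
    (h : IsFilter x Z M) : Continuous Z ∧ ∃ C : ℝ, ∀ t, ‖Z t‖ ≤ C := by
  induction h with
  | base j => exact ⟨hx j, hb j⟩
  | zero => exact ⟨continuous_const, 0, fun t => by simp⟩
  | add _ _ h1 h2 =>
    obtain ⟨hc, C, hC⟩ := h1
    obtain ⟨hc', C', hC'⟩ := h2
    exact ⟨hc.add hc', C + C', fun ξ => (norm_add_le _ _).trans (add_le_add (hC ξ) (hC' ξ))⟩
  | smul a _ h =>
    obtain ⟨hc, C, hC⟩ := h
    refine ⟨hc.const_smul a, ‖a‖ * C, fun ξ => ?_⟩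
    rw [norm_smul]
    gcongr
    exact hC ξ
  | shift a _ h =>
    obtain ⟨hc, C, hC⟩ := h
    exact ⟨by fun_prop, C, fun t => hC _⟩
  | conv hk _ h =>
    obtain ⟨hc, C, hC⟩ := h
    exact ⟨continuous_conv hk hc hC, _, norm_conv_le hk hC⟩

lemma lipschitz (hx : ∀ i, Continuous (x i)) (hb : ∀ i, ∃ C : ℝ, ∀ t, ‖x i t‖ ≤ C)
    (hl : ∀ i, ∃ L : ℝ, 0 ≤ L ∧ ∀ s t, ‖x i s - x i t‖ ≤ L * |s - t|)
    (h : IsFilter x Z M) : ∃ L : ℝ, 0 ≤ L ∧ ∀ s t, ‖Z s - Z t‖ ≤ L * |s - t| := by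
  induction h with
  | base j => exact hl j
  | zero => exact ⟨0, le_rfl, fun s t => by simp⟩
  | add _ _ h1 h2 =>
    obtain ⟨C, h0, hC⟩ := h1
    obtain ⟨C', h0', hC'⟩ := h2
    refine ⟨C + C', by positivity, fun s t => ?_⟩
    rw [add_sub_add_comm, add_mul]
    exact (norm_add_le _ _).trans (add_le_add (hC s t) (hC' s t))
  | smul a _ h =>
    obtain ⟨C, h0, hC⟩ := h
    refine ⟨‖a‖ * C, by positivity, fun s t => ?_⟩
    rw [← smul_sub, norm_smul, mul_assoc]
    gcongr
    exact hC s t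
  | shift a _ h =>
    obtain ⟨C, h0, hC⟩ := h
    exact ⟨C, h0, fun s t => by simpa using hC (s + a) (t + a)⟩
  | @conv k hk Z M hZ h =>
    obtain ⟨L, h0, hL⟩ := h
    obtain ⟨hc, C, hC⟩ := hZ.continuous hx hb
    refine ⟨(∫ τ, ‖k τ‖) * L, by positivity, fun s t => ?_⟩
    have i1 := integrable_kernel_smul hk (by fun_prop : Continuous fun τ => Z (s - τ)) fun τ => hC _
    have i2 := integrable_kernel_smul hk (by fun_prop : Continuous fun τ => Z (t - τ)) fun τ => hC _
    rw [CCC.conv, CCC.conv, ← integral_sub i1 i2, mul_assoc, ← integral_mul_const]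
    refine norm_integral_le_of_norm_le (hk.norm.mul_const _) (ae_of_all _ fun τ => ?_)
    rw [← smul_sub, norm_smul]
    gcongr
    simpa using hL (s - τ) (t - τ)

variable [CompleteSpace H]

/-- Orthogonality to the inputs passes to all filtered signals; taking double orthogonal complements
then gives membership in the closed span. -/
lemma inner_eq_zero (hx : ∀ i, Continuous (x i)) (hb : ∀ i, ∃ C : ℝ, ∀ t, ‖x i t‖ ≤ C) {u : H}
    (hu : ∀ i t, inner ℝ u (x i t) = 0) (h : IsFilter x Z M) (t : ℝ) : inner ℝ u (Z t) = 0 := by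
  induction h generalizing t with
  | base j => exact hu j t
  | zero => simp
  | add _ _ h1 h2 => rw [inner_add_right, h1, h2, add_zero]
  | smul a _ h => rw [real_inner_smul_right, h, mul_zero]
  | shift a _ h => exact h _
  | @conv k hk Z M hZ h =>
    obtain ⟨hc, C, hC⟩ := hZ.continuous hx hb
    have i1 := integrable_kernel_smul hk (by fun_prop : Continuous fun τ => Z (t - τ)) fun τ => hC _
    rw [CCC.conv, ← integral_inner i1]
    simp [real_inner_smul_right, h]

/-- Filtered signals stay in every closed subspace that contains the inputs. -/
lemma mem_closure_span (hx : ∀ i, Continuous (x i)) (hb : ∀ i, ∃ C : ℝ, ∀ t, ‖x i t‖ ≤ C)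
    (h : IsFilter x Z M) (t : ℝ) :
    Z t ∈ (Submodule.span ℝ (Set.range fun p : ι × ℝ => x p.1 p.2)).topologicalClosure := by
  rw [← Submodule.orthogonal_orthogonal_eq_closure, Submodule.mem_orthogonal]
  intro u hu
  refine h.inner_eq_zero hx hb (fun i s => ?_) t
  rw [real_inner_comm]
  exact (Submodule.mem_orthogonal _ _).1 hu _ (Submodule.subset_span ⟨(i, s), rfl⟩)

variable [Fintype ι]

omit [CompleteSpace H] in
lemma integrable_symbol_mul (h : IsFilter x Z M) {Q : ι → ℝ → ℂ} (hQ : ∀ i, Integrable (Q i))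
    (s : ℝ) : Integrable fun ξ => Complex.exp (freq ξ * s) * ∑ i, M i ξ * Q i ξ := by
  have hf : Continuous freq := (isSymbol_freq 0).1
  refine Integrable.bdd_mul (c := 1) (integrable_finsetSum _ fun i _ => ?_)
    (by fun_prop : Continuous _).aestronglyMeasurable
    (ae_of_all _ fun ξ => (norm_exp_freq_mul ξ s).le)
  obtain ⟨C, hC⟩ := h.bounded_symbol i
  exact (hQ i).bdd_mul (h.continuous_symbol i).aestronglyMeasurable (ae_of_all _ hC)

/-- Testing against a fixed vector u reduces filtering to multiplication by M in a scalar spectral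
representation. The only analytic case is convolution, which is Fubini's theorem. -/
lemma inner_eq_integral (hx : ∀ i, Continuous (x i)) (hb : ∀ i, ∃ C : ℝ, ∀ t, ‖x i t‖ ≤ C)
    {u : H} {Q : ι → ℝ → ℂ} (hQ : ∀ i, Integrable (Q i))
    (hu : ∀ i s, ((inner ℝ (x i s) u : ℝ) : ℂ) = ∫ ξ, Complex.exp (freq ξ * s) * Q i ξ)
    (h : IsFilter x Z M) (s : ℝ) :
    ((inner ℝ (Z s) u : ℝ) : ℂ) = ∫ ξ, Complex.exp (freq ξ * s) * ∑ i, M i ξ * Q i ξ := by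
  induction h generalizing s with
  | base j =>
    rw [hu j s]
    congr 1; ext ξ
    rw [Finset.sum_eq_single j (fun i _ hij => by simp [hij]) (by simp)]
    simp
  | zero => simp
  | add h1 h2 ih1 ih2 =>
    rw [inner_add_left, Complex.ofReal_add, ih1, ih2,
      ← integral_add (h1.integrable_symbol_mul hQ s) (h2.integrable_symbol_mul hQ s)]
    congr 1; ext ξ
    rw [← mul_add, ← Finset.sum_add_distrib]
    simp only [add_mul]
  | smul a h ih =>
    rw [real_inner_smul_left, Complex.ofReal_mul, ih, ← integral_const_mul]
    congr 1; ext ξ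
    simp only [mul_assoc, ← Finset.mul_sum]
    ring
  | shift a h ih =>
    rw [ih]
    congr 1; ext ξ
    simp only [mul_assoc, ← Finset.mul_sum]
    rw [Complex.ofReal_add, mul_add, Complex.exp_add]
    ring
  | @conv k hk Z M h ih =>
    obtain ⟨hc, C, hC⟩ := h.continuous hx hb
    have i1 := integrable_kernel_smul hk (by fun_prop : Continuous fun τ => Z (s - τ)) fun τ => hC _
    set q : ℝ → ℂ := fun ξ => ∑ i, M i ξ * Q i ξ with hq
    have hqi : Integrable q := by simpa using h.integrable_symbol_mul hQ 0
    have hf : Continuous freq := (isSymbol_freq 0).1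
    have e1 : ((inner ℝ (CCC.conv k Z s) u : ℝ) : ℂ)
        = ∫ τ, ∫ ξ, (k τ : ℂ) * (Complex.exp (freq ξ * (s - τ : ℝ)) * q ξ) := by
      rw [CCC.conv, real_inner_comm, ← integral_inner i1, ← integral_complex_ofReal]
      congr 1; ext τ
      rw [real_inner_smul_right, real_inner_comm, Complex.ofReal_mul, ih, integral_const_mul]
    have hint : Integrable (fun p : ℝ × ℝ =>
        (k p.1 : ℂ) * (Complex.exp (freq p.2 * (s - p.1 : ℝ)) * q p.2)) := by
      have h0 : Integrable (fun p : ℝ × ℝ => Complex.exp (freq p.2 * (s - p.1 : ℝ))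
          * ((k p.1 : ℂ) * q p.2)) :=
        (hk.ofReal.mul_prod hqi).bdd_mul (c := 1)
          (by fun_prop : Continuous fun p : ℝ × ℝ =>
            Complex.exp (freq p.2 * (s - p.1 : ℝ))).aestronglyMeasurable
          (ae_of_all _ fun p => (norm_exp_freq_mul _ _).le)
      refine h0.congr (ae_of_all _ fun p => ?_)
      simp only; ring
    rw [e1, integral_integral_swap hint]
    congr 1; ext ξ
    have e2 : ∑ i, kernelFT k ξ * M i ξ * Q i ξ = kernelFT k ξ * q ξ := by
      simp only [hq, Finset.mul_sum, mul_assoc]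
    rw [e2, kernelFT, ← integral_mul_const, ← integral_const_mul]
    congr 1; ext τ
    rw [Complex.ofReal_sub, mul_sub, sub_eq_add_neg, Complex.exp_add]
    ring

end IsFilter

/-- The correlation of two filtered signals in terms of the spectral densities of the inputs. -/
theorem IsStationaryFamily.inner_filter [Fintype ι] [CompleteSpace H] {x : ι → ℝ → H}
    {R : ι → ι → ℝ → ℝ} (hx : IsStationaryFamily x R) {Z Z' : ℝ → H} {M M' : ι → ℝ → ℂ}
    (hZ : IsFilter x Z M) (hZ' : IsFilter x Z' M') (s t : ℝ) :
    ((inner ℝ (Z s) (Z' t) : ℝ) : ℂ) = ∫ ξ, Complex.exp (freq ξ * (s - t : ℝ))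
      * ∑ i, ∑ j, M i ξ * (starRingEnd ℂ) (M' j ξ) * kernelFT (R i j) ξ := by
  have hc := hx.continuous
  have hb : ∀ i, ∃ C : ℝ, ∀ t, ‖x i t‖ ≤ C := fun i => ⟨‖x i 0‖, fun t => (hx.norm_eq i t).le⟩
  have hf : Continuous freq := (isSymbol_freq 0).1
  have hexp : ∀ t ξ, (starRingEnd ℂ) (Complex.exp (freq ξ * (t : ℝ)))
      = Complex.exp (freq ξ * (-t : ℝ)) := fun t ξ => by
    rw [← Complex.exp_conj]; simp [freq, Complex.conj_ofNat]
  have hadd : ∀ (a b : ℝ) ξ, Complex.exp (freq ξ * a) * Complex.exp (freq ξ * b)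
      = Complex.exp (freq ξ * (a + b : ℝ)) := fun a b ξ => by
    rw [← Complex.exp_add, Complex.ofReal_add, mul_add]
  have hei : ∀ (a : ℝ) {f : ℝ → ℂ}, Integrable f →
      Integrable fun ξ => Complex.exp (freq ξ * a) * f ξ := fun a f hfi =>
    hfi.bdd_mul (c := 1) (by fun_prop : Continuous _).aestronglyMeasurable
      (ae_of_all _ fun ξ => (norm_exp_freq_mul ξ a).le)
  -- The representation is used twice: here Z is filtered against the fixed vectors x j t, and below
  -- Z' is filtered against the fixed vector Z s. Conjugation exchanges the two roles in between.
  have step1 : ∀ j t, ((inner ℝ (Z s) (x j t) : ℝ) : ℂ) = ∫ ξ, Complex.exp (freq ξ * s)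
      * ∑ i, M i ξ * (Complex.exp (freq ξ * (-t : ℝ)) * kernelFT (R i j) ξ) := fun j t => by
    refine hZ.inner_eq_integral hc hb (fun i => hei _ (hx.integrable_spectrum i j))
      (fun i s => ?_) s
    rw [hx.inner_eq, hx.corr_eq_integral]
    congr 1; ext ξ
    rw [← mul_assoc, hadd, sub_eq_add_neg]
  have step2 : ∀ j t, ((inner ℝ (x j t) (Z s) : ℝ) : ℂ) = ∫ ξ, Complex.exp (freq ξ * t)
      * (Complex.exp (freq ξ * (-s : ℝ))
        * ∑ i, (starRingEnd ℂ) (M i ξ) * kernelFT (R j i) ξ) := fun j t => by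
    rw [real_inner_comm, ← Complex.conj_ofReal, step1, ← integral_conj]
    congr 1; ext ξ
    simp only [map_mul, map_sum, hexp, hx.kernelFT_corr_conj, neg_neg, Finset.mul_sum]
    refine Finset.sum_congr rfl fun i _ => ?_
    ring
  have step3 := hZ'.inner_eq_integral hc hb (u := Z s) (fun j => hei (-s)
    (integrable_finsetSum _ fun i _ => by
      obtain ⟨C, hC⟩ := hZ.bounded_symbol i
      exact (hx.integrable_spectrum j i).bdd_mul (c := C)
        (Complex.continuous_conj.comp (hZ.continuous_symbol i)).aestronglyMeasurable
        (ae_of_all _ fun ξ => (RCLike.norm_conj _).trans_le (hC ξ)))) step2 t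
  rw [real_inner_comm, ← Complex.conj_ofReal, step3, ← integral_conj]
  congr 1; ext ξ
  simp only [map_mul, map_sum, hexp, hx.kernelFT_corr_conj, neg_neg, Complex.conj_conj]
  rw [sub_eq_add_neg, ← hadd, Finset.sum_comm]
  simp only [Finset.mul_sum]
  refine Finset.sum_congr rfl fun j _ => Finset.sum_congr rfl fun i _ => ?_
  ring

end CCC

/-! ### Gaussianity on the closed linear span of the inputs. -/

noncomputable section

namespace CCC

variable {Ω : Type*} [MeasurableSpace Ω] {P : Measure Ω} {T : Type*}

lemma inner_lp_eq (f g : Lp ℝ 2 P) : inner ℝ f g = ∫ ω, f ω * g ω ∂P := by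
  rw [L2.inner_def]
  exact integral_congr_ae (Eventually.of_forall fun ω => by simp [mul_comm])

lemma norm_sq_lp_eq (f : Lp ℝ 2 P) : ‖f‖ ^ 2 = ∫ ω, f ω ^ 2 ∂P := by
  rw [← real_inner_self_eq_norm_sq, inner_lp_eq]
  simp [pow_two]

lemma coeFn_finset_sum {κ : Type*} (s : Finset κ) (f : κ → Lp ℝ 2 P) :
    ⇑(∑ i ∈ s, f i) =ᵐ[P] fun ω => ∑ i ∈ s, f i ω := by
  classical
  induction s using Finset.induction_on with
  | empty =>
    simp only [Finset.sum_empty]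
    exact Lp.coeFn_zero ℝ 2 P
  | insert a s ha ih =>
    rw [Finset.sum_insert ha]
    filter_upwards [Lp.coeFn_add (f a) (∑ i ∈ s, f i), ih] with ω h1 h2
    rw [h1, Finset.sum_insert ha, Pi.add_apply, h2]

section CharFun

variable [IsProbabilityMeasure P]

lemma integral_abs_le_norm (z : Lp ℝ 2 P) : ∫ ω, ‖z ω‖ ∂P ≤ ‖z‖ := by
  have h2 := Lp.memLp z
  have h1 : MemLp z 1 P := h2.mono_exponent (by norm_num)
  rw [Lp.norm_def, integral_norm_eq_lintegral_enorm (Lp.aestronglyMeasurable z),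
    ← eLpNorm_one_eq_lintegral_enorm]
  exact ENNReal.toReal_mono h2.2.ne
    (eLpNorm_le_eLpNorm_of_exponent_le (by norm_num) (Lp.aestronglyMeasurable z))

lemma integrable_exp_mul_I {f : Ω → ℝ} (hf : AEStronglyMeasurable f P) :
    Integrable (fun ω => Complex.exp (f ω * Complex.I)) P := by
  refine (integrable_const (1 : ℝ)).mono' ?_ (Eventually.of_forall fun ω => ?_)
  · exact Complex.continuous_exp.comp_aestronglyMeasurable
      ((Complex.continuous_ofReal.comp_aestronglyMeasurable hf).mul_const _)
  · rw [Complex.norm_exp_ofReal_mul_I]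

lemma norm_exp_mul_I_sub_le (a b : ℝ) :
    ‖Complex.exp (a * Complex.I) - Complex.exp (b * Complex.I)‖ ≤ |a - b| := by
  have : Complex.exp (a * Complex.I) - Complex.exp (b * Complex.I)
      = Complex.exp (b * Complex.I) * (Complex.exp (Complex.I * ((a - b : ℝ) : ℂ)) - 1) := by
    rw [mul_sub, ← Complex.exp_add, mul_one]
    congr 2
    push_cast; ring
  rw [this, norm_mul, Complex.norm_exp_ofReal_mul_I, one_mul]
  exact Real.norm_exp_I_mul_ofReal_sub_one_le

/-- The map is 1-Lipschitz: |e^(ia) - e^(ib)| ≤ |a - b|, and the L¹ norm is at most the L² norm on a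
probability space. -/
lemma continuous_integral_exp_mul_I :
    Continuous fun z : Lp ℝ 2 P => ∫ ω, Complex.exp (z ω * Complex.I) ∂P := by
  refine (LipschitzWith.of_dist_le_mul (K := 1) fun z w => ?_).continuous
  rw [dist_eq_norm, dist_eq_norm, NNReal.coe_one, one_mul,
    ← integral_sub (integrable_exp_mul_I (Lp.aestronglyMeasurable z))
      (integrable_exp_mul_I (Lp.aestronglyMeasurable w))]
  refine (norm_integral_le_integral_norm _).trans (le_trans ?_ (integral_abs_le_norm (z - w)))
  have hi : Integrable (fun ω => ‖(z - w : Lp ℝ 2 P) ω‖) P :=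
    ((Lp.memLp (z - w)).integrable (by norm_num)).norm
  refine integral_mono_of_nonneg (Eventually.of_forall fun _ => norm_nonneg _) hi ?_
  filter_upwards [Lp.coeFn_sub z w] with ω hω
  rw [hω]
  exact norm_exp_mul_I_sub_le _ _

variable {Y : T → Ω → ℝ} (hY : IsGaussianProcess Y P) (hY0 : ∀ k, ∫ ω, Y k ω ∂P = 0)
  (hm : ∀ k, MemLp (Y k) 2 P)

include hY hY0 in
lemma integral_exp_mul_I_of_mem_span {z : Lp ℝ 2 P}
    (hz : z ∈ Submodule.span ℝ (Set.range fun k => (hm k).toLp (Y k))) :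
    ∫ ω, Complex.exp (z ω * Complex.I) ∂P = Complex.exp (-(‖z‖ ^ 2 : ℝ) / 2) := by
  obtain ⟨c, rfl⟩ := Finsupp.mem_span_range_iff_exists_finsupp.1 hz
  set z : Lp ℝ 2 P := c.sum fun i a => a • (hm i).toLp (Y i) with hzdef
  have hzae : ⇑z =ᵐ[P] fun ω => ∑ k : c.support, c k * Y k ω := by
    have h1 := coeFn_finset_sum (P := P) c.support fun i => c i • (hm i).toLp (Y i)
    have h2 : ∀ i, ∀ᵐ ω ∂P, i ∈ c.support → (c i • (hm i).toLp (Y i) : Lp ℝ 2 P) ω = c i * Y i ω := by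
      intro i
      filter_upwards [Lp.coeFn_smul (c i) ((hm i).toLp (Y i)), (hm i).coeFn_toLp] with ω ha hb _
      rw [ha, Pi.smul_apply, hb, smul_eq_mul]
    have h3 : ∀ᵐ ω ∂P, ∀ i ∈ c.support,
        (c i • (hm i).toLp (Y i) : Lp ℝ 2 P) ω = c i * Y i ω :=
      (ae_ball_iff c.support.countable_toSet).2 fun i hi => by
        filter_upwards [h2 i] with ω hω using hω hi
    filter_upwards [h1, h3] with ω h1 h3
    rw [hzdef, Finsupp.sum, h1, Finset.sum_coe_sort c.support fun k => c k * Y k ω]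
    exact Finset.sum_congr rfl h3
  have hg : HasGaussianLaw (⇑z) P := by
    let L : (c.support → ℝ) →L[ℝ] ℝ :=
      ∑ k : c.support, c k • ContinuousLinearMap.proj (R := ℝ) (φ := fun _ : c.support => ℝ) k
    refine ((hY.hasGaussianLaw c.support).map_fun L).congr ?_
    filter_upwards [hzae] with ω hω
    rw [hω]
    simp [L]
  have hmean : ∫ ω, z ω ∂P = 0 := by
    rw [integral_congr_ae hzae, integral_finsetSum]
    · simp [integral_const_mul, hY0]
    · exact fun i _ => ((hm i).integrable (by norm_num)).const_mul _
  have hvar : Var[⇑z; P] = ‖z‖ ^ 2 := by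
    rw [variance_of_integral_eq_zero hg.aemeasurable hmean, norm_sq_lp_eq]
  have := hg.map_eq_gaussianReal
  rw [hmean, hvar] at this
  have h1 : charFun (P.map z) 1 = charFun (gaussianReal 0 (‖z‖ ^ 2).toNNReal) 1 := by rw [this]
  rw [charFun_gaussianReal, charFun_apply_real, integral_map hg.aemeasurable (by fun_prop)] at h1
  have h2 : (((‖z‖ ^ 2).toNNReal : ℝ) : ℂ) = ((‖z‖ ^ 2 : ℝ) : ℂ) := by
    rw [Real.coe_toNNReal _ (by positivity)]
  simp only [Complex.ofReal_one, one_mul] at h1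
  rw [h1, h2]
  congr 1
  push_cast; ring

include hY hY0 in
-- Both sides are continuous in the L² norm, so the Gaussian identity extends from finite
-- combinations to their limits.
lemma integral_exp_mul_I_of_mem_closure {z : Lp ℝ 2 P}
    (hz : z ∈ (Submodule.span ℝ (Set.range fun k => (hm k).toLp (Y k))).topologicalClosure) :
    ∫ ω, Complex.exp (z ω * Complex.I) ∂P = Complex.exp (-(‖z‖ ^ 2 : ℝ) / 2) := by
  have hcl : IsClosed {z : Lp ℝ 2 P | ∫ ω, Complex.exp (z ω * Complex.I) ∂P
      = Complex.exp (-(‖z‖ ^ 2 : ℝ) / 2)} :=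
    isClosed_eq continuous_integral_exp_mul_I (by fun_prop)
  exact closure_minimal (fun z hz => integral_exp_mul_I_of_mem_span hY hY0 hm hz) hcl hz

include hY hY0 in
/-- Elements of the closed span of a centered Gaussian process are centered Gaussian. -/
lemma map_eq_gaussianReal_of_mem_closure {z : Lp ℝ 2 P}
    (hz : z ∈ (Submodule.span ℝ (Set.range fun k => (hm k).toLp (Y k))).topologicalClosure) :
    P.map z = gaussianReal 0 (‖z‖ ^ 2).toNNReal := by
  have hzm : AEMeasurable z P := (Lp.aestronglyMeasurable z).aemeasurable
  have : IsProbabilityMeasure (P.map z) := Measure.isProbabilityMeasure_map hzm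
  refine Measure.ext_of_charFun ?_
  ext t
  rw [charFun_gaussianReal, charFun_apply_real, integral_map hzm (by fun_prop)]
  -- The closed span contains t • z, so the identity at argument 1 gives the whole characteristic
  -- function.
  have h := integral_exp_mul_I_of_mem_closure hY hY0 hm (Submodule.smul_mem _ t hz)
  have h1 : ∫ ω, Complex.exp ((t • z : Lp ℝ 2 P) ω * Complex.I) ∂P
      = ∫ ω, Complex.exp (t * z ω * Complex.I) ∂P := by
    refine integral_congr_ae ?_
    filter_upwards [Lp.coeFn_smul t z] with ω hω
    simp [hω]
  have h2 : (((‖z‖ ^ 2).toNNReal : ℝ) : ℂ) = ((‖z‖ ^ 2 : ℝ) : ℂ) := by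
    rw [Real.coe_toNNReal _ (by positivity)]
  rw [← h1, h, h2, norm_smul, mul_pow, Real.norm_eq_abs, sq_abs]
  congr 1
  push_cast; ring

include hY hY0 in
-- Every linear functional of the pair is again an element of the closed span, hence Gaussian; this
-- is joint Gaussianity.
lemma hasGaussianLaw_prodMk_of_mem_closure {z w : Lp ℝ 2 P}
    (hz : z ∈ (Submodule.span ℝ (Set.range fun k => (hm k).toLp (Y k))).topologicalClosure)
    (hw : w ∈ (Submodule.span ℝ (Set.range fun k => (hm k).toLp (Y k))).topologicalClosure) :
    HasGaussianLaw (fun ω => (z ω, w ω)) P := by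
  have hzm : AEMeasurable z P := (Lp.aestronglyMeasurable z).aemeasurable
  have hwm : AEMeasurable w P := (Lp.aestronglyMeasurable w).aemeasurable
  refine ⟨isGaussian_of_map_eq_gaussianReal fun L => ?_⟩
  refine ⟨0, (‖L (1, 0) • z + L (0, 1) • w‖ ^ 2).toNNReal, ?_⟩
  rw [← map_eq_gaussianReal_of_mem_closure hY hY0 hm
    (Submodule.add_mem _ (Submodule.smul_mem _ _ hz) (Submodule.smul_mem _ _ hw)),
    AEMeasurable.map_map_of_aemeasurable (by fun_prop) (hzm.prodMk hwm)]
  refine Measure.map_congr ?_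
  filter_upwards [Lp.coeFn_add (L (1, 0) • z) (L (0, 1) • w), Lp.coeFn_smul (L (1, 0)) z,
    Lp.coeFn_smul (L (0, 1)) w] with ω h1 h2 h3
  rw [h1, Pi.add_apply, h2, h3]
  have : ((z ω, w ω) : ℝ × ℝ) = z ω • (1, 0) + w ω • (0, 1) := by simp
  simp only [Function.comp_apply, Pi.smul_apply, smul_eq_mul]
  rw [this, map_add, map_smul, map_smul, smul_eq_mul, smul_eq_mul]
  ring

include hY hY0 in
lemma integral_eq_zero_of_mem_closure {z : Lp ℝ 2 P}
    (hz : z ∈ (Submodule.span ℝ (Set.range fun k => (hm k).toLp (Y k))).topologicalClosure) :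
    ∫ ω, z ω ∂P = 0 := by
  have hzm : AEMeasurable z P := (Lp.aestronglyMeasurable z).aemeasurable
  have := integral_map (f := fun x : ℝ => x) hzm (by fun_prop)
  rw [← this, map_eq_gaussianReal_of_mem_closure hY hY0 hm hz, integral_id_gaussianReal]

lemma integral_max_gaussianReal (s : ℝ) (hs : 0 ≤ s) :
    ∫ x, max x 0 ∂(gaussianReal 0 (s ^ 2).toNNReal) = s / √(2 * Real.pi) := by
  rcases hs.eq_or_lt with rfl | hs
  · simp
  have hv : (s ^ 2).toNNReal ≠ 0 := by simp; positivity
  rw [integral_gaussianReal_eq_integral_smul hv]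
  have h1 : ∀ x : ℝ, gaussianPDFReal 0 (s ^ 2).toNNReal x • max x 0
      = (Set.Ioi (0 : ℝ)).indicator
        (fun x => (√(2 * Real.pi * s ^ 2))⁻¹ * (x * Real.exp (-(1 / (2 * s ^ 2)) * x ^ 2))) x := by
    intro x
    rw [gaussianPDFReal_def, Real.coe_toNNReal _ (by positivity)]
    by_cases hx : 0 < x
    · rw [Set.indicator_of_mem (by exact hx), max_eq_left hx.le, smul_eq_mul]
      have : -(x - 0) ^ 2 / (2 * s ^ 2) = -(1 / (2 * s ^ 2)) * x ^ 2 := by ring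
      simp only [this]
      ring
    · rw [Set.indicator_of_notMem (by exact hx), max_eq_right (not_lt.1 hx), smul_zero]
  simp_rw [h1]
  rw [integral_indicator measurableSet_Ioi, integral_const_mul]
  have h2 := integral_rpow_mul_exp_neg_mul_rpow (p := 2) (q := 1) (b := 1 / (2 * s ^ 2))
    (by norm_num) (by norm_num) (by positivity)
  have h3 : ∫ x in Set.Ioi (0 : ℝ), x * Real.exp (-(1 / (2 * s ^ 2)) * x ^ 2) = s ^ 2 := by
    simp only [Real.rpow_one, Real.rpow_two] at h2
    rw [h2]
    norm_num
    rw [Real.rpow_neg_one]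
    field_simp
  rw [h3, Real.sqrt_mul (by positivity), Real.sqrt_sq hs.le]
  field_simp

include hY hY0 in
/-- For uncorrelated `z`, `w` in the closed span of a centered Gaussian process. -/
lemma integral_add_mul_max_of_mem_closure {z w : Lp ℝ 2 P}
    (hz : z ∈ (Submodule.span ℝ (Set.range fun k => (hm k).toLp (Y k))).topologicalClosure)
    (hw : w ∈ (Submodule.span ℝ (Set.range fun k => (hm k).toLp (Y k))).topologicalClosure)
    (h : inner ℝ z w = 0) (b : ℝ) :
    ∫ ω, (b + z ω) * max (w ω) 0 ∂P = b * (‖w‖ / √(2 * Real.pi)) := by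
  have hzm := Lp.memLp z
  have hwm := Lp.memLp w
  have hw' : MemLp (fun ω => max (w ω) 0) 2 P := hwm.pos_part
  -- Jointly Gaussian and uncorrelated variables are independent, so the term z max(w, 0) has mean
  -- zero.
  have hind : IndepFun z w P := by
    refine (hasGaussianLaw_prodMk_of_mem_closure hY hY0 hm hz hw).indepFun_of_covariance_eq_zero ?_
    rw [covariance_eq_sub hzm hwm, integral_eq_zero_of_mem_closure hY hY0 hm hz, zero_mul, sub_zero]
    rw [inner_lp_eq] at h
    exact h
  have hind' : IndepFun z (fun ω => max (w ω) 0) P :=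
    hind.comp (φ := id) (ψ := fun x => max x 0) measurable_id (by fun_prop)
  have h1 : ∫ ω, z ω * max (w ω) 0 ∂P = 0 := by
    have := hind'.integral_mul_eq_mul_integral hzm.1 hw'.1
    simp only [Pi.mul_apply] at this
    rw [this, integral_eq_zero_of_mem_closure hY hY0 hm hz, zero_mul]
  have h2 : ∫ ω, max (w ω) 0 ∂P = ‖w‖ / √(2 * Real.pi) := by
    have := integral_map (f := fun x : ℝ => max x 0) hwm.1.aemeasurable (by fun_prop)
    rw [← this, map_eq_gaussianReal_of_mem_closure hY hY0 hm hw,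
      integral_max_gaussianReal _ (norm_nonneg _)]
  simp_rw [add_mul]
  have h3 : Integrable (fun ω => z ω * max (w ω) 0) P := hzm.integrable_mul hw'
  rw [integral_add ((hw'.integrable (by norm_num)).const_mul _) h3, integral_const_mul, h1, h2, add_zero]

end CharFun

end CCC

end

/-! ### From stochastic processes to curves in L² and back. -/

noncomputable section

namespace CCC

variable {Ω : Type*} [MeasurableSpace Ω] {P : Measure Ω} {ι : Type*}

section Translation

/-- Mean-square differentiation is norm differentiation in L², so the closed loop becomes a delay
equation for Hilbert-space curves. -/
lemma hasMSDerivAt_iff {X : ℝ → Ω → ℝ} {Y : Ω → ℝ} (hX : ∀ t, MemLp (X t) 2 P)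
    (hY : MemLp Y 2 P) (t : ℝ) :
    HasMSDerivAt P X Y t ↔ HasDerivAt (fun t => (hX t).toLp (X t)) (hY.toLp Y) t := by
  rw [hasDerivAt_iff_tendsto_slope_zero, tendsto_iff_edist_tendsto_0, HasMSDerivAt]
  refine iff_of_eq (congrArg (fun f => Tendsto f (𝓝[≠] 0) (𝓝 0)) (funext fun δ => ?_))
  rw [← MemLp.toLp_sub (hX _) (hX _), ← MemLp.toLp_const_smul, Lp.edist_toLp_toLp]
  congr 1
  ext ω
  simp [div_eq_inv_mul]

lemma inner_toLp {X Y : Ω → ℝ} (hX : MemLp X 2 P) (hY : MemLp Y 2 P) :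
    inner ℝ (hX.toLp X) (hY.toLp Y) = ∫ ω, X ω * Y ω ∂P := by
  rw [inner_lp_eq]
  refine integral_congr_ae ?_
  filter_upwards [hX.coeFn_toLp, hY.coeFn_toLp] with ω h1 h2
  rw [h1, h2]

lemma norm_toLp_sq {X : Ω → ℝ} (hX : MemLp X 2 P) : ‖hX.toLp X‖ ^ 2 = ∫ ω, X ω ^ 2 ∂P := by
  rw [← real_inner_self_eq_norm_sq, inner_toLp]
  simp [pow_two]

lemma feedback_iff [Fintype ι] {α κ : ℝ} {β : ι → ℝ} {h v a : Ω → ℝ} {X : ι → Ω → ℝ}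
    (hh : MemLp h 2 P) (hv : MemLp v 2 P) (ha : MemLp a 2 P) (hX : ∀ i, MemLp (X i) 2 P) :
    (a =ᵐ[P] fun ω => α * (κ * h ω - v ω) + ∑ i, β i * (X i ω - v ω)) ↔
      ha.toLp a = (α * κ) • hh.toLp h + -((α + ∑ i, β i) • hv.toLp v)
        + ∑ i, β i • (hX i).toLp (X i) := by
  have key : ⇑((α * κ) • hh.toLp h + -((α + ∑ i, β i) • hv.toLp v)
        + ∑ i, β i • (hX i).toLp (X i)) =ᵐ[P]
        fun ω => α * (κ * h ω - v ω) + ∑ i, β i * (X i ω - v ω) := by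
    have hs : ∀ᵐ ω ∂P, ∀ i, (β i • (hX i).toLp (X i) : Lp ℝ 2 P) ω = β i * X i ω :=
      ae_all_iff.2 fun i => by
        filter_upwards [Lp.coeFn_smul (β i) ((hX i).toLp (X i)), (hX i).coeFn_toLp] with ω h1 h2
        rw [h1, Pi.smul_apply, h2, smul_eq_mul]
    filter_upwards [Lp.coeFn_add ((α * κ) • hh.toLp h + -((α + ∑ i, β i) • hv.toLp v))
        (∑ i, β i • (hX i).toLp (X i)),
      Lp.coeFn_add ((α * κ) • hh.toLp h) (-((α + ∑ i, β i) • hv.toLp v)),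
      Lp.coeFn_neg ((α + ∑ i, β i) • hv.toLp v), Lp.coeFn_smul (α * κ) (hh.toLp h),
      Lp.coeFn_smul (α + ∑ i, β i) (hv.toLp v), hh.coeFn_toLp, hv.coeFn_toLp, hs,
      coeFn_finset_sum Finset.univ fun i => β i • (hX i).toLp (X i)] with
      ω h1 h2 h3 h4 h5 h6 h7 h8 h9
    rw [h1, Pi.add_apply, h2, Pi.add_apply, h3, Pi.neg_apply, h4, h5, h9,
      Finset.sum_congr rfl fun i _ => h8 i, Pi.smul_apply, Pi.smul_apply, h6, h7]
    simp only [smul_eq_mul, mul_sub, Finset.sum_sub_distrib, ← Finset.sum_mul]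
    ring
  constructor
  · intro h0
    exact Lp.ext ((ha.coeFn_toLp.trans h0).trans key.symm)
  · intro h0
    rw [← h0] at key
    exact ha.coeFn_toLp.symm.trans key

/-- The inputs as curves in `L²`. -/
def inputCurve {X : ι → ℝ → Ω → ℝ} (hX : IsGaussianInput P X) (i : ι) (t : ℝ) : Lp ℝ 2 P :=
  ((hX.wss i).1 t).toLp (X i t)

variable {X : ι → ℝ → Ω → ℝ} (hX : IsGaussianInput P X)

lemma inner_inputCurve (i j : ι) (s t : ℝ) :
    inner ℝ (inputCurve hX i s) (inputCurve hX j t) = crossCorr P (X i) (X j) (s - t) := by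
  rw [inputCurve, inputCurve, inner_toLp, hX.jointly_wss]

lemma exists_deriv_inputCurve (i : ι) :
    ∃ y : ℝ → Lp ℝ 2 P, ∀ t, HasDerivAt (inputCurve hX i) (y t) t := by
  obtain ⟨Y, hY⟩ := hX.ms_differentiable i
  exact ⟨fun t => (hY t).1.toLp (Y t),
    fun t => (hasMSDerivAt_iff (hX.wss i).1 (hY t).1 t).1 (hY t).2⟩

lemma exists_isSmoothSignal_inputCurve :
    ∃ y : ι → ℝ → Lp ℝ 2 P, ∀ i, IsSmoothSignal (inputCurve hX i) (y i) := by
  choose y hy using exists_deriv_inputCurve hX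
  exact ⟨y, fun i => isSmoothSignal_of_stationary (r := crossCorr P (X i) (X i))
    (fun s t => inner_inputCurve hX i i s t) (hy i)⟩

lemma isStationaryFamily_inputCurve (hR : ∀ i j, Integrable (crossCorr P (X i) (X j))) :
    IsStationaryFamily (inputCurve hX) fun i j => crossCorr P (X i) (X j) where
  inner_eq i j s t := inner_inputCurve hX i j s t
  continuous i := by
    obtain ⟨y, hy⟩ := exists_deriv_inputCurve hX i
    exact continuous_iff_continuousAt.2 fun t => (hy t).continuousAt
  integrable i j := hR i j

end Translation

section Version

/-- A Lipschitz curve in `L²` has a jointly measurable version. -/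
lemma exists_measurable_version [IsProbabilityMeasure P] {Z : ℝ → Lp ℝ 2 P} {L : ℝ}
    (hL : 0 ≤ L) (hZ : ∀ s t, ‖Z s - Z t‖ ≤ L * |s - t|) :
    ∃ z : ℝ → Ω → ℝ, Measurable (Function.uncurry z) ∧ ∀ t, z t =ᵐ[P] Z t := by
  -- Dyadic rounding takes countably many values, so sampling there is jointly measurable. The L¹
  -- errors are at most L · 2⁻ⁿ, hence summable, which gives almost sure convergence at each fixed
  -- t.
  let q : ℕ → ℝ → ℝ := fun n t => (⌊t * 2 ^ n⌋ : ℝ) / 2 ^ n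
  have hq : ∀ n t, |q n t - t| ≤ (1 / 2) ^ n := by
    intro n t
    have h1 := Int.floor_le (t * 2 ^ n)
    have h2 := Int.lt_floor_add_one (t * 2 ^ n)
    have h3 : (0 : ℝ) < 2 ^ n := by positivity
    have h4 : q n t - t = (⌊t * 2 ^ n⌋ - t * 2 ^ n) / 2 ^ n := by
      simp only [q]; field_simp
    rw [h4, abs_div, abs_of_pos h3, one_div, inv_pow, div_eq_mul_inv]
    refine mul_le_of_le_one_left (by positivity) ?_
    rw [abs_le]; constructor <;> linarith
  let g : ℕ → ℝ × Ω → ℝ := fun n p => Z (q n p.1) p.2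
  have hg : ∀ n, Measurable (g n) := by
    intro n
    have h1 : Measurable fun p : ℤ × Ω => Z ((p.1 : ℝ) / 2 ^ n) p.2 :=
      measurable_from_prod_countable_right fun k => (Lp.stronglyMeasurable (Z ((k : ℝ) / 2 ^ n))).measurable
    have h2 : Measurable fun p : ℝ × Ω => (⌊p.1 * 2 ^ n⌋, p.2) := by fun_prop
    exact h1.comp h2
  refine ⟨fun t ω => limsup (fun n => g n (t, ω)) atTop, Measurable.limsup hg, fun t => ?_⟩
  have hsum : ∑' n, ∫⁻ ω, ‖(Z (q n t) - Z t : Lp ℝ 2 P) ω‖ₑ ∂P ≠ ⊤ := by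
    have hs : Summable fun n : ℕ => L * (1 / 2 : ℝ) ^ n :=
      (summable_geometric_of_lt_one (by norm_num) (by norm_num)).mul_left L
    refine ne_top_of_le_ne_top hs.tsum_ofReal_ne_top (ENNReal.tsum_le_tsum fun n => ?_)
    have h1 : Integrable ((Z (q n t) - Z t : Lp ℝ 2 P)) P :=
      (Lp.memLp _).integrable (by norm_num)
    rw [← ofReal_integral_norm_eq_lintegral_enorm h1]
    refine ENNReal.ofReal_le_ofReal ((integral_abs_le_norm _).trans ((hZ _ _).trans ?_))
    exact mul_le_mul_of_nonneg_left (hq n t) hL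
  rw [← lintegral_tsum fun n => (Lp.aestronglyMeasurable _).enorm] at hsum
  have hae := ae_lt_top' (AEMeasurable.tsum fun n => (Lp.aestronglyMeasurable _).enorm) hsum
  have hsub : ∀ᵐ ω ∂P, ∀ n, (Z (q n t) - Z t : Lp ℝ 2 P) ω = Z (q n t) ω - Z t ω :=
    ae_all_iff.2 fun n => Lp.coeFn_sub _ _
  filter_upwards [hae, hsub] with ω h1 h2
  have h3 := ENNReal.tendsto_atTop_zero_of_tsum_ne_top h1.ne
  refine Tendsto.limsup_eq ?_
  rw [tendsto_iff_edist_tendsto_0]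
  refine h3.congr fun n => ?_
  rw [h2, edist_eq_enorm_sub]

end Version

end CCC

end

/-! ### Transfer functions of the response and existence of a steady state. -/

noncomputable section

namespace CCC

variable {ι : Type*} [Fintype ι]

section Symbols

lemma charD_freq (α κ σ : ℝ) (β : ι → ℝ) (ξ : ℝ) :
    charD α κ σ β (freq ξ) = axisD (α + ∑ i, β i) (α * κ) σ ξ := by
  simp [charD, axisD]

lemma PlantStable.charD_freq_ne_zero {α κ σ : ℝ} {β : ι → ℝ} (h : PlantStable α κ σ β) (ξ : ℝ) :
    charD α κ σ β (freq ξ) ≠ 0 := fun h0 => by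
  have := h _ h0
  simp [freq] at this

lemma PlantStable.exists_isKernelPair {α κ σ : ℝ} {β : ι → ℝ} (h : PlantStable α κ σ β) :
    ∃ k₀ k₁, IsKernelPair (α + ∑ i, β i) (α * κ) σ k₀ k₁ := by
  have hD : ∀ ξ, axisD (α + ∑ i, β i) (α * κ) σ ξ ≠ 0 := fun ξ => by
    rw [← charD_freq]; exact h.charD_freq_ne_zero ξ
  obtain ⟨k₀, k₁, h0, h1, h2, h3⟩ := exists_kernels hD
  exact ⟨k₀, k₁, hD, h0, h1, h2, h3⟩

variable {H : Type*} [NormedAddCommGroup H] [InnerProductSpace ℝ H]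
  {α κ σ : ℝ} {lead : ι} {β d : ι → ℝ} {k₀ k₁ : ℝ → ℝ}

/-- The zero delay of the leading vehicle makes its exponential equal to 1, so a single formula
covers all vehicles. -/
lemma linkTransfer_eq (hd : d lead = 0) [DecidableEq ι] (i : ι) (s : ℂ) :
    linkTransfer α κ σ lead β d i s = (β i * s * Complex.exp (-(s * d i))
      + if i = lead then (α : ℂ) * κ else 0) / charD α κ σ β s := by
  rw [linkTransfer]
  by_cases h : i = lead
  · subst h; simp [hd]
  · simp [h]

lemma isFilter_responseV (hK : IsKernelPair (α + ∑ i, β i) (α * κ) σ k₀ k₁) (hd : d lead = 0)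
    (x : ι → ℝ → H) :
    IsFilter x (responseV (α * κ) lead β d k₀ k₁ x)
      fun i ξ => linkTransfer α κ σ lead β d i (freq ξ) := by
  classical
  have h : IsFilter x (responseV (α * κ) lead β d k₀ k₁ x) _ := (IsFilter.sum Finset.univ fun i =>
    ((((IsFilter.base (x := x) i).conv hK.integrable₁).shift (-d i)).smul (β i))).add
    (((IsFilter.base (x := x) lead).conv hK.integrable₀).smul (α * κ))
  convert h using 3 with i ξ
  rw [linkTransfer_eq hd, charD_freq]
  simp only [hK.kernelFT₀, hK.kernelFT₁, mul_ite, mul_one, mul_zero, Finset.sum_ite_eq,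
    Finset.mem_univ, if_true]
  split_ifs <;> push_cast <;> rw [mul_neg] <;> ring

/-- The acceleration is assembled from the feedback law and not by differentiation; clearing e^(sσ)
and D shows that its symbol is s times that of the speed. -/
lemma isFilter_responseA (hK : IsKernelPair (α + ∑ i, β i) (α * κ) σ k₀ k₁) (hd : d lead = 0)
    (x : ι → ℝ → H) :
    IsFilter x (responseA (α + ∑ i, β i) (α * κ) σ lead β d k₀ k₁ x)
      fun i ξ => freq ξ * linkTransfer α κ σ lead β d i (freq ξ) := by
  classical
  have hH : IsFilter x (responseH (α + ∑ i, β i) σ lead β d k₀ k₁ x) _ :=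
    ((((IsFilter.base (x := x) lead).conv hK.integrable₁).shift σ).add
    (((IsFilter.base (x := x) lead).conv hK.integrable₀).smul (α + ∑ i, β i))).add
    (IsFilter.sum Finset.univ fun i =>
    ((((IsFilter.base (x := x) i).conv hK.integrable₀).shift (-d i)).smul (β i))).neg
  have h : IsFilter x (responseA (α + ∑ i, β i) (α * κ) σ lead β d k₀ k₁ x) _ :=
    (((hH.shift (-σ)).smul (α * κ)).add
    ((((isFilter_responseV hK hd x).shift (-σ)).smul (α + ∑ i, β i)).neg)).add
    (IsFilter.sum Finset.univ fun i =>
      (((IsFilter.base (x := x) i).shift (-(σ + d i))).smul (β i)))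
  convert h using 3 with i ξ
  have hne := hK.ne_zero ξ
  rw [linkTransfer_eq hd, charD_freq]
  simp only [hK.kernelFT₀, hK.kernelFT₁, mul_ite, mul_one, mul_zero, Finset.sum_ite_eq,
    Finset.mem_univ, if_true]
  have e1 : Complex.exp (freq ξ * ((-σ : ℝ) : ℂ)) = (Complex.exp (freq ξ * σ))⁻¹ := by
    rw [← Complex.exp_neg]; push_cast; ring_nf
  have e2 : Complex.exp (freq ξ * ((-(σ + d i) : ℝ) : ℂ))
      = (Complex.exp (freq ξ * σ))⁻¹ * Complex.exp (-(freq ξ * d i)) := by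
    rw [← Complex.exp_neg, ← Complex.exp_add]; push_cast; ring_nf
  have e3 : Complex.exp (freq ξ * ((-d i : ℝ) : ℂ)) = Complex.exp (-(freq ξ * d i)) := by
    push_cast; ring_nf
  rw [e1, e2, e3]
  have hE := Complex.exp_ne_zero (freq ξ * σ)
  rw [axisD] at hne ⊢
  generalize Complex.exp (freq ξ * σ) = E at *
  generalize Complex.exp (-(freq ξ * d i)) = F at *
  generalize freq ξ = s at *
  push_cast at hne ⊢
  generalize ∑ i, (β i : ℂ) = B at *
  generalize hD : s ^ 2 * E + (α + B) * s + α * κ = D at *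
  split_ifs <;> field_simp <;> subst hD <;> ring

end Symbols

section Existence

variable {Ω : Type*} [MeasurableSpace Ω] {P : Measure Ω} {X : ι → ℝ → Ω → ℝ} (hX : IsGaussianInput P X)

omit [Fintype ι] in
lemma inputCurve_continuous (i : ι) : Continuous (inputCurve hX i) := by
  obtain ⟨y, hy⟩ := exists_isSmoothSignal_inputCurve hX
  exact (hy i).continuous

omit [Fintype ι] in
lemma inputCurve_bounded (i : ι) : ∃ C : ℝ, ∀ t, ‖inputCurve hX i t‖ ≤ C := by
  obtain ⟨y, hy⟩ := exists_isSmoothSignal_inputCurve hX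
  exact (hy i).bounded

omit [Fintype ι] in
lemma inputCurve_lipschitz (i : ι) :
    ∃ L : ℝ, 0 ≤ L ∧ ∀ s t, ‖inputCurve hX i s - inputCurve hX i t‖ ≤ L * |s - t| := by
  obtain ⟨y, hy⟩ := exists_isSmoothSignal_inputCurve hX
  obtain ⟨C, hC⟩ := (hy i).bounded_deriv
  refine ⟨C, (norm_nonneg _).trans (hC 0), fun s t => ?_⟩
  exact Convex.norm_image_sub_le_of_norm_hasDerivWithin_le (s := Set.univ)
    (fun u _ => ((hy i).hasDerivAt u).hasDerivWithinAt) (fun u _ => hC u) convex_univ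
    (Set.mem_univ t) (Set.mem_univ s)

variable [IsProbabilityMeasure P]

omit [Fintype ι] in
lemma integral_filter_eq_zero {Z : ℝ → Lp ℝ 2 P} {M : ι → ℝ → ℂ}
    (hZ : IsFilter (inputCurve hX) Z M) (t : ℝ) : ∫ ω, Z t ω ∂P = 0 :=
  integral_eq_zero_of_mem_closure (Y := fun p : ι × ℝ => X p.1 p.2) hX.gaussian
    (fun p => hX.zero_mean p.1 p.2) (fun p => (hX.wss p.1).1 p.2)
    (hZ.mem_closure_span (inputCurve_continuous hX) (inputCurve_bounded hX) t)

omit [Fintype ι] in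
lemma exists_filter_version {Z : ℝ → Lp ℝ 2 P} {M : ι → ℝ → ℂ}
    (hZ : IsFilter (inputCurve hX) Z M) :
    ∃ z : ℝ → Ω → ℝ, Measurable (Function.uncurry z) ∧ ∀ t, z t =ᵐ[P] Z t := by
  obtain ⟨L, hL, h⟩ := hZ.lipschitz (inputCurve_continuous hX) (inputCurve_bounded hX)
    (inputCurve_lipschitz hX)
  exact exists_measurable_version hL h

omit [IsProbabilityMeasure P] in
lemma inner_filter_stationary (hR : ∀ i j, Integrable (crossCorr P (X i) (X j)))
    {Z Z' : ℝ → Lp ℝ 2 P} {M M' : ι → ℝ → ℂ}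
    (hZ : IsFilter (inputCurve hX) Z M) (hZ' : IsFilter (inputCurve hX) Z' M') (s t : ℝ) :
    inner ℝ (Z s) (Z' t) = inner ℝ (Z (s - t)) (Z' 0) := by
  have hx := isStationaryFamily_inputCurve hX hR
  have h1 := hx.inner_filter hZ hZ' s t
  have h2 := hx.inner_filter hZ hZ' (s - t) 0
  rw [sub_zero] at h2
  exact_mod_cast h1.trans h2.symm

variable {α κ σ : ℝ} {lead : ι} {β d : ι → ℝ}

include hX in
/-- For plant stable gains a stationary steady-state response exists. -/
theorem exists_isSteadyState (hR : ∀ i j, Integrable (crossCorr P (X i) (X j)))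
    (hd : d lead = 0) (hβ : PlantStable α κ σ β) :
    ∃ h v a : ℝ → Ω → ℝ, IsSteadyState P α κ σ lead β d X h v a ∧ IsWSS P v := by
  obtain ⟨k₀, k₁, hK⟩ := hβ.exists_isKernelPair
  obtain ⟨y, hy⟩ := exists_isSmoothSignal_inputCurve hX
  have hV := isFilter_responseV hK hd (inputCurve hX)
  have hA := isFilter_responseA hK hd (inputCurve hX)
  -- Elements of L² are classes at each separate time; joint measurability of v and a in time and
  -- outcome requires versions. The headway needs none.
  obtain ⟨v, hvm, hv⟩ := exists_filter_version hX hV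
  obtain ⟨a, ham, ha⟩ := exists_filter_version hX hA
  set Hc := responseH (α + ∑ i, β i) σ lead β d k₀ k₁ (inputCurve hX) with hHc
  set Vc := responseV (α * κ) lead β d k₀ k₁ (inputCurve hX) with hVc
  set Ac := responseA (α + ∑ i, β i) (α * κ) σ lead β d k₀ k₁ (inputCurve hX) with hAc
  have mv : ∀ t, MemLp (v t) 2 P := fun t => (Lp.memLp (Vc t)).ae_eq (hv t).symm
  have ma : ∀ t, MemLp (a t) 2 P := fun t => (Lp.memLp (Ac t)).ae_eq (ha t).symm
  have mh : ∀ t, MemLp (Hc t) 2 P := fun t => Lp.memLp (Hc t)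
  have ev : ∀ t, (mv t).toLp (v t) = Vc t := fun t => Lp.ext ((mv t).coeFn_toLp.trans (hv t))
  have ea : ∀ t, (ma t).toLp (a t) = Ac t := fun t => Lp.ext ((ma t).coeFn_toLp.trans (ha t))
  have eh : ∀ t, (mh t).toLp (Hc t) = Hc t := fun t => Lp.ext (mh t).coeFn_toLp
  refine ⟨fun t => Hc t, v, a, ⟨hvm, ham, mh, mv, ma, fun t => ?_, fun t => ?_, fun t => ?_, ?_⟩,
    mv, ⟨0, fun t => ?_⟩, fun τ => inner ℝ (Vc 0) (Vc τ), fun s t => ?_⟩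
  · refine (hasMSDerivAt_iff mh (((hX.wss lead).1 t).sub (mv t)) t).2 ?_
    rw [MemLp.toLp_sub ((hX.wss lead).1 t) (mv t), ev]
    simp only [eh]
    exact hasDerivAt_responseH hK lead β d hy t
  · refine (hasMSDerivAt_iff mv (ma t) t).2 ?_
    rw [ea]
    simp only [ev]
    exact hasDerivAt_responseV hK lead β d hy t
  · refine (feedback_iff (mh _) (mv _) (ma t) fun i => (hX.wss i).1 _).2 ?_
    rw [ea, ev, eh]
    rfl
  · obtain ⟨C, hC⟩ := responseH_bounded hK lead β d hy
    obtain ⟨C', hC'⟩ := responseV_bounded hK lead β d hy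
    refine ⟨max (C ^ 2) (C' ^ 2), fun t => ⟨?_, ?_⟩⟩
    · rw [← norm_toLp_sq (mh t), eh]
      exact (pow_le_pow_left₀ (norm_nonneg _) (hC t) 2).trans (le_max_left _ _)
    · rw [← norm_toLp_sq (mv t), ev]
      exact (pow_le_pow_left₀ (norm_nonneg _) (hC' t) 2).trans (le_max_right _ _)
  · rw [integral_congr_ae (hv t), integral_filter_eq_zero hX hV]
  · rw [← inner_toLp (mv s) (mv t), ev, ev, real_inner_comm,
      inner_filter_stationary hX hR hV hV, real_inner_comm]

end Existence

end CCC

end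

/-! ### The objective as the variance of the acceleration. -/

noncomputable section

namespace CCC

variable {ι : Type*} [Fintype ι]

lemma kernelFT_neg (k : ℝ → ℝ) (ξ : ℝ) : kernelFT k (-ξ) = (starRingEnd ℂ) (kernelFT k ξ) := by
  rw [kernelFT, kernelFT, ← integral_conj]
  congr 1; ext t
  rw [map_mul, Complex.conj_ofReal, ← Complex.exp_conj, freq_neg]
  simp [freq, Complex.conj_ofNat]

lemma freq_div_two_pi (w : ℝ) : freq (w / (2 * Real.pi)) = Complex.I * w := by
  have : (Real.pi : ℂ) ≠ 0 := by exact_mod_cast Real.pi_ne_zero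
  rw [freq]; push_cast; field_simp

lemma crossPSD_eq_kernelFT {Ω : Type*} [MeasurableSpace Ω] (P : Measure Ω) (X Y : ℝ → Ω → ℝ)
    (w : ℝ) : crossPSD P X Y w = kernelFT (crossCorr P X Y) (w / (2 * Real.pi)) := by
  rw [crossPSD, kernelFT, freq_div_two_pi]
  congr 1; ext t
  rw [mul_comm]

lemma linkTransfer_conj (α κ σ : ℝ) (lead : ι) (β d : ι → ℝ) (i : ι) (s : ℂ) :
    linkTransfer α κ σ lead β d i ((starRingEnd ℂ) s)
      = (starRingEnd ℂ) (linkTransfer α κ σ lead β d i s) := by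
  rw [linkTransfer, linkTransfer]
  split_ifs <;> simp [charD, ← Complex.exp_conj]

lemma freq_conj (ξ : ℝ) : (starRingEnd ℂ) (freq ξ) = freq (-ξ) := by
  simp [freq, Complex.conj_ofNat]

/-- Power spectral density of the output of a filter with symbol `M`. -/
def outputPSD (M : ι → ℝ → ℂ) (R : ι → ι → ℝ → ℝ) (ξ : ℝ) : ℂ :=
  ∑ i, ∑ j, M i ξ * (starRingEnd ℂ) (M j ξ) * kernelFT (R i j) ξ

section OutputPSD

variable {H : Type*} [NormedAddCommGroup H] [InnerProductSpace ℝ H]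
  {x : ι → ℝ → H} {R : ι → ι → ℝ → ℝ} (hx : IsStationaryFamily x R) {M : ι → ℝ → ℂ}
include hx

lemma outputPSD_conj (ξ : ℝ) : (starRingEnd ℂ) (outputPSD M R ξ) = outputPSD M R ξ := by
  rw [outputPSD, map_sum, Finset.sum_comm]
  simp only [map_sum, map_mul, Complex.conj_conj, hx.kernelFT_corr_conj]
  refine Finset.sum_congr rfl fun i _ => Finset.sum_congr rfl fun j _ => ?_
  ring

lemma outputPSD_re_nonneg [CompleteSpace H] (ξ : ℝ) : 0 ≤ (outputPSD M R ξ).re :=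
  hx.spectral_nonneg (fun i => M i ξ) ξ

lemma ofReal_outputPSD_re (ξ : ℝ) : ((outputPSD M R ξ).re : ℂ) = outputPSD M R ξ :=
  Complex.conj_eq_iff_re.1 (outputPSD_conj hx ξ)

lemma outputPSD_neg (hM : ∀ i ξ, M i (-ξ) = (starRingEnd ℂ) (M i ξ)) (ξ : ℝ) :
    outputPSD M R (-ξ) = outputPSD M R ξ := by
  rw [← outputPSD_conj hx ξ]
  simp only [outputPSD, map_sum, map_mul, hM, kernelFT_neg]

lemma norm_sq_filter [CompleteSpace H] {Z : ℝ → H} (hZ : IsFilter x Z M) (t : ℝ) :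
    ‖Z t‖ ^ 2 = ∫ ξ, (outputPSD M R ξ).re := by
  have h := hx.inner_filter hZ hZ t t
  rw [real_inner_self_eq_norm_sq] at h
  have h2 : ((‖Z t‖ ^ 2 : ℝ) : ℂ) = ∫ ξ, ((outputPSD M R ξ).re : ℂ) := by
    rw [h]
    congr 1; ext ξ
    rw [ofReal_outputPSD_re hx, outputPSD]
    simp
  rw [integral_complex_ofReal] at h2
  exact_mod_cast h2

omit [Fintype ι] in
lemma integrable_symbol_mul_spectrum [CompleteSpace H] {Z : ℝ → H} (hZ : IsFilter x Z M) (i j : ι) :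
    Integrable fun ξ => M i ξ * (starRingEnd ℂ) (M j ξ) * kernelFT (R i j) ξ := by
  obtain ⟨C, hC⟩ := hZ.bounded_symbol i
  obtain ⟨C', hC'⟩ := hZ.bounded_symbol j
  have h1 := hZ.continuous_symbol i
  have h2 := hZ.continuous_symbol j
  refine (hx.integrable_spectrum i j).bdd_mul (c := C * C') ?_ (Eventually.of_forall fun ξ => ?_)
  · exact (h1.mul (Complex.continuous_conj.comp h2)).aestronglyMeasurable
  · rw [norm_mul, RCLike.norm_conj]
    exact mul_le_mul (hC ξ) (hC' ξ) (norm_nonneg _) ((norm_nonneg _).trans (hC ξ))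

end OutputPSD

section Cost

variable {Ω : Type*} [MeasurableSpace Ω] {P : Measure Ω} {X : ι → ℝ → Ω → ℝ}
  (hX : IsGaussianInput P X) (hR : ∀ i j, Integrable (crossCorr P (X i) (X j)))
  {α κ σ : ℝ} {lead : ι} {β d : ι → ℝ}
  {S : ι → ι → ℝ → ℂ} (hS : ∀ i j, S i j = crossPSD P (X i) (X j))

/-- Transfer functions from the inputs to the acceleration. -/
def accelSymbol (α κ σ : ℝ) (lead : ι) (β d : ι → ℝ) (i : ι) (ξ : ℝ) : ℂ :=
  freq ξ * linkTransfer α κ σ lead β d i (freq ξ)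

lemma accelSymbol_neg (i : ι) (ξ : ℝ) : accelSymbol α κ σ lead β d i (-ξ)
    = (starRingEnd ℂ) (accelSymbol α κ σ lead β d i ξ) := by
  rw [accelSymbol, accelSymbol, map_mul, ← linkTransfer_conj, freq_conj]

include hS in
lemma costIntegrand_eq (i j : ι) (w : ℝ) :
    costIntegrand α κ σ lead S β d i j w
      = accelSymbol α κ σ lead β d i (w / (2 * Real.pi))
        * (starRingEnd ℂ) (accelSymbol α κ σ lead β d j (w / (2 * Real.pi)))
        * kernelFT (crossCorr P (X i) (X j)) (w / (2 * Real.pi)) := by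
  rw [costIntegrand, hS, crossPSD_eq_kernelFT, accelSymbol, accelSymbol, freq_div_two_pi, map_mul,
    map_mul, Complex.conj_I, Complex.conj_ofReal]
  linear_combination ((w : ℂ) ^ 2 * linkTransfer α κ σ lead β d i (Complex.I * w)
    * (starRingEnd ℂ) (linkTransfer α κ σ lead β d j (Complex.I * w))
    * kernelFT (crossCorr P (X i) (X j)) (w / (2 * Real.pi))) * Complex.I_sq

include hX hR hS in
-- The acceleration symbols are bounded and continuous, the spectral densities integrable.
lemma integrable_costIntegrand (hd : d lead = 0) (hβ : PlantStable α κ σ β) (i j : ι) :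
    Integrable (costIntegrand α κ σ lead S β d i j) := by
  obtain ⟨k₀, k₁, hK⟩ := hβ.exists_isKernelPair
  rw [funext (costIntegrand_eq hS i j)]
  exact (integrable_symbol_mul_spectrum (isStationaryFamily_inputCurve hX hR)
    (isFilter_responseA hK hd (inputCurve hX)) i j).comp_div (by positivity)

include hX hR hS in
lemma cost_eq (hd : d lead = 0) (hβ : PlantStable α κ σ β) :
    cost α κ σ lead S β d = ((∫ w in Set.Ioi (0 : ℝ), (outputPSD (accelSymbol α κ σ lead β d)
      (fun i j => crossCorr P (X i) (X j)) (w / (2 * Real.pi))).re : ℝ) : ℂ) := by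
  have hi := fun i j => (integrable_costIntegrand hX hR hS (lead := lead) (d := d) hd hβ i j).integrableOn
    (s := Set.Ioi 0)
  rw [cost, ← integral_complex_ofReal]
  simp only [ofReal_outputPSD_re (isStationaryFamily_inputCurve hX hR)]
  simp_rw [← integral_finsetSum Finset.univ fun j _ => hi _ j]
  rw [← integral_finsetSum Finset.univ fun i _ => integrable_finsetSum _ fun j _ => hi i j]
  simp only [costIntegrand_eq hS, outputPSD]

include hX hR hS in
lemma cost_im (hd : d lead = 0) (hβ : PlantStable α κ σ β) :
    (cost α κ σ lead S β d).im = 0 := by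
  rw [cost_eq hX hR hS hd hβ, Complex.ofReal_im]

include hX hR hS in
lemma cost_re_nonneg (hd : d lead = 0) (hβ : PlantStable α κ σ β) :
    0 ≤ (cost α κ σ lead S β d).re := by
  rw [cost_eq hX hR hS hd hβ, Complex.ofReal_re]
  exact integral_nonneg fun w => outputPSD_re_nonneg (isStationaryFamily_inputCurve hX hR) _

include hX hR hS in
-- The variance is the integral of the output density over all ξ. The density is even, and w = 2πξ
-- contributes a factor 1/(2π); twice the integral over the half line thus becomes J/π.
lemma norm_sq_accel {k₀ k₁ : ℝ → ℝ} (hK : IsKernelPair (α + ∑ i, β i) (α * κ) σ k₀ k₁)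
    (hd : d lead = 0) (hβ : PlantStable α κ σ β) (t : ℝ) :
    ‖responseA (α + ∑ i, β i) (α * κ) σ lead β d k₀ k₁ (inputCurve hX) t‖ ^ 2
      = (cost α κ σ lead S β d).re / Real.pi := by
  have hx := isStationaryFamily_inputCurve hX hR
  set g : ℝ → ℝ := fun ξ => (outputPSD (accelSymbol α κ σ lead β d)
      (fun i j => crossCorr P (X i) (X j)) ξ).re with hg
  have heven : ∀ w : ℝ, g (|w| / (2 * Real.pi)) = g (w / (2 * Real.pi)) := by
    intro w
    rcases abs_choice w with h | h
    · rw [h]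
    · rw [h, neg_div, hg]
      simp only [outputPSD_neg hx accelSymbol_neg]
  have h1 := integral_comp_abs (f := fun w => g (w / (2 * Real.pi)))
  simp only [heven] at h1
  rw [Measure.integral_comp_div, abs_of_pos (by positivity), smul_eq_mul] at h1
  rw [norm_sq_filter hx (isFilter_responseA hK hd (inputCurve hX)), cost_eq hX hR hS hd hβ,
    Complex.ofReal_re, eq_div_iff Real.pi_ne_zero]
  change (∫ ξ, g ξ) * Real.pi = ∫ w in Set.Ioi (0 : ℝ), g (w / (2 * Real.pi))
  linarith

end Cost

end CCC

end

/-! ### Expected energy of an arbitrary steady-state response. -/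

noncomputable section

namespace CCC

variable {ι : Type*} [Fintype ι] {Ω : Type*} [MeasurableSpace Ω] {P : Measure Ω}
  {X : ι → ℝ → Ω → ℝ} (hX : IsGaussianInput P X)
  (hR : ∀ i j, Integrable (crossCorr P (X i) (X j)))
  {α κ σ : ℝ} {lead : ι} {β d : ι → ℝ}

/-- Bounded second moments make any steady-state response a bounded solution in L², so uniqueness
identifies it with the convolution formula. -/
lemma IsSteadyState.toLp_eq {h v a : ℝ → Ω → ℝ}
    (hs : IsSteadyState P α κ σ lead β d X h v a)
    {k₀ k₁ : ℝ → ℝ} (hK : IsKernelPair (α + ∑ i, β i) (α * κ) σ k₀ k₁) (t : ℝ) :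
    (hs.memLp_v t).toLp (v t) = responseV (α * κ) lead β d k₀ k₁ (inputCurve hX) t ∧
    (hs.memLp_a t).toLp (a t)
      = responseA (α + ∑ i, β i) (α * κ) σ lead β d k₀ k₁ (inputCurve hX) t := by
  obtain ⟨y, hy⟩ := exists_isSmoothSignal_inputCurve hX
  obtain ⟨C, hC⟩ := hs.bounded
  refine eq_response hK lead β d hy (h := fun t => (hs.memLp_h t).toLp (h t))
    (v := fun t => (hs.memLp_v t).toLp (v t)) (a := fun t => (hs.memLp_a t).toLp (a t))
    (fun t => ?_) (fun t => (hasMSDerivAt_iff hs.memLp_v (hs.memLp_a t) t).1 (hs.speed t))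
    (fun t => ?_) ⟨√C, fun t => ?_⟩ ⟨√C, fun t => ?_⟩ t
  · exact (hasMSDerivAt_iff hs.memLp_h (((hX.wss lead).1 t).sub (hs.memLp_v t)) t).1 (hs.headway t)
  · exact (feedback_iff (hs.memLp_h _) (hs.memLp_v _) (hs.memLp_a t) fun i => (hX.wss i).1 _).1
      (hs.accel t)
  · refine Real.le_sqrt_of_sq_le ?_
    rw [norm_toLp_sq]; exact (hC t).1
  · refine Real.le_sqrt_of_sq_le ?_
    rw [norm_toLp_sq]; exact (hC t).2

include hR in
-- The variance of the speed is constant in time, and its derivative is 2 ⟨v, a⟩.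
lemma inner_responseV_responseA {k₀ k₁ : ℝ → ℝ}
    (hK : IsKernelPair (α + ∑ i, β i) (α * κ) σ k₀ k₁) (hd : d lead = 0) (t : ℝ) :
    inner ℝ (responseV (α * κ) lead β d k₀ k₁ (inputCurve hX) t)
      (responseA (α + ∑ i, β i) (α * κ) σ lead β d k₀ k₁ (inputCurve hX) t) = 0 := by
  obtain ⟨y, hy⟩ := exists_isSmoothSignal_inputCurve hX
  have h1 := (hasDerivAt_responseV hK lead β d hy t).norm_sq
  have h2 : (fun t => ‖responseV (α * κ) lead β d k₀ k₁ (inputCurve hX) t‖ ^ 2) = fun _ =>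
      ∫ ξ, (outputPSD (fun i ξ => linkTransfer α κ σ lead β d i (freq ξ))
        (fun i j => crossCorr P (X i) (X j)) ξ).re :=
    funext fun t => norm_sq_filter (isStationaryFamily_inputCurve hX hR)
      (isFilter_responseV hK hd (inputCurve hX)) t
  rw [h2] at h1
  have := h1.unique (hasDerivAt_const t _)
  linarith

variable [IsProbabilityMeasure P] {S : ι → ι → ℝ → ℂ}
  (hS : ∀ i j, S i j = crossPSD P (X i) (X j))

include hX hR hS in
/-- Expected power along a steady-state response. -/
lemma IsSteadyState.integral_power {h v a : ℝ → Ω → ℝ}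
    (hs : IsSteadyState P α κ σ lead β d X h v a) (hd : d lead = 0) (hβ : PlantStable α κ σ β)
    (b t : ℝ) : ∫ ω, (b + v t ω) * max (a t ω) 0 ∂P
      = b / √(2 * Real.pi) * √((cost α κ σ lead S β d).re / Real.pi) := by
  obtain ⟨k₀, k₁, hK⟩ := hβ.exists_isKernelPair
  obtain ⟨hv, ha⟩ := hs.toLp_eq hX hK t
  have hcl := fun {Z : ℝ → Lp ℝ 2 P} {M} (hZ : IsFilter (inputCurve hX) Z M) =>
    hZ.mem_closure_span (inputCurve_continuous hX) (inputCurve_bounded hX) t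
  have key := integral_add_mul_max_of_mem_closure (Y := fun p : ι × ℝ => X p.1 p.2) hX.gaussian
    (fun p => hX.zero_mean p.1 p.2) (fun p => (hX.wss p.1).1 p.2)
    (hcl (isFilter_responseV hK hd (inputCurve hX)))
    (hcl (isFilter_responseA hK hd (inputCurve hX)))
    (inner_responseV_responseA hX hR hK hd t) b
  rw [← norm_sq_accel hX hR hS hK hd hβ t, Real.sqrt_sq (norm_nonneg _), div_mul_eq_mul_div,
    ← mul_div_assoc', ← key, ← hv, ← ha]
  refine integral_congr_ae ?_
  filter_upwards [(hs.memLp_v t).coeFn_toLp, (hs.memLp_a t).coeFn_toLp] with ω h1 h2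
  rw [h1, h2]

include hX hR in
lemma IsSteadyState.integrable_power {h v a : ℝ → Ω → ℝ}
    (hs : IsSteadyState P α κ σ lead β d X h v a) (hd : d lead = 0) (hβ : PlantStable α κ σ β)
    (b t₀ tf : ℝ) : Integrable (fun p : ℝ × Ω => (b + v p.1 p.2) * max (a p.1 p.2) 0)
      ((volume.restrict (Set.Ioc t₀ tf)).prod P) := by
  obtain ⟨k₀, k₁, hK⟩ := hβ.exists_isKernelPair
  have hx := isStationaryFamily_inputCurve hX hR
  have hm : AEStronglyMeasurable (fun p : ℝ × Ω => (b + v p.1 p.2) * max (a p.1 p.2) 0)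
      ((volume.restrict (Set.Ioc t₀ tf)).prod P) :=
    ((hs.measurable_v.const_add b).mul (hs.measurable_a.max measurable_const)).aestronglyMeasurable
  have hV := fun t => norm_sq_filter hx (isFilter_responseV hK hd (inputCurve hX)) t
  have hA := fun t => norm_sq_filter hx (isFilter_responseA hK hd (inputCurve hX)) t
  simp only [← (hs.toLp_eq hX hK _).1, norm_toLp_sq] at hV
  simp only [← (hs.toLp_eq hX hK _).2, norm_toLp_sq] at hA
  have hi : ∀ t, Integrable (fun ω => (b + v t ω) * max (a t ω) 0) P := fun t =>
    ((memLp_const b).add (hs.memLp_v t)).integrable_mul (hs.memLp_a t).pos_part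
  refine (integrable_prod_iff hm).2 ⟨Eventually.of_forall hi, ?_⟩
  -- The pointwise bound |(b + v) max(a, 0)| ≤ 2b² + 2v² + a² is integrated; stationarity of the
  -- second moments makes the result constant in t, so moments at time 0 serve as the bound.
  refine Integrable.mono' (integrable_const
    (2 * b ^ 2 + (2 * ∫ ω, v 0 ω ^ 2 ∂P) + ∫ ω, a 0 ω ^ 2 ∂P))
    hm.norm.integral_prod_right' (Eventually.of_forall fun t => ?_)
  rw [Real.norm_of_nonneg (integral_nonneg fun ω => norm_nonneg _), (hV 0).trans (hV t).symm,
    (hA 0).trans (hA t).symm]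
  have i1 : Integrable (fun ω => 2 * b ^ 2 + 2 * v t ω ^ 2) P :=
    (integrable_const _).add ((hs.memLp_v t).integrable_sq.const_mul 2)
  have e1 : ∫ ω, (2 * b ^ 2 + 2 * v t ω ^ 2 + a t ω ^ 2) ∂P
      = 2 * b ^ 2 + (2 * ∫ ω, v t ω ^ 2 ∂P) + ∫ ω, a t ω ^ 2 ∂P := by
    rw [integral_add i1 (hs.memLp_a t).integrable_sq,
      integral_add (integrable_const _) ((hs.memLp_v t).integrable_sq.const_mul 2)]
    simp [integral_const_mul]
  rw [← e1]
  refine integral_mono (hi t).norm (i1.add (hs.memLp_a t).integrable_sq) fun ω => ?_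
  simp only [norm_mul, Real.norm_eq_abs]
  have h1 : |max (a t ω) 0| ≤ |a t ω| := by
    rcases le_total (a t ω) 0 with h | h <;> simp [h]
  have h2 := mul_le_mul_of_nonneg_left h1 (abs_nonneg (b + v t ω))
  have h3 := two_mul_le_add_sq |b + v t ω| |a t ω|
  rw [sq_abs, sq_abs] at h3
  nlinarith [sq_nonneg (b - v t ω), sq_nonneg (a t ω), sq_nonneg (b + v t ω)]

include hX hR in
lemma IsSteadyState.ae_intervalIntegrable {h v a : ℝ → Ω → ℝ}
    (hs : IsSteadyState P α κ σ lead β d X h v a) (hd : d lead = 0) (hβ : PlantStable α κ σ β)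
    (b : ℝ) {t₀ tf : ℝ} (ht : t₀ ≤ tf) :
    ∀ᵐ ω ∂P, IntervalIntegrable (fun t => (b + v t ω) * max (a t ω) 0) volume t₀ tf := by
  filter_upwards [(hs.integrable_power hX hR hd hβ b t₀ tf).prod_left_ae] with ω hω
  exact (intervalIntegrable_iff_integrableOn_Ioc_of_le ht).2 hω

include hX hR in
lemma IsSteadyState.integrable_energy {h v a : ℝ → Ω → ℝ}
    (hs : IsSteadyState P α κ σ lead β d X h v a) (hd : d lead = 0) (hβ : PlantStable α κ σ β)
    (b : ℝ) {t₀ tf : ℝ} (ht : t₀ ≤ tf) : Integrable (energy b t₀ tf v a) P := by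
  have := (hs.integrable_power hX hR hd hβ b t₀ tf).integral_prod_right
  refine this.congr (Eventually.of_forall fun ω => ?_)
  simp only [energy, intervalIntegral.integral_of_le ht]

include hX hR hS in
/-- The expected energy consumption of a steady-state response. -/
theorem IsSteadyState.integral_energy {h v a : ℝ → Ω → ℝ}
    (hs : IsSteadyState P α κ σ lead β d X h v a) (hd : d lead = 0) (hβ : PlantStable α κ σ β)
    (b : ℝ) {t₀ tf : ℝ} (ht : t₀ ≤ tf) : ∫ ω, energy b t₀ tf v a ω ∂P
      = (tf - t₀) * (b / √(2 * Real.pi)) * √((cost α κ σ lead S β d).re / Real.pi) := by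
  have hswap := integral_integral_swap (f := fun t ω => (b + v t ω) * max (a t ω) 0)
    (hs.integrable_power hX hR hd hβ b t₀ tf)
  simp only [energy, intervalIntegral.integral_of_le ht]
  rw [← hswap]
  simp only [hs.integral_power hX hR hS hd hβ, integral_const, smul_eq_mul]
  rw [measureReal_restrict_apply_univ, Real.volume_real_Ioc_of_le ht]
  ring

lemma rangePolicy_pos {hst hgo vmax h : ℝ} (hvmax : 0 < vmax) (h₁ : hst < h) (h₂ : h < hgo) :
    0 < rangePolicy hst hgo vmax h := by
  have : 0 < hgo - hst := by linarith
  have h3 : 0 < h - hst := by linarith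
  exact lt_max_of_lt_right (lt_min (by rw [rangeGradient]; positivity) hvmax)

end CCC

end

/-! ### Assembly of the corollary. -/

theorem mainTheorem2
    {Ω : Type*} [MeasurableSpace Ω] (P : Measure Ω) [IsProbabilityMeasure P]
    {ι : Type*} [Fintype ι] (lead : ι)
    (α σ hst hgo vmax hStar t₀ tf κ vStar : ℝ)
    (hσ : 0 < σ) (hvmax : 0 < vmax) (hhst : hst < hStar) (hhgo : hStar < hgo) (ht : t₀ < tf)
    (hκ : κ = CCC.rangeGradient hst hgo vmax)
    (hvStar : vStar = CCC.rangePolicy hst hgo vmax hStar)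
    (X : ι → ℝ → Ω → ℝ) (hX : CCC.IsGaussianInput P X)
    (hR : ∀ i j, Integrable (CCC.crossCorr P (X i) (X j)))
    (S : ι → ι → ℝ → ℂ) (hS : ∀ i j, S i j = CCC.crossPSD P (X i) (X j))
    (stab feas : Set ((ι → ℝ) × (ι → ℝ)))
    (hstab : stab = {p | CCC.AdmissibleDelays lead p.2 ∧ CCC.PlantStable α κ σ p.1})
    (hfeas : feas = {p | CCC.AdmissibleDelays lead p.2 ∧
      p.1 ∈ CCC.plantStableRegion α κ σ}) :
    -- the steady-state response exists and is wide-sense stationary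
    (∀ p ∈ stab, ∃ h v a : ℝ → Ω → ℝ,
      CCC.IsSteadyState P α κ σ lead p.1 p.2 X h v a ∧ CCC.IsWSS P v) ∧
    -- the objective is a well-defined nonnegative real number
    (∀ p ∈ stab,
      (∀ i j, IntegrableOn (CCC.costIntegrand α κ σ lead S p.1 p.2 i j) (Set.Ioi 0)) ∧
      (CCC.cost α κ σ lead S p.1 p.2).im = 0 ∧ 0 ≤ (CCC.cost α κ σ lead S p.1 p.2).re) ∧
    -- the expected energy is an increasing function of the objective
    (∀ p ∈ stab, ∀ h v a : ℝ → Ω → ℝ, CCC.IsSteadyState P α κ σ lead p.1 p.2 X h v a →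
      (∀ᵐ ω ∂P, IntervalIntegrable (fun t => (vStar + v t ω) * max (a t ω) 0) volume t₀ tf) ∧
      Integrable (CCC.energy vStar t₀ tf v a) P ∧
      ∫ ω, CCC.energy vStar t₀ tf v a ω ∂P =
        (tf - t₀) * (vStar / √(2 * Real.pi))
          * √((CCC.cost α κ σ lead S p.1 p.2).re / Real.pi)) ∧
    -- the two optimization problems have the same solutions
    (∀ h v a : (ι → ℝ) × (ι → ℝ) → ℝ → Ω → ℝ,
      (∀ p ∈ stab, CCC.IsSteadyState P α κ σ lead p.1 p.2 X (h p) (v p) (a p)) →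
      ∀ p : (ι → ℝ) × (ι → ℝ),
        (p ∈ stab ∧ IsMinOn (fun q => ∫ ω, CCC.energy vStar t₀ tf (v q) (a q) ω ∂P) stab p) ↔
        (p ∈ feas ∧ IsMinOn (fun q => (CCC.cost α κ σ lead S q.1 q.2).re) feas p)) := by
  have hκ0 : 0 < κ := by
    rw [hκ, CCC.rangeGradient]
    exact div_pos hvmax (by linarith)
  have hv0 : 0 < vStar := hvStar ▸ CCC.rangePolicy_pos hvmax hhst hhgo
  -- The root-location half enters only here; afterwards both problems have the same feasible set.
  have heq : feas = stab := by
    rw [hfeas, hstab]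
    ext p
    exact and_congr_right fun _ => (CCC.plantStable_iff_mem_plantStableRegion hκ0 hσ p.1).symm
  have hmem : ∀ p ∈ stab, p.2 lead = 0 ∧ CCC.PlantStable α κ σ p.1 := fun p hp => by
    rw [hstab] at hp
    exact ⟨hp.1.1, hp.2⟩
  refine ⟨fun p hp => CCC.exists_isSteadyState hX hR (hmem p hp).1 (hmem p hp).2,
    fun p hp => ⟨fun i j => (CCC.integrable_costIntegrand hX hR hS (hmem p hp).1
      (hmem p hp).2 i j).integrableOn, CCC.cost_im hX hR hS (hmem p hp).1 (hmem p hp).2,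
      CCC.cost_re_nonneg hX hR hS (hmem p hp).1 (hmem p hp).2⟩,
    fun p hp h v a hs => ⟨hs.ae_intervalIntegrable hX hR (hmem p hp).1 (hmem p hp).2 vStar ht.le,
      hs.integrable_energy hX hR (hmem p hp).1 (hmem p hp).2 vStar ht.le,
      hs.integral_energy hX hR hS (hmem p hp).1 (hmem p hp).2 vStar ht.le⟩, ?_⟩
  intro h v a hs p
  rw [heq]
  refine and_congr_right fun hp => ?_
  rw [isMinOn_iff, isMinOn_iff]
  refine forall₂_congr fun q hq => ?_
  -- The expected energy is a positive constant times √(J/π) with J ≥ 0, so comparing energies is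
  -- the same as comparing objectives.
  have hK : 0 < (tf - t₀) * (vStar / √(2 * Real.pi)) := by
    have : 0 < tf - t₀ := by linarith
    have : 0 < √(2 * Real.pi) := Real.sqrt_pos.2 (by positivity)
    positivity
  rw [(hs p hp).integral_energy hX hR hS (hmem p hp).1 (hmem p hp).2 vStar ht.le,
    (hs q hq).integral_energy hX hR hS (hmem q hq).1 (hmem q hq).2 vStar ht.le,
    mul_le_mul_iff_right₀ hK, Real.sqrt_le_sqrt_iff (div_nonneg
      (CCC.cost_re_nonneg hX hR hS (hmem q hq).1 (hmem q hq).2) Real.pi_pos.le),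
    div_le_div_iff_of_pos_right Real.pi_pos]
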